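/- **Definitions.** An $R$-Cartan structure on a smooth 3-manifold $\Sigma$ is a smooth coframing $\alpha=(\alpha^1,\alpha^2,\alpha^3)$ together with a smooth function $R$ such that $d\alpha^1=\alpha^2\wedge\alpha^3$, $d\alpha^2=-\alpha^1\wedge\alpha^3$, $d\alpha^3=R\,\alpha^1\wedge\alpha^2$. For a function $f$ on $\Sigma$ write $df=f_1\alpha^1+f_2\alpha^2+f_3\alpha^3$ and $f_{ij}=(f_i)_j$. For an open set $V\subset\Sigma$, a leaf space of the foliation $\{\alpha^1=0,\alpha^2=0\}$ of $V$ is a smooth (Hausdorff) surface $\Lambda$ with a surjective smooth submersion $\pi:V\to\Lambda$ whose fibers are exactly the leaves of the foliation in $V$. (If the foliation is amenable one may take $V=\Sigma$; in general $V$ is any open set on which it is amenable.) For $R_0>1$ put $$\Phi(r)=\Bigl[\bigl(R_0-\tfrac32\bigr)-\bigl(R_0-\tfrac32-\tfrac14r^2\bigr)e^{-r^2/2}\Bigr]^{1/2},\qquad \eta(r)=\frac{r\,e^{-r^2/4}}{2\Phi(r)},\qquad \varphi(r)=\frac{\Phi(r)}{R_0-1}.$$ **Theorem 6.1.** (1)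 Let $\Sigma$ be a connected (Hausdorff) smooth 3-manifold with an $R$-Cartan structure $\alpha$ satisfying $$R_3=0,\quad R_{11}=1-R-R_1^2,\quad R_{12}=-R_1R_2,\quad R_{22}=1-R-R_2^2,$$ with $R$ not identically $1$. Then there is a constant $R_0>1$ such that $$\bigl(R_1^2+R_2^2+R-\tfrac32\bigr)e^{2(R-1)}=\bigl(R_0-\tfrac32\bigr)e^{2(R_0-1)}\quad\text{on }\Sigma,$$ and for every open $V\subset\Sigma$ and every leaf space $\pi:V\to\Lambda$ of $\{\alpha^1=0,\alpha^2=0\}$ on $V$ there is exactly one smooth Riemannian metric $g$ on $\Lambda$ with $\pi^*g=(\alpha^1)^2+(\alpha^2)^2$ on $V$. This $g$ is locally rotationally symmetric, in the following sense. * At the image $\pi(x)$ of every $x\in V$ with $(R_1,R_2)(x)\ne(0,0)$ there are smooth local coordinates $(r,\theta)$ on $\Lambda$, with values in an open piece $(a,b)\times(c,d)$ of $I\times S^1$, where $0<a$, $d-c\le 2\pi$ and $\Phi>0$ on $(a,b)$, such that $$g=\eta(r)^2dr^2+\varphi(r)^2d\theta^2,\qquad R=R_0-\tfrac14r^2 .$$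 * At the image $\pi(x)$ of every $x\in V$ with $R(x)=R_0$ there are smooth local coordinates on $\Lambda$ with values in an open disc of the plane centered at the origin, sending $\pi(x)$ to the origin, such that $\Phi(r)>0$ for $r>0$ less than the radius of the disc, $R=R_0-\frac14r^2$, and $g=\eta(r)^2dr^2+\varphi(r)^2d\theta^2$ away from the origin, where $(r,\theta)$ are the polar coordinates of the plane. (2) For every $R_0>1$, $\eta(r)^2dr^2+\varphi(r)^2d\theta^2$ is a smooth rotationally symmetric Riemannian metric on the open region $\{r=0\}\cup\{\Phi(r)>0\}$ of the plane with polar coordinates $(r,\theta)$; that is, it extends across the origin to a smooth Riemannian metric that is invariant under the linear isometries of the plane. Moreover every $R_0>1$ occurs in (1): there is a Cartan structure on $\mathbb R^3$ satisfying the system above whose constant is $R_0$. -/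

import Mathlib

open Set Manifold Bundle
open scoped ContDiff Topology

noncomputable section

namespace CartanLeaf

/-- The Euclidean plane, the model of smooth surfaces. -/
abbrev E2 := EuclideanSpace ℝ (Fin 2)

/-- Euclidean 3-space, the model of smooth 3-manifolds. -/
abbrev E3 := EuclideanSpace ℝ (Fin 3)

section Forms

variable {S : Type*} [TopologicalSpace S] [ChartedSpace E3 S]

/-- A (not necessarily smooth) one-form on the 3-manifold `S`. -/
abbrev OneForm (S : Type*) [TopologicalSpace S] [ChartedSpace E3 S] :=
  (x : S) → TangentSpace (𝓡 3) x →L[ℝ] ℝ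

/-- Smoothness of a one-form, as a section of the cotangent bundle. -/
def SmoothForm [IsManifold (𝓡 3) ∞ S] (a : OneForm S) : Prop :=
  ContMDiff (𝓡 3) ((𝓡 3).prod 𝓘(ℝ, E3 →L[ℝ] ℝ)) ∞
    (fun x => TotalSpace.mk' (E3 →L[ℝ] ℝ)
      (E := fun x : S => TangentSpace (𝓡 3) x →L[ℝ] ℝ) x (a x))

/-- The one-form `a` read in the preferred chart at `x₀`: the pullback of `a` under the inverse
of this chart. -/
def chartForm (a : OneForm S) (x₀ : S) (z : E3) : E3 →L[ℝ] ℝ :=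
  (a ((extChartAt (𝓡 3) x₀).symm z)).comp
    (mfderiv 𝓘(ℝ, E3) (𝓡 3) (extChartAt (𝓡 3) x₀).symm z)

/-- The exterior derivative of a one-form at `x`, on two tangent vectors:
computed in the preferred chart at `x`, with the normalization
`da (v, w) = v (a w) - w (a v) - a [v, w]`. -/
def dForm (a : OneForm S) (x : S) (v w : TangentSpace (𝓡 3) x) : ℝ :=
  extDeriv (fun z => ContinuousAlternatingMap.ofSubsingleton ℝ E3 ℝ (0 : Fin 1)
      (chartForm a x z)) (extChartAt (𝓡 3) x x)
    ![mfderiv (𝓡 3) 𝓘(ℝ, E3) (extChartAt (𝓡 3) x) x v,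
      mfderiv (𝓡 3) 𝓘(ℝ, E3) (extChartAt (𝓡 3) x) x w]

/-- The wedge product of two one-forms, evaluated on two tangent vectors. -/
def wedge (a b : OneForm S) (x : S) (v w : TangentSpace (𝓡 3) x) : ℝ :=
  a x v * b x w - a x w * b x v

/-- `(α⁰, α¹, α²)` (the classical `(α¹, α², α³)`) is an `R`-Cartan structure on `S`: a smooth
coframing with
`dα¹ = α² ∧ α³`, `dα² = - α¹ ∧ α³`, `dα³ = R α¹ ∧ α²`. -/
structure IsCartanStructure [IsManifold (𝓡 3) ∞ S] (α : Fin 3 → OneForm S) (R : S → ℝ) :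
    Prop where
  smooth_form : ∀ i, SmoothForm (α i)
  smooth_R : ContMDiff (𝓡 3) 𝓘(ℝ, ℝ) ∞ R
  coframe : ∀ x, LinearIndependent ℝ (fun i => α i x)
  d_one : ∀ x v w, dForm (α 0) x v w = wedge (α 1) (α 2) x v w
  d_two : ∀ x v w, dForm (α 1) x v w = - wedge (α 0) (α 2) x v w
  d_three : ∀ x v w, dForm (α 2) x v w = R x * wedge (α 0) (α 1) x v w

/-- The frame dual to the coframe `α`: `dualFrame α i x` is the vector `v` with
`α j x v = δ i j` for all `j` (it exists and is unique for a coframe). -/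
def dualFrame (α : Fin 3 → OneForm S) (i : Fin 3) (x : S) : TangentSpace (𝓡 3) x :=
  Classical.epsilon fun v => ∀ j, α j x v = if j = i then 1 else 0

/-- The directional derivatives `f_i` of a function with respect to the coframe `α`, that is, the
coefficients in `df = f₁ α¹ + f₂ α² + f₃ α³`. -/
def cder (α : Fin 3 → OneForm S) (i : Fin 3) (f : S → ℝ) (x : S) : ℝ :=
  mfderiv (𝓡 3) 𝓘(ℝ, ℝ) f x (dualFrame α i x)

/-- The system `R₃ = 0`, `R₁₁ = 1 - R - R₁²`, `R₁₂ = - R₁ R₂`, `R₂₂ = 1 - R - R₂²`, where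
`R_{ij} = (R_i)_j`. -/
structure SatisfiesEDS (α : Fin 3 → OneForm S) (R : S → ℝ) : Prop where
  R3 : ∀ x, cder α 2 R x = 0
  R11 : ∀ x, cder α 0 (cder α 0 R) x = 1 - R x - cder α 0 R x ^ 2
  R12 : ∀ x, cder α 1 (cder α 0 R) x = - (cder α 0 R x * cder α 1 R x)
  R22 : ∀ x, cder α 1 (cder α 1 R) x = 1 - R x - cder α 1 R x ^ 2

/-- `(R₁² + R₂² + R - 3/2) e^{2(R - 1)}`. -/
def firstIntegral (α : Fin 3 → OneForm S) (R : S → ℝ) (x : S) : ℝ :=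
  (cder α 0 R x ^ 2 + cder α 1 R x ^ 2 + R x - 3 / 2) * Real.exp (2 * (R x - 1))

/-- `x` and `y` lie on the same leaf of the foliation `{α¹ = 0, α² = 0}` of the open set `V`:
they are joined inside `V` by a smooth curve along which `α¹` and `α²` vanish. -/
def SameLeaf (α : Fin 3 → OneForm S) (V : Set S) (x y : S) : Prop :=
  ∃ γ : ℝ → S, ContMDiff 𝓘(ℝ, ℝ) (𝓡 3) ∞ γ ∧ γ 0 = x ∧ γ 1 = y ∧
    ∀ t, γ t ∈ V ∧ α 0 (γ t) (mfderiv 𝓘(ℝ, ℝ) (𝓡 3) γ t (1 : ℝ)) = 0 ∧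
      α 1 (γ t) (mfderiv 𝓘(ℝ, ℝ) (𝓡 3) γ t (1 : ℝ)) = 0

variable {L : Type*} [TopologicalSpace L] [ChartedSpace E2 L]

/-- The surface `L` is, through the map `pr`, the leaf space of the foliation `{α¹ = 0, α² = 0}`
of the open set `V` (amenability of the foliation on `V`): `pr` is a smooth submersion of `V` onto
`L` whose fibers are exactly the leaves. Only the restriction of `pr` to `V` matters. -/
structure IsLeafSpace (α : Fin 3 → OneForm S) (V : Set S) (pr : S → L) : Prop where
  smooth : ContMDiffOn (𝓡 3) (𝓡 2) ∞ pr V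
  submersion : ∀ x ∈ V, Function.Surjective (mfderiv (𝓡 3) (𝓡 2) pr x)
  surj : pr '' V = univ
  fibers : ∀ x ∈ V, ∀ y ∈ V, pr x = pr y ↔ SameLeaf α V x y

/-- Smooth Riemannian metrics on the surface `L`. -/
abbrev RMetric (L : Type*) [TopologicalSpace L] [ChartedSpace E2 L] [IsManifold (𝓡 2) ∞ L] :=
  ContMDiffRiemannianMetric (𝓡 2) ∞ E2 (fun p : L => TangentSpace (𝓡 2) p)

/-- The metric `g` on the leaf space is induced by `α`: `pr^* g = (α¹)² + (α²)²` on `V`. -/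
def IsInduced [IsManifold (𝓡 2) ∞ L] (α : Fin 3 → OneForm S) (V : Set S) (pr : S → L)
    (g : RMetric L) : Prop :=
  ∀ x ∈ V, ∀ v w : TangentSpace (𝓡 3) x,
    g.inner (pr x) (mfderiv (𝓡 3) (𝓡 2) pr x v) (mfderiv (𝓡 3) (𝓡 2) pr x w)
      = α 0 x v * α 0 x w + α 1 x v * α 1 x w

end Forms

/-- `Φ(r) = [(R₀ - 3/2) - (R₀ - 3/2 - r²/4) e^{-r²/2}]^{1/2}`. -/
def Phi (R₀ r : ℝ) : ℝ :=
  Real.sqrt ((R₀ - 3 / 2) - (R₀ - 3 / 2 - r ^ 2 / 4) * Real.exp (-(r ^ 2 / 2)))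

/-- `η(r) = r e^{-r²/4} / (2 Φ(r))`. -/
def eta (R₀ r : ℝ) : ℝ := r * Real.exp (-(r ^ 2 / 4)) / (2 * Phi R₀ r)

/-- `φ(r) = Φ(r) / (R₀ - 1)`. -/
def phi (R₀ r : ℝ) : ℝ := Phi R₀ r / (R₀ - 1)

/-- The form `dr` of the polar coordinates of the punctured plane, at `z`, on the vector `v`. -/
def dRad (z v : E2) : ℝ := (z 0 * v 0 + z 1 * v 1) / ‖z‖

/-- The form `dθ` of the polar coordinates of the punctured plane, at `z`, on the vector `v`. -/
def dAng (z v : E2) : ℝ := (z 0 * v 1 - z 1 * v 0) / ‖z‖ ^ 2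

/-- The symmetric form `η(r)² dr² + φ(r)² dθ²` on the punctured plane, where `(r, θ)` are the
polar coordinates of the plane. -/
def polarMetric (R₀ : ℝ) (z v w : E2) : ℝ :=
  eta R₀ ‖z‖ ^ 2 * (dRad z v * dRad z w) + phi R₀ ‖z‖ ^ 2 * (dAng z v * dAng z w)

section Coordinates

variable {L : Type*} [TopologicalSpace L] [ChartedSpace E2 L] [IsManifold (𝓡 2) ∞ L]

/-- The differential at `q` of the `i`-th coordinate function of the chart `e`. -/
def dCoord (e : OpenPartialHomeomorph L E2) (i : Fin 2) (q : L) (v : TangentSpace (𝓡 2) q) : ℝ :=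
  mfderiv (𝓡 2) 𝓘(ℝ, ℝ) (fun q' => e q' i) q v

/-- The chart `e = (r, θ)` of the surface `L` identifies its domain with an open piece
`(a, b) × (c, d)` of `I × S¹`, where `0 < a` and `d - c ≤ 2π`, and in it
`g = η(r)² dr² + φ(r)² dθ²`. -/
def IsPolarChart (R₀ : ℝ) (g : RMetric L) (e : OpenPartialHomeomorph L E2) : Prop :=
  e ∈ IsManifold.maximalAtlas (𝓡 2) ∞ L ∧
  (∃ a b c d : ℝ, 0 < a ∧ d - c ≤ 2 * Real.pi ∧ (∀ r ∈ Ioo a b, 0 < Phi R₀ r) ∧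
    e.target = {z : E2 | z 0 ∈ Ioo a b ∧ z 1 ∈ Ioo c d}) ∧
  ∀ q ∈ e.source, ∀ v w : TangentSpace (𝓡 2) q,
    g.inner q v w =
      eta R₀ (e q 0) ^ 2 * (dCoord e 0 q v * dCoord e 0 q w) +
        phi R₀ (e q 0) ^ 2 * (dCoord e 1 q v * dCoord e 1 q w)

/-- The chart `e` identifies a neighborhood of `p` in `L` with a disc in the plane, `p` with the
center of the disc, and off `p` one has `g = η(r)² dr² + φ(r)² dθ²` in the polar coordinates
`(r, θ)` of the disc. -/
def IsPoleChart (R₀ : ℝ) (g : RMetric L) (p : L) (e : OpenPartialHomeomorph L E2) : Prop :=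
  e ∈ IsManifold.maximalAtlas (𝓡 2) ∞ L ∧ e p = 0 ∧
  (∃ ρ : ℝ, 0 < ρ ∧ (∀ r ∈ Ioo 0 ρ, 0 < Phi R₀ r) ∧ e.target = Metric.ball 0 ρ) ∧
  ∀ q ∈ e.source, q ≠ p → ∀ v w : TangentSpace (𝓡 2) q,
    g.inner q v w = polarMetric R₀ (e q) (mfderiv (𝓡 2) 𝓘(ℝ, E2) e q v)
      (mfderiv (𝓡 2) 𝓘(ℝ, E2) e q w)

end Coordinates

/-- The region `{r = 0} ∪ {Φ(r) > 0}` of the plane. -/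
def region (R₀ : ℝ) : Set E2 := {z | z = 0 ∨ 0 < Phi R₀ ‖z‖}

/-- `η(r)² dr² + φ(r)² dθ²` is (the restriction to the punctured region of) a smooth, rotationally
symmetric Riemannian metric `h` on the region `{r = 0} ∪ {Φ(r) > 0}` of the plane. -/
def IsSmoothRotational (R₀ : ℝ) : Prop :=
  IsOpen (region R₀) ∧
  ∃ h : E2 → E2 →L[ℝ] E2 →L[ℝ] ℝ,
    ContDiffOn ℝ ∞ h (region R₀) ∧
    (∀ z ∈ region R₀, ∀ v w, h z v w = h z w v) ∧
    (∀ z ∈ region R₀, ∀ v, v ≠ 0 → 0 < h z v v) ∧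
    (∀ z ∈ region R₀, ∀ (A : E2 ≃ₗᵢ[ℝ] E2) (v w : E2), h (A z) (A v) (A w) = h z v w) ∧
    ∀ z ∈ region R₀, z ≠ 0 → ∀ v w, h z v w = polarMetric R₀ z v w

end CartanLeaf

end

/-! Write p = R₁, q = R₂, s = p² + q². Applying d to dR = p α¹ + q α² gives p₃ = -q, q₃ = p and
equality of the mixed derivatives (`cder_mixed`), so the system closes up: dR, dp, dq are algebraic
in R, p, q and the coframe. `CartanSystem` records this in a form that survives pullback to any open
subset of a normed space. It implies ds = 2(1 - R - s) dR, so the first integral is locally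
constant. The function (u - 3/2) e^{2(u-1)} has its strict minimum at u = 1; hence R ≢ 1 allows the
constant to be written with a parameter R₀ > 1 (`exists_constant`).

With t = R₀ - R = r²/4 the first integral becomes s = e^{2t} t M(t), where M is analytic, M(0) =
2(R₀ - 1), and t M(t) is the radicand of Φ. Put B = p α² - q α¹. Then (α¹)² + (α²)² = (dR² + B²)/s.
The first term is a multiple of dr², and e^{-R} B / s is closed, so a suitable multiple of it is dθ
(`curl_angForm`, `CartanSystem.exists_polar`). Where R = R₀ the gradient (p, q) vanishes and these
coordinates degenerate; there (p, q) itself, rescaled to length r and rotated by an angle χ, gives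
Cartesian coordinates. The differential of χ must be -(h(R) B + α³) for a certain h, which is
regular at R₀ because of the factor R₀ - 1 in φ (`CartanSystem.curl_poleForm`,
`CartanSystem.exists_pole`).

Descent to the leaf space: a leaf space only says which points share a fiber, so it must first be
shown that α¹ and α² vanish on the kernel of the differential of the projection
(`IsFlowBox.forms_vertical_base`). Along a fiber the pair (α¹, α²) then merely rotates, with speed
given by α³, so (α¹)² + (α²)² descends (`CartanSystem.vertical_metric`), as does R. The normal forms
are computed on local sections of the projection.

For the second part, the polar metric is rewritten with analytic coefficients as a combination of
⟨v, w⟩ and ⟨z, v⟩⟨z, w⟩ (`rotMetric`), and a Cartan structure with given R₀ is found by running the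
normal form backwards (`modelForm`, `exists_cartanStructure`). -/

noncomputable section

namespace CartanLeaf

/-! ### Exterior calculus of one-forms on normed spaces -/

section Calculus

variable {E F : Type*} [NormedAddCommGroup E] [NormedSpace ℝ E]
  [NormedAddCommGroup F] [NormedSpace ℝ F]

/-- The exterior derivative of a one-form on a normed space. -/
def curl (a : E → E →L[ℝ] ℝ) (z v w : E) : ℝ := fderiv ℝ a z v w - fderiv ℝ a z w v

/-- Connects the exterior derivative of alternating maps, used in `dForm`, with the antisymmetrized
derivative; there is no factor 1/2. -/
lemma extDeriv_ofSubsingleton {a : E → E →L[ℝ] ℝ} {z : E} (h : DifferentiableAt ℝ a z) (v w : E) :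
    extDeriv (fun z => ContinuousAlternatingMap.ofSubsingleton ℝ E ℝ (0 : Fin 1) (a z)) z ![v, w]
      = curl a z v w := by
  have h' : DifferentiableAt ℝ
      (fun z => ContinuousAlternatingMap.ofSubsingleton ℝ E ℝ (0 : Fin 1) (a z)) z :=
    (ContinuousAlternatingMap.ofSubsingletonLIE (𝕜 := ℝ) (E := E) (F := ℝ)
      (0 : Fin 1)).toContinuousLinearEquiv.differentiableAt.comp z h
  rw [extDeriv_apply h']
  simp [Fin.sum_univ_two, curl, Fin.removeNth, fderiv_clm_apply, h]
  ring

lemma curl_congr {a a' : E → E →L[ℝ] ℝ} {z : E} (h : a =ᶠ[𝓝 z] a') (v w : E) :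
    curl a z v w = curl a' z v w := by
  simp only [curl, h.fderiv_eq]

lemma curl_add {a a' : E → E →L[ℝ] ℝ} {z : E} (h : DifferentiableAt ℝ a z)
    (h' : DifferentiableAt ℝ a' z) (v w : E) :
    curl (fun z => a z + a' z) z v w = curl a z v w + curl a' z v w := by
  simp only [curl, fderiv_fun_add h h', add_apply]; ring

lemma curl_sub {a a' : E → E →L[ℝ] ℝ} {z : E} (h : DifferentiableAt ℝ a z)
    (h' : DifferentiableAt ℝ a' z) (v w : E) :
    curl (fun z => a z - a' z) z v w = curl a z v w - curl a' z v w := by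
  simp only [curl, fderiv_fun_sub h h', sub_apply]; ring

lemma curl_smul {f : E → ℝ} {a : E → E →L[ℝ] ℝ} {z : E} (hf : DifferentiableAt ℝ f z)
    (h : DifferentiableAt ℝ a z) (v w : E) :
    curl (fun z => f z • a z) z v w =
      fderiv ℝ f z v * a z w - fderiv ℝ f z w * a z v + f z * curl a z v w := by
  simp only [curl, fderiv_fun_smul hf h, add_apply,
    smul_apply, ContinuousLinearMap.smulRight_apply, smul_eq_mul]; ring

lemma curl_fderiv {f : E → ℝ} {z : E} (hf : ContDiffAt ℝ 2 f z) (v w : E) :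
    curl (fderiv ℝ f) z v w = 0 := by
  have := (hf.isSymmSndFDerivAt (by simp)).eq v w
  simp only [curl]; linarith

/-- Naturality of d: the second derivative of `f` enters symmetrically and cancels on
antisymmetrization. -/
lemma curl_comp {a : F → F →L[ℝ] ℝ} {f : E → F} {z : E} (ha : DifferentiableAt ℝ a (f z))
    (hf : ContDiffAt ℝ 2 f z) (v w : E) :
    curl (fun z => (a (f z)).comp (fderiv ℝ f z)) z v w =
      curl a (f z) (fderiv ℝ f z v) (fderiv ℝ f z w) := by
  have hs := (hf.isSymmSndFDerivAt (by simp)).eq v w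
  have hd : DifferentiableAt ℝ f z := hf.differentiableAt (by norm_num)
  have hd2 : DifferentiableAt ℝ (fderiv ℝ f) z :=
    (hf.fderiv_right (m := 1) (by norm_num)).differentiableAt (by norm_num)
  simp only [curl]
  have hc : HasFDerivAt (fun z => a (f z)) ((fderiv ℝ a (f z)).comp (fderiv ℝ f z)) z :=
    ha.hasFDerivAt.comp z hd.hasFDerivAt
  rw [(hc.clm_comp hd2.hasFDerivAt).fderiv]
  simp [hs]

/-- A family of continuous linear maps on a finite-dimensional space is smooth at a point if all
its applications are. -/
lemma contDiffAt_clm_of_apply {G : Type*} [NormedAddCommGroup G] [NormedSpace ℝ G]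
    {n : WithTop ℕ∞} {f : F → E →L[ℝ] G} {z : F} [FiniteDimensional ℝ E]
    (h : ∀ v, ContDiffAt ℝ n (fun x => f x v) z) : ContDiffAt ℝ n f z := by
  have hd : Module.finrank ℝ E = Module.finrank ℝ (Fin (Module.finrank ℝ E) → ℝ) := by simp
  let e₁ := ContinuousLinearEquiv.ofFinrankEq hd
  let e₂ := (e₁.arrowCongr (1 : G ≃L[ℝ] G)).trans (ContinuousLinearEquiv.piRing _)
  have : f = e₂.symm ∘ (e₂ ∘ f) := by ext; simp
  rw [this]
  exact e₂.symm.contDiff.contDiffAt.comp z (contDiffAt_pi.2 fun i => h _)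

/-- The Poincaré lemma for one-forms near a point. -/
lemma exists_primitive [CompleteSpace E] {a : E → E →L[ℝ] ℝ} {W : Set E} (hW : IsOpen W)
    (haW : ContDiffOn ℝ ∞ a W) (hc : ∀ z ∈ W, ∀ v w, curl a z v w = 0) {z₀ : E} (hz : z₀ ∈ W)
    (y : ℝ) :
    ∃ ε > 0, ∃ f : E → ℝ, Metric.ball z₀ ε ⊆ W ∧ f z₀ = y ∧
      ContDiffOn ℝ ∞ f (Metric.ball z₀ ε) ∧
      ∀ z ∈ Metric.ball z₀ ε, HasFDerivAt f (a z) z := by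
  obtain ⟨ε, hε, hb⟩ := Metric.isOpen_iff.1 hW z₀ hz
  obtain ⟨f, hf'⟩ := (convex_ball z₀ ε).exists_forall_hasFDerivAt_of_fderiv_symmetric
    Metric.isOpen_ball  ((haW.mono hb).differentiableOn (by simp))
    (fun z hz x y => sub_eq_zero.1 (hc z (hb hz) x y))
  have hs : ContDiffOn ℝ ∞ f (Metric.ball z₀ ε) := by
    rw [contDiffOn_infty_iff_fderiv_of_isOpen Metric.isOpen_ball]
    exact ⟨fun z hz => (hf' z hz).differentiableAt.differentiableWithinAt,
      (haW.mono hb).congr fun z hz => (hf' z hz).fderiv⟩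
  refine ⟨ε, hε, fun z => f z - f z₀ + y, hb, by simp, (hs.sub contDiffOn_const).add contDiffOn_const,
    fun z hz => ((hf' z hz).sub_const _).add_const _⟩

end Calculus

/-! ### Pulling back one-forms from the manifold -/

section Pullback

variable {S : Type*} [TopologicalSpace S] [ChartedSpace E3 S]
  {E : Type*} [NormedAddCommGroup E] [NormedSpace ℝ E]

/-- The pullback of a one-form under a map from a normed space. -/
def pullForm (f : E → S) (a : OneForm S) (u : E) : E →L[ℝ] ℝ :=
  (a (f u)).comp (mfderiv 𝓘(ℝ, E) (𝓡 3) f u)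

lemma pullForm_apply (f : E → S) (a : OneForm S) (u v : E) :
    pullForm f a u v = a (f u) (mfderiv 𝓘(ℝ, E) (𝓡 3) f u v) := rfl

variable [IsManifold (𝓡 3) ∞ S]

lemma contDiffAt_pullForm [FiniteDimensional ℝ E] {f : E → S} {a : OneForm S} {u : E}
    (hf : ContMDiffAt 𝓘(ℝ, E) (𝓡 3) ∞ f u) (ha : SmoothForm a) :
    ContDiffAt ℝ ∞ (pullForm f a) u := by
  refine contDiffAt_clm_of_apply ?_
  intro v
  have h1 : ContMDiffAt 𝓘(ℝ, E) ((𝓡 3).prod (𝓡 3)) ∞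
      (fun u' => TotalSpace.mk' E3 (E := fun x : S => TangentSpace (𝓡 3) x) (f u')
        (mfderiv 𝓘(ℝ, E) (𝓡 3) f u' v)) u := by
    have hv : ContMDiffAt 𝓘(ℝ, E) (𝓘(ℝ, E).prod 𝓘(ℝ, E)) ∞
        (fun u' => TotalSpace.mk' E (E := fun x : E => TangentSpace 𝓘(ℝ, E) x) u' v) u := by
      exact contMDiffAt_vectorSpace_iff_contDiffAt.2 contDiffAt_const
    exact ContMDiffAt.clm_apply_of_inCoordinates (hf.mfderiv_const (m := ∞) (by simp)) hv hf
  have h2 : ContMDiffAt 𝓘(ℝ, E) ((𝓡 3).prod 𝓘(ℝ, E3 →L[ℝ] ℝ)) ∞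
    (fun u' => TotalSpace.mk' (E3 →L[ℝ] ℝ)
      (E := fun x : S => TangentSpace (𝓡 3) x →L[ℝ] ℝ) (f u') (a (f u'))) u :=
    ContMDiffAt.comp u (ha (f u)) hf
  have h3 := ContMDiffAt.clm_bundle_apply (E₂ := fun _ : S => ℝ) (F₂ := ℝ) h2 h1
  rw [contMDiffAt_totalSpace] at h3
  have := h3.2
  simp at this
  exact this.contDiffAt

/-- `dForm` at `f u` is defined through the preferred chart there, so near `u` the pullback is
factored through that chart and `curl_comp` applies. All use of the structure equations passes
through this lemma. -/
lemma curl_pullForm [FiniteDimensional ℝ E] {f : E → S} {a : OneForm S} {u : E}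
    (hf : ContMDiffAt 𝓘(ℝ, E) (𝓡 3) ∞ f u) (ha : SmoothForm a) (v w : E) :
    curl (pullForm f a) u v w = dForm a (f u) (mfderiv 𝓘(ℝ, E) (𝓡 3) f u v)
      (mfderiv 𝓘(ℝ, E) (𝓡 3) f u w) := by
  set φ := extChartAt (𝓡 3) (f u) with hφ
  have hsymm : ContMDiffAt 𝓘(ℝ, E3) (𝓡 3) ∞ φ.symm (φ (f u)) :=
    (contMDiffOn_extChartAt_symm (f u)).contMDiffAt (extChartAt_target_mem_nhds (f u))
  have hg : ContMDiffAt 𝓘(ℝ, E) 𝓘(ℝ, E3) ∞ (φ ∘ f) u :=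
    ContMDiffAt.comp u (contMDiffAt_extChartAt) hf
  have hc : ∀ z, chartForm a (f u) z = pullForm φ.symm a z := fun z => rfl
  have key : pullForm f a =ᶠ[𝓝 u]
      fun u' => (chartForm a (f u) ((φ ∘ f) u')).comp (fderiv ℝ (φ ∘ f) u') := by
    have hsrc : ∀ᶠ u' in 𝓝 u, f u' ∈ (chartAt E3 (f u)).source :=
      hf.continuousAt ((chartAt E3 (f u)).open_source.mem_nhds (mem_chart_source _ _))
    have hnb : ∀ᶠ u' in 𝓝 u, ContMDiffAt 𝓘(ℝ, E) (𝓡 3) 1 f u' :=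
      (contMDiffAt_iff_contMDiffAt_nhds (by simp)).1 (hf.of_le (by norm_cast))
    filter_upwards [hsrc, hnb, hsrc.eventually_nhds] with u' hs hn hev
    have hs' : φ (f u') ∈ φ.target := φ.map_source (by simpa [hφ] using hs)
    have h1 : ContMDiffAt 𝓘(ℝ, E3) (𝓡 3) 1 φ.symm (φ (f u')) :=
      ((contMDiffOn_extChartAt_symm (f u)).contMDiffAt
        ((isOpen_extChartAt_target (f u)).mem_nhds hs'))
    have h2 : ContMDiffAt 𝓘(ℝ, E) 𝓘(ℝ, E3) 1 (φ ∘ f) u' :=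
      ContMDiffAt.comp u' (contMDiffAt_extChartAt' hs) hn
    have h3 : f =ᶠ[𝓝 u'] φ.symm ∘ (φ ∘ f) := by
      filter_upwards [hev] with y hy
      exact (φ.left_inv (by simpa [hφ] using hy)).symm
    have h4 : mfderiv 𝓘(ℝ, E) (𝓡 3) f u' = (mfderiv 𝓘(ℝ, E3) (𝓡 3) φ.symm (φ (f u'))).comp
        (fderiv ℝ (φ ∘ f) u') := by
      rw [h3.mfderiv_eq, ← mfderiv_eq_fderiv]
      exact mfderiv_comp u' (h1.mdifferentiableAt (by simp)) (h2.mdifferentiableAt (by simp))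
    have h5 : φ.symm (φ (f u')) = f u' := φ.left_inv (by simpa [hφ] using hs)
    ext v
    rw [pullForm_apply, h4]
    simp only [chartForm, Function.comp]
    rw [← hφ, h5]
    rfl
  have hda : ContDiffAt ℝ ∞ (chartForm a (f u)) (φ (f u)) := contDiffAt_pullForm hsymm ha
  have : fderiv ℝ (φ ∘ f) u =
    (mfderiv (𝓡 3) 𝓘(ℝ, E3) φ (f u)).comp (mfderiv 𝓘(ℝ, E) (𝓡 3) f u) := by
    rw [← mfderiv_eq_fderiv]
    exact mfderiv_comp u (mdifferentiableAt_extChartAt (mem_chart_source _ _)) (hf.mdifferentiableAt (by simp))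
  have h1 := (curl_congr key v w).trans (curl_comp (f := φ ∘ f) (hda.differentiableAt (by simp))
    (hg.contDiffAt.of_le (by norm_cast)) v w)
  rw [this] at h1
  exact h1.trans (extDeriv_ofSubsingleton (hda.differentiableAt (by simp)) _ _).symm

end Pullback

/-! ### Coframes, dual frames and directional derivatives -/

section Frames

/-- The linear map with a given family of three components. -/
def coMap {E : Type*} [NormedAddCommGroup E] [NormedSpace ℝ E] (l : Fin 3 → E →L[ℝ] ℝ) :
    E →L[ℝ] (Fin 3 → ℝ) := ContinuousLinearMap.pi l

/-- Three independent functionals span the dual space, so a common zero is also a zero of every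
coordinate and vanishes. -/
lemma exists_equiv_of_linearIndependent {l : Fin 3 → E3 →L[ℝ] ℝ} (h : LinearIndependent ℝ l) :
    ∃ e : E3 ≃L[ℝ] (Fin 3 → ℝ), (e : E3 →L[ℝ] (Fin 3 → ℝ)) = coMap l := by
  have hinj : Function.Injective (coMap l : E3 →ₗ[ℝ] (Fin 3 → ℝ)) := by
    rw [injective_iff_map_eq_zero]
    intro v hv
    have hspan : Submodule.span ℝ (Set.range l) = ⊤ := by
      apply h.span_eq_top_of_card_eq_finrank'
      rw [(LinearMap.toContinuousLinearMap (𝕜 := ℝ) (E := E3) (F' := ℝ)).symm.finrank_eq]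
      simp
    have h0 : ∀ m : E3 →L[ℝ] ℝ, m v = 0 := by
      intro m
      have hm : m ∈ Submodule.span ℝ (Set.range l) := hspan ▸ Submodule.mem_top
      induction hm using Submodule.span_induction with
      | mem x hx => obtain ⟨i, rfl⟩ := hx; exact congrFun hv i
      | zero => simp
      | add x y _ _ hx hy => simp [hx, hy]
      | smul c x _ hx => simp [hx]
    ext i
    exact h0 (EuclideanSpace.proj i)
  let e := LinearEquiv.ofInjectiveOfFinrankEq (coMap l : E3 →ₗ[ℝ] (Fin 3 → ℝ)) hinj (by simp)
  exact ⟨e.toContinuousLinearEquiv, by ext; rfl⟩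

lemma exists_dual {l : Fin 3 → E3 →L[ℝ] ℝ} (h : LinearIndependent ℝ l) (i : Fin 3) :
    ∃ v, ∀ j, l j v = if j = i then 1 else 0 := by
  obtain ⟨e, he⟩ := exists_equiv_of_linearIndependent h
  refine ⟨e.symm (Pi.single i 1), fun j => ?_⟩
  have : coMap l (e.symm (Pi.single i 1)) = Pi.single i 1 := by
    rw [← he]; simp
  have := congrFun this j
  simpa [coMap, Pi.single_apply] using this

lemma ext_of_linearIndependent {l : Fin 3 → E3 →L[ℝ] ℝ} (h : LinearIndependent ℝ l) {v w : E3}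
    (hvw : ∀ j, l j v = l j w) : v = w := by
  obtain ⟨e, he⟩ := exists_equiv_of_linearIndependent h
  apply e.injective
  have : coMap l v = coMap l w := funext hvw
  rwa [← he] at this

variable {S : Type*} [TopologicalSpace S] [ChartedSpace E3 S]

lemma apply_dualFrame {α : Fin 3 → OneForm S} {x : S} (h : LinearIndependent ℝ (fun i => α i x))
    (i j : Fin 3) : α j x (dualFrame α i x) = if j = i then 1 else 0 :=
  Classical.epsilon_spec (exists_dual h i) j

lemma eq_sum_dualFrame {α : Fin 3 → OneForm S} {x : S} (h : LinearIndependent ℝ (fun i => α i x))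
    (v : TangentSpace (𝓡 3) x) : v = ∑ i, α i x v • dualFrame α i x := by
  refine ext_of_linearIndependent h fun j => ?_
  have : α j x v = α j x (∑ i, α i x v • dualFrame α i x) := by
    rw [map_sum]
    simp only [map_smul, apply_dualFrame h, smul_eq_mul]
    simp
  exact this

lemma mfderiv_eq_sum {α : Fin 3 → OneForm S} {x : S} (h : LinearIndependent ℝ (fun i => α i x))
    (f : S → ℝ) (v : TangentSpace (𝓡 3) x) :
    mfderiv (𝓡 3) 𝓘(ℝ, ℝ) f x v = ∑ i, cder α i f x * α i x v := by
  conv_lhs => rw [eq_sum_dualFrame h v]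
  rw [map_sum]
  refine Finset.sum_congr rfl fun i _ => ?_
  rw [map_smul, mul_comm]; rfl

lemma cder_eq_of_mfderiv_eq {α : Fin 3 → OneForm S} {x : S}
    (h : LinearIndependent ℝ (fun i => α i x)) {f : S → ℝ} {c : Fin 3 → ℝ}
    (hc : ∀ v, mfderiv (𝓡 3) 𝓘(ℝ, ℝ) f x v = ∑ i, c i * α i x v) (i : Fin 3) :
    cder α i f x = c i := by
  have := hc (dualFrame α i x)
  simp only [apply_dualFrame h] at this
  have h2 : ∑ j, c j * (if j = i then (1 : ℝ) else 0) = c i := by simp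
  exact this.trans h2

variable {E : Type*} [NormedAddCommGroup E] [NormedSpace ℝ E]

lemma mfderiv_comp_real {f : S → ℝ} {g : E → S} {u : E}
    (hf : MDifferentiableAt (𝓡 3) 𝓘(ℝ, ℝ) f (g u)) (hg : MDifferentiableAt 𝓘(ℝ, E) (𝓡 3) g u)
    (v : E) : fderiv ℝ (f ∘ g) u v =
      mfderiv (𝓡 3) 𝓘(ℝ, ℝ) f (g u) (mfderiv 𝓘(ℝ, E) (𝓡 3) g u v) := by
  rw [← mfderiv_eq_fderiv, mfderiv_comp u hf hg]; rfl

lemma fderiv_comp_eq_sum {α : Fin 3 → OneForm S} {f : S → ℝ} {g : E → S} {u : E}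
    (h : LinearIndependent ℝ (fun i => α i (g u)))
    (hf : MDifferentiableAt (𝓡 3) 𝓘(ℝ, ℝ) f (g u)) (hg : MDifferentiableAt 𝓘(ℝ, E) (𝓡 3) g u)
    (v : E) : fderiv ℝ (f ∘ g) u v = ∑ i, cder α i f (g u) * pullForm g (α i) u v := by
  rw [mfderiv_comp_real hf hg, mfderiv_eq_sum h]; rfl

variable [IsManifold (𝓡 3) ∞ S]

lemma contMDiffAt_symm_extChartAt {x₀ : S} {z : E3} (hz : z ∈ (extChartAt (𝓡 3) x₀).target) :
    ContMDiffAt 𝓘(ℝ, E3) (𝓡 3) ∞ (extChartAt (𝓡 3) x₀).symm z :=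
  (contMDiffOn_extChartAt_symm x₀).contMDiffAt ((isOpen_extChartAt_target x₀).mem_nhds hz)

lemma exists_equiv_mfderiv_symm {x₀ : S} {z : E3} (hz : z ∈ (extChartAt (𝓡 3) x₀).target) :
    ∃ e : E3 ≃L[ℝ] E3, (e : E3 →L[ℝ] E3) = mfderiv 𝓘(ℝ, E3) (𝓡 3) (extChartAt (𝓡 3) x₀).symm z := by
  have := isInvertible_mfderivWithin_extChartAt_symm (I := 𝓡 3) hz
  rw [ModelWithCorners.range_eq_univ, mfderivWithin_univ] at this
  exact this

/-- The dual frame is chosen pointwise, so its smoothness has to be earned: in a chart it is the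
image of a basis vector under the inverse of the coframe map, and inversion is smooth at invertible
maps. -/
lemma contMDiff_cder {α : Fin 3 → OneForm S} (hα : ∀ i, SmoothForm (α i))
    (h : ∀ x, LinearIndependent ℝ (fun i => α i x)) {f : S → ℝ} (hf : ContMDiff (𝓡 3) 𝓘(ℝ, ℝ) ∞ f)
    (i : Fin 3) : ContMDiff (𝓡 3) 𝓘(ℝ, ℝ) ∞ (cder α i f) := by
  intro x₀
  set φ := extChartAt (𝓡 3) x₀ with hφ
  set A : E3 → E3 →L[ℝ] (Fin 3 → ℝ) := fun z => coMap fun j => pullForm φ.symm (α j) z with hA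
  have hAs : ∀ z ∈ φ.target, ContDiffAt ℝ ∞ A z := fun z hz =>
    contDiffAt_clm_of_apply fun v => contDiffAt_pi.2 fun j =>
      (contDiffAt_pullForm (contMDiffAt_symm_extChartAt hz) (hα j)).clm_apply contDiffAt_const
  have hAe : ∀ z ∈ φ.target, ∃ e : E3 ≃L[ℝ] (Fin 3 → ℝ), (e : E3 →L[ℝ] (Fin 3 → ℝ)) = A z := by
    intro z hz
    obtain ⟨e, he⟩ := exists_equiv_mfderiv_symm hz
    obtain ⟨e', he'⟩ := exists_equiv_of_linearIndependent (h (φ.symm z))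
    refine ⟨e.trans e', ?_⟩
    ext v j
    change e' (e v) j = _
    have h1 : e' (e v) = coMap (fun j => α j (φ.symm z)) (e v) := by rw [← he']; rfl
    have h2 : e v = mfderiv 𝓘(ℝ, E3) (𝓡 3) φ.symm z v := by rw [← he]; rfl
    rw [h1, h2]; rfl
  have key : ∀ z ∈ φ.target, cder α i f (φ.symm z) =
      fderiv ℝ (f ∘ φ.symm) z ((A z).inverse (Pi.single i 1)) := by
    intro z hz
    obtain ⟨e, he⟩ := hAe z hz
    rw [← he, ContinuousLinearMap.inverse_equiv,
      fderiv_comp_eq_sum (h _) ((hf _).mdifferentiableAt (by simp))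
      ((contMDiffAt_symm_extChartAt hz).mdifferentiableAt (by simp))]
    have h1 : ∀ j, pullForm φ.symm (α j) z (e.symm (Pi.single i 1)) = if j = i then 1 else 0 := by
      intro j
      have h2 : A z (e.symm (Pi.single i 1)) = Pi.single i 1 := by rw [← he]; simp
      have := congrFun h2 j
      simpa [hA, coMap, Pi.single_apply] using this
    trans ∑ j, cder α j f (φ.symm z) * (if j = i then (1 : ℝ) else 0)
    · simp only [mul_ite, mul_one, mul_zero, Finset.sum_ite_eq', Finset.mem_univ, if_true]
    · exact Finset.sum_congr rfl fun j _ => congrArg (cder α j f (φ.symm z) * ·) (h1 j).symm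
  have hsm : ∀ z ∈ φ.target,
      ContDiffAt ℝ ∞ (fun z => fderiv ℝ (f ∘ φ.symm) z ((A z).inverse (Pi.single i 1))) z := by
    intro z hz
    have h1 : ContDiffAt ℝ ∞ (f ∘ φ.symm) z :=
      (ContMDiffAt.comp z (hf _) (contMDiffAt_symm_extChartAt hz)).contDiffAt
    obtain ⟨e, he⟩ := hAe z hz
    have h2 : ContDiffAt ℝ ∞ (fun z => (A z).inverse) z :=
      ContDiffAt.comp z (g := ContinuousLinearMap.inverse)
        (by rw [← he]; exact contDiffAt_map_inverse e) (hAs z hz)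
    exact (h1.fderiv_right (by simp)).clm_apply (h2.clm_apply contDiffAt_const)
  have hx : φ x₀ ∈ φ.target := mem_extChartAt_target x₀
  have : ContMDiffAt (𝓡 3) 𝓘(ℝ, ℝ) ∞
      ((fun z => fderiv ℝ (f ∘ φ.symm) z ((A z).inverse (Pi.single i 1))) ∘ φ) x₀ :=
    ContMDiffAt.comp x₀ (hsm _ hx).contMDiffAt contMDiffAt_extChartAt
  refine this.congr_of_eventuallyEq ?_
  filter_upwards [extChartAt_source_mem_nhds (I := 𝓡 3) x₀] with y hy
  rw [Function.comp, ← key _ (φ.map_source hy), φ.left_inv hy]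

end Frames

/-! ### The closed differential system and its pullbacks -/

section System

variable {E : Type*} [NormedAddCommGroup E] [NormedSpace ℝ E]

/-- The structure equations of a Cartan structure satisfying the system, with `p = R₁`, `q = R₂`,
for one-forms `a, b, c` on an open subset `W` of a normed space (which need not be a coframe). -/
structure CartanSystem (W : Set E) (a b c : E → E →L[ℝ] ℝ) (R p q : E → ℝ) : Prop where
  smooth_a : ContDiffOn ℝ ∞ a W
  smooth_b : ContDiffOn ℝ ∞ b W
  smooth_c : ContDiffOn ℝ ∞ c W
  smooth_R : ContDiffOn ℝ ∞ R W
  smooth_p : ContDiffOn ℝ ∞ p W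
  smooth_q : ContDiffOn ℝ ∞ q W
  curl_a : ∀ z ∈ W, ∀ v w, curl a z v w = b z v * c z w - b z w * c z v
  curl_b : ∀ z ∈ W, ∀ v w, curl b z v w = -(a z v * c z w - a z w * c z v)
  curl_c : ∀ z ∈ W, ∀ v w, curl c z v w = R z * (a z v * b z w - a z w * b z v)
  dR : ∀ z ∈ W, ∀ v, fderiv ℝ R z v = p z * a z v + q z * b z v
  dp : ∀ z ∈ W, ∀ v, fderiv ℝ p z v =
    (1 - R z - p z ^ 2) * a z v - p z * q z * b z v - q z * c z v
  dq : ∀ z ∈ W, ∀ v, fderiv ℝ q z v =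
    -(p z * q z) * a z v + (1 - R z - q z ^ 2) * b z v + p z * c z v

variable {S : Type*} [TopologicalSpace S] [ChartedSpace E3 S] [IsManifold (𝓡 3) ∞ S]
  {α : Fin 3 → OneForm S} {R : S → ℝ}

/-- The mixed derivatives of `R` that follow from `d(dR) = 0`. -/
lemma cder_mixed (hα : IsCartanStructure α R) (hR : ∀ x, cder α 2 R x = 0) (x : S) :
    cder α 0 (cder α 1 R) x = cder α 1 (cder α 0 R) x ∧
    cder α 2 (cder α 0 R) x = -cder α 1 R x ∧ cder α 2 (cder α 1 R) x = cder α 0 R x := by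
  set φ := extChartAt (𝓡 3) x with hφ
  have hx : φ x ∈ φ.target := mem_extChartAt_target x
  have hxx : φ.symm (φ x) = x := extChartAt_to_inv x
  have hs : ∀ z ∈ φ.target, ContMDiffAt 𝓘(ℝ, E3) (𝓡 3) ∞ φ.symm z :=
    fun z hz => contMDiffAt_symm_extChartAt hz
  have hsm : ∀ i, ContMDiff (𝓡 3) 𝓘(ℝ, ℝ) ∞ (cder α i R) :=
    contMDiff_cder hα.smooth_form hα.coframe hα.smooth_R
  have hdR : fderiv ℝ (R ∘ φ.symm) =ᶠ[𝓝 (φ x)] fun z =>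
      (cder α 0 R ∘ φ.symm) z • pullForm φ.symm (α 0) z +
        (cder α 1 R ∘ φ.symm) z • pullForm φ.symm (α 1) z := by
    filter_upwards [(isOpen_extChartAt_target x).mem_nhds hx] with z hz
    ext v
    rw [fderiv_comp_eq_sum (hα.coframe _) ((hα.smooth_R _).mdifferentiableAt (by simp))
      ((hs z hz).mdifferentiableAt (by simp))]
    simp [Fin.sum_univ_three, hR]
  have hfs : ∀ f : S → ℝ, ContMDiff (𝓡 3) 𝓘(ℝ, ℝ) ∞ f → ContDiffAt ℝ ∞ (f ∘ φ.symm) (φ x) :=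
    fun f hf => (ContMDiffAt.comp (φ x) (hf _) (hs _ hx)).contDiffAt
  have hd : ∀ f : S → ℝ, ContMDiff (𝓡 3) 𝓘(ℝ, ℝ) ∞ f → DifferentiableAt ℝ (f ∘ φ.symm) (φ x) :=
    fun f hf => (hfs f hf).differentiableAt (by simp)
  have hda : ∀ i, DifferentiableAt ℝ (pullForm φ.symm (α i)) (φ x) := fun i =>
    (contDiffAt_pullForm (hs _ hx) (hα.smooth_form i)).differentiableAt (by simp)
  have hfd : ∀ f : S → ℝ, ContMDiff (𝓡 3) 𝓘(ℝ, ℝ) ∞ f → ∀ v, fderiv ℝ (f ∘ φ.symm) (φ x) v =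
      ∑ i, cder α i f x * pullForm φ.symm (α i) (φ x) v := by
    intro f hf v
    have := fderiv_comp_eq_sum (hα.coframe _) ((hf _).mdifferentiableAt (by simp))
      ((hs _ hx).mdifferentiableAt (by simp)) v
    rw [this]
    refine Finset.sum_congr rfl fun i _ => ?_
    rw [hxx]
  have key : ∀ v w, 0 = curl (fderiv ℝ (R ∘ φ.symm)) (φ x) v w := fun v w =>
    (curl_fderiv ((hfs R hα.smooth_R).of_le (by norm_cast)) v w).symm
  have hca : ∀ v w, curl (pullForm φ.symm (α 0)) (φ x) v w =
      pullForm φ.symm (α 1) (φ x) v * pullForm φ.symm (α 2) (φ x) w -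
        pullForm φ.symm (α 1) (φ x) w * pullForm φ.symm (α 2) (φ x) v := fun v w => by
    rw [curl_pullForm (hs _ hx) (hα.smooth_form 0)]; exact hα.d_one _ _ _
  have hcb : ∀ v w, curl (pullForm φ.symm (α 1)) (φ x) v w =
      -(pullForm φ.symm (α 0) (φ x) v * pullForm φ.symm (α 2) (φ x) w -
        pullForm φ.symm (α 0) (φ x) w * pullForm φ.symm (α 2) (φ x) v) := fun v w => by
    rw [curl_pullForm (hs _ hx) (hα.smooth_form 1)]; exact hα.d_two _ _ _
  -- Expands 0 = d(dR) = dp ∧ α¹ + p dα¹ + dq ∧ α² + q dα². Its values on pairs of dual frame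
  -- vectors are the three claims.
  have key2 : ∀ v w, _ := fun v w => (key v w).trans ((curl_congr hdR v w).trans
    ((curl_add ((hd _ (hsm 0)).smul (hda 0)) ((hd _ (hsm 1)).smul (hda 1)) v w).trans
    (congrArg₂ (· + ·) (curl_smul (hd _ (hsm 0)) (hda 0) v w)
      (curl_smul (hd _ (hsm 1)) (hda 1) v w))))
  simp only [hfd _ (hsm _), hca, hcb, Function.comp, hxx, Fin.sum_univ_three] at key2
  have hdual : ∀ i, ∃ v, ∀ j, pullForm φ.symm (α j) (φ x) v = if j = i then 1 else 0 := by
    intro i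
    obtain ⟨e, he⟩ := exists_equiv_mfderiv_symm hx
    obtain ⟨v, hv⟩ := exists_dual (hα.coframe (φ.symm (φ x))) i
    refine ⟨e.symm v, fun j => ?_⟩
    rw [← hv j, pullForm_apply]
    have : mfderiv 𝓘(ℝ, E3) (𝓡 3) φ.symm (φ x) (e.symm v) = e (e.symm v) := by rw [← he]; rfl
    rw [this, e.apply_symm_apply]
    rfl
  obtain ⟨v0, h0⟩ := hdual 0
  obtain ⟨v1, h1⟩ := hdual 1
  obtain ⟨v2, h2⟩ := hdual 2
  have k01 := key2 v0 v1
  have k02 := key2 v0 v2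
  have k12 := key2 v1 v2
  simp [h0, h1, h2] at k01 k02 k12
  refine ⟨?_, ?_, ?_⟩ <;> linarith

/-- The pullback of a Cartan structure satisfying the system. -/
theorem cartanSystem_pullForm [FiniteDimensional ℝ E] (hα : IsCartanStructure α R)
    (hR : SatisfiesEDS α R) {W : Set E} (hW : IsOpen W) {f : E → S}
    (hf : ContMDiffOn 𝓘(ℝ, E) (𝓡 3) ∞ f W) :
    CartanSystem W (pullForm f (α 0)) (pullForm f (α 1)) (pullForm f (α 2)) (R ∘ f)
      (cder α 0 R ∘ f) (cder α 1 R ∘ f) := by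
  have hf' : ∀ z ∈ W, ContMDiffAt 𝓘(ℝ, E) (𝓡 3) ∞ f z := fun z hz => hf.contMDiffAt (hW.mem_nhds hz)
  have hsm : ∀ i, ContMDiff (𝓡 3) 𝓘(ℝ, ℝ) ∞ (cder α i R) :=
    contMDiff_cder hα.smooth_form hα.coframe hα.smooth_R
  have hfs : ∀ g : S → ℝ, ContMDiff (𝓡 3) 𝓘(ℝ, ℝ) ∞ g → ContDiffOn ℝ ∞ (g ∘ f) W :=
    fun g hg z hz => (ContMDiffAt.comp z (hg _) (hf' z hz)).contDiffAt.contDiffWithinAt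
  have hfa : ∀ i, ContDiffOn ℝ ∞ (pullForm f (α i)) W := fun i z hz =>
    (contDiffAt_pullForm (hf' z hz) (hα.smooth_form i)).contDiffWithinAt
  have hfd : ∀ g : S → ℝ, ContMDiff (𝓡 3) 𝓘(ℝ, ℝ) ∞ g → ∀ z ∈ W, ∀ v, fderiv ℝ (g ∘ f) z v =
      ∑ i, cder α i g (f z) * pullForm f (α i) z v := fun g hg z hz v =>
    fderiv_comp_eq_sum (hα.coframe _) ((hg _).mdifferentiableAt (by simp))
      ((hf' z hz).mdifferentiableAt (by simp)) v
  refine ⟨hfa 0, hfa 1, hfa 2, hfs _ hα.smooth_R, hfs _ (hsm 0), hfs _ (hsm 1), ?_, ?_, ?_, ?_, ?_,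
    ?_⟩
  · intro z hz v w
    rw [curl_pullForm (hf' z hz) (hα.smooth_form 0)]; exact hα.d_one _ _ _
  · intro z hz v w
    rw [curl_pullForm (hf' z hz) (hα.smooth_form 1)]; exact hα.d_two _ _ _
  · intro z hz v w
    rw [curl_pullForm (hf' z hz) (hα.smooth_form 2)]; exact hα.d_three _ _ _
  · intro z hz v
    rw [hfd _ hα.smooth_R z hz, Fin.sum_univ_three, hR.R3]; simp
  · intro z hz v
    obtain ⟨-, h2, -⟩ := cder_mixed hα hR.R3 (f z)
    rw [hfd _ (hsm 0) z hz, Fin.sum_univ_three, hR.R11, hR.R12, h2]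
    simp only [Function.comp]; ring
  · intro z hz v
    obtain ⟨h1, -, h3⟩ := cder_mixed hα hR.R3 (f z)
    rw [hfd _ (hsm 1) z hz, Fin.sum_univ_three, hR.R22, h1, hR.R12, h3]
    simp only [Function.comp]

variable {W : Set E} {a b c : E → E →L[ℝ] ℝ} {ρ p q : E → ℝ}

lemma CartanSystem.mono (h : CartanSystem W a b c ρ p q) {W' : Set E} (hW : W' ⊆ W) :
    CartanSystem W' a b c ρ p q where
  smooth_a := h.smooth_a.mono hW
  smooth_b := h.smooth_b.mono hW
  smooth_c := h.smooth_c.mono hW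
  smooth_R := h.smooth_R.mono hW
  smooth_p := h.smooth_p.mono hW
  smooth_q := h.smooth_q.mono hW
  curl_a z hz := h.curl_a z (hW hz)
  curl_b z hz := h.curl_b z (hW hz)
  curl_c z hz := h.curl_c z (hW hz)
  dR z hz := h.dR z (hW hz)
  dp z hz := h.dp z (hW hz)
  dq z hz := h.dq z (hW hz)

/-- With s = p² + q² the `c` terms of p dp + q dq cancel and ds = 2(1 - ρ - s) dρ; the exponential
is the integrating factor of this linear equation for s as a function of ρ. -/
lemma CartanSystem.fderiv_firstIntegral (h : CartanSystem W a b c ρ p q) (hW : IsOpen W) {z : E}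
    (hz : z ∈ W) :
    HasFDerivAt (fun z => (p z ^ 2 + q z ^ 2 + ρ z - 3 / 2) * Real.exp (2 * (ρ z - 1)))
      (0 : E →L[ℝ] ℝ) z := by
  have hp := ((h.smooth_p.contDiffAt (hW.mem_nhds hz)).differentiableAt (by simp)).hasFDerivAt
  have hq := ((h.smooth_q.contDiffAt (hW.mem_nhds hz)).differentiableAt (by simp)).hasFDerivAt
  have hr := ((h.smooth_R.contDiffAt (hW.mem_nhds hz)).differentiableAt (by simp)).hasFDerivAt
  have := ((((hp.pow 2).add (hq.pow 2)).add hr).sub_const (3 / 2)).mul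
    ((hr.sub_const 1).const_mul 2).exp
  refine this.congr_fderiv ?_
  ext v
  simp [h.dR z hz, h.dp z hz, h.dq z hz]
  ring

end System

/-! ### The first integral and the parameter R₀ -/

section FirstIntegral

variable {S : Type*} [TopologicalSpace S] [ChartedSpace E3 S] [IsManifold (𝓡 3) ∞ S]
  {α : Fin 3 → OneForm S} {R : S → ℝ}

lemma firstIntegral_const [ConnectedSpace S] (hα : IsCartanStructure α R) (hR : SatisfiesEDS α R)
    (x y : S) : firstIntegral α R x = firstIntegral α R y := by
  suffices IsLocallyConstant (firstIntegral α R) from this.apply_eq_of_preconnectedSpace x y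
  rw [IsLocallyConstant.iff_eventually_eq]
  intro x₀
  set φ := extChartAt (𝓡 3) x₀ with hφ
  obtain ⟨ε, hε, hb⟩ := Metric.isOpen_iff.1 (isOpen_extChartAt_target x₀) (φ x₀)
    (mem_extChartAt_target x₀)
  have hsys := (cartanSystem_pullForm hα hR (isOpen_extChartAt_target x₀)
    (contMDiffOn_extChartAt_symm x₀)).mono hb
  have hconst : ∀ z ∈ Metric.ball (φ x₀) ε, firstIntegral α R (φ.symm z) =
      firstIntegral α R (φ.symm (φ x₀)) := by
    intro z hz
    exact (convex_ball (φ x₀) ε).is_const_of_fderivWithin_eq_zero (𝕜 := ℝ)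
      (f := firstIntegral α R ∘ φ.symm)
      (fun z hz => (hsys.fderiv_firstIntegral Metric.isOpen_ball hz).differentiableAt.differentiableWithinAt)
      (fun z hz => (hsys.fderiv_firstIntegral Metric.isOpen_ball hz).hasFDerivWithinAt.fderivWithin
        (Metric.isOpen_ball.uniqueDiffWithinAt hz)) hz (Metric.mem_ball_self hε)
  have hc : ∀ᶠ y in 𝓝 x₀, φ y ∈ Metric.ball (φ x₀) ε :=
    (continuousAt_extChartAt x₀).eventually (Metric.ball_mem_nhds _ hε)
  filter_upwards [hc, extChartAt_source_mem_nhds (I := 𝓡 3) x₀] with y hy hys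
  have := hconst _ hy
  rwa [φ.left_inv hys, extChartAt_to_inv] at this

/-- The function `(u - 3/2) e^{2(u - 1)}` through which the constant `R₀` enters. -/
def potential (u : ℝ) : ℝ := (u - 3 / 2) * Real.exp (2 * (u - 1))

lemma hasDerivAt_potential (u : ℝ) :
    HasDerivAt potential (2 * (u - 1) * Real.exp (2 * (u - 1))) u := by
  have := ((hasDerivAt_id u).sub_const (3 / 2)).mul
    ((((hasDerivAt_id u).sub_const 1).const_mul 2).exp)
  refine this.congr_deriv ?_
  simp only [id]; ring

lemma continuous_potential : Continuous potential := by unfold potential; fun_prop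

lemma strictMonoOn_potential : StrictMonoOn potential (Ici 1) := by
  refine strictMonoOn_of_deriv_pos (convex_Ici 1) continuous_potential.continuousOn fun u hu => ?_
  rw [interior_Ici] at hu
  rw [(hasDerivAt_potential u).deriv]
  have : 0 < u - 1 := sub_pos.2 hu
  positivity

lemma strictAntiOn_potential : StrictAntiOn potential (Iic 1) := by
  refine strictAntiOn_of_deriv_neg (convex_Iic 1) continuous_potential.continuousOn fun u hu => ?_
  rw [interior_Iic] at hu
  rw [(hasDerivAt_potential u).deriv]
  have : u - 1 < 0 := sub_neg.2 hu
  have := Real.exp_pos (2 * (u - 1))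
  nlinarith

lemma exists_potential_eq {y : ℝ} (hy : -(1 / 2) < y) : ∃ u, 1 < u ∧ potential u = y := by
  have h1 : potential 1 = -(1 / 2) := by norm_num [potential]
  -- At |y| + 2 the exponential is at least 1 and the linear factor is |y| + 1/2.
  have h2 : y ≤ potential (|y| + 2) := by
    have e1 : 1 ≤ Real.exp (2 * ((|y| + 2) - 1)) := Real.one_le_exp (by have := abs_nonneg y; linarith)
    have := abs_nonneg y
    have := le_abs_self y
    unfold potential
    nlinarith
  obtain ⟨u, hu, hu'⟩ := intermediate_value_Icc (show (1 : ℝ) ≤ |y| + 2 by have := abs_nonneg y; linarith)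
    continuous_potential.continuousOn ⟨(h1.trans_lt hy).le, h2⟩
  refine ⟨u, lt_of_le_of_ne hu.1 ?_, hu'⟩
  rintro rfl
  linarith

omit [IsManifold (𝓡 3) ∞ S] in
lemma firstIntegral_eq (x : S) : firstIntegral α R x =
    (cder α 0 R x ^ 2 + cder α 1 R x ^ 2) * Real.exp (2 * (R x - 1)) + potential (R x) := by
  unfold firstIntegral potential; ring

/-- The gradient term is nonnegative and `potential` has the strict minimum -1/2 at 1, so a single
point with R ≠ 1 forces the constant above -1/2. The increasing branch on [1, ∞) then attains it at
some R₀ > 1. -/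
lemma exists_constant [ConnectedSpace S] (hα : IsCartanStructure α R) (hR : SatisfiesEDS α R)
    (hne : ∃ x, R x ≠ 1) : ∃ R₀ : ℝ, 1 < R₀ ∧
      ∀ x, firstIntegral α R x = (R₀ - 3 / 2) * Real.exp (2 * (R₀ - 1)) := by
  obtain ⟨x, hx⟩ := hne
  have h1 : potential 1 = -(1 / 2) := by norm_num [potential]
  have hlt : -(1 / 2) < firstIntegral α R x := by
    rw [firstIntegral_eq]
    have h2 : -(1 / 2) < potential (R x) := by
      rw [← h1]
      rcases lt_or_gt_of_ne hx with h | h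
      · exact strictAntiOn_potential h.le (mem_Iic.2 le_rfl) h
      · exact strictMonoOn_potential (mem_Ici.2 le_rfl) h.le h
    have : 0 ≤ (cder α 0 R x ^ 2 + cder α 1 R x ^ 2) * Real.exp (2 * (R x - 1)) := by positivity
    linarith
  obtain ⟨R₀, h, h'⟩ := exists_potential_eq hlt
  exact ⟨R₀, h, fun y => (firstIntegral_const hα hR y x).trans h'.symm⟩

end FirstIntegral

/-! ### Removable singularities and the analytic profile of Φ -/

section Slope

/-- Away from the base point this is a quotient; at the base point the shifted power series of `f`
represents the slope, which is why analyticity is carried along. -/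
lemma contDiff_dslope {f : ℝ → ℝ} (hf : ContDiff ℝ ω f) (x₀ : ℝ) : ContDiff ℝ ω (dslope f x₀) := by
  rw [contDiff_iff_contDiffAt]
  intro x
  rcases eq_or_ne x x₀ with rfl | hx
  · obtain ⟨P, hP⟩ := (hf.contDiffAt (x := x)).analyticAt
    exact hP.has_fpower_series_dslope_fslope.analyticAt.contDiffAt
  · have h1 : ContDiffAt ℝ ω (fun y => (y - x₀)⁻¹ * (f y - f x₀)) x :=
      ((contDiffAt_id.sub contDiffAt_const).inv (sub_ne_zero.2 hx)).mul
        (hf.contDiffAt.sub contDiffAt_const)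
    refine h1.congr_of_eventuallyEq ?_
    filter_upwards [dslope_eventuallyEq_slope_of_ne f hx] with y hy
    rw [hy, slope_def_field, div_eq_inv_mul]

lemma mul_dslope_zero (f : ℝ → ℝ) (t : ℝ) : t * dslope f 0 t = f t - f 0 := by
  simpa using sub_smul_dslope f 0 t

/-- The function `(eᵗ - 1) / t`. -/
def expSlope : ℝ → ℝ := dslope Real.exp 0

lemma contDiff_expSlope : ContDiff ℝ ω expSlope := contDiff_dslope Real.contDiff_exp 0

lemma mul_expSlope (t : ℝ) : t * expSlope t = Real.exp t - 1 := by
  simpa [expSlope] using mul_dslope_zero Real.exp t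

lemma expSlope_zero : expSlope 0 = 1 := by simp [expSlope, dslope_same]

/-- The function `M` with `Φ(r)² = t M(t)`, `t = r² / 4`. -/
def profile (R₀ t : ℝ) : ℝ := (2 * R₀ - 3) * expSlope (-2 * t) + Real.exp (-2 * t)

lemma contDiff_profile (R₀ : ℝ) : ContDiff ℝ ω (profile R₀) := by
  unfold profile
  exact (contDiff_const.mul (contDiff_expSlope.comp (contDiff_const.mul contDiff_id))).add
    (Real.contDiff_exp.comp (contDiff_const.mul contDiff_id))

lemma profile_zero (R₀ : ℝ) : profile R₀ 0 = 2 * (R₀ - 1) := by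
  simp [profile, expSlope_zero]; ring

/-- The right side is the radicand of Φ at t = r²/4. Extracting its zero at t = 0 leaves a factor
that is positive at the pole when R₀ > 1. -/
lemma mul_profile (R₀ t : ℝ) :
    t * profile R₀ t = (R₀ - 3 / 2) - (R₀ - 3 / 2 - t) * Real.exp (-2 * t) := by
  have := mul_expSlope (-2 * t)
  unfold profile
  linear_combination (-(R₀ - 3 / 2)) * this

lemma Phi_eq (R₀ r : ℝ) : Phi R₀ r = Real.sqrt (r ^ 2 / 4 * profile R₀ (r ^ 2 / 4)) := by
  rw [mul_profile, Phi]
  congr 4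
  ring

lemma Phi_pos_iff (R₀ : ℝ) {r : ℝ} (hr : r ≠ 0) : 0 < Phi R₀ r ↔ 0 < profile R₀ (r ^ 2 / 4) := by
  rw [Phi_eq, Real.sqrt_pos]
  have : 0 < r ^ 2 / 4 := by positivity
  exact mul_pos_iff_of_pos_left this

end Slope

/-! ### Inverse function theorem with a prescribed target -/

section LocalDiffeo

variable {E F : Type*} [NormedAddCommGroup E] [NormedSpace ℝ E] [CompleteSpace E]
  [NormedAddCommGroup F] [NormedSpace ℝ F]

/-- The inverse function theorem, with smoothness of both maps on the whole domains. -/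
lemma exists_localDiffeo {f : E → F} {U : Set E} (hU : IsOpen U) (hf : ContDiffOn ℝ ∞ f U) {u₀ : E}
    (hu : u₀ ∈ U) {f' : E ≃L[ℝ] F} (hf' : HasFDerivAt f (f' : E →L[ℝ] F) u₀) :
    ∃ e : OpenPartialHomeomorph E F, u₀ ∈ e.source ∧ e.source ⊆ U ∧ (∀ u, e u = f u) ∧
      ContDiffOn ℝ ∞ e.symm e.target := by
  have hfa : ∀ u ∈ U, ContDiffAt ℝ ∞ f u := fun u hu => hf.contDiffAt (hU.mem_nhds hu)
  set e₀ := (hfa u₀ hu).toOpenPartialHomeomorph f hf' (by simp)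
  have he₀ : ∀ u, e₀ u = f u := fun u => rfl
  have hcont : ContinuousOn (fderiv ℝ f) U := (hf.continuousOn_fderiv_of_isOpen hU (by simp))
  have hopen : IsOpen (Set.range ((↑) : (E ≃L[ℝ] F) → E →L[ℝ] F)) := ContinuousLinearEquiv.isOpen
  -- Shrinking to the points with invertible derivative makes the inverse smooth on the whole
  -- target, not only at the image of `u₀`.
  have hU' : IsOpen (U ∩ fderiv ℝ f ⁻¹' Set.range ((↑) : (E ≃L[ℝ] F) → E →L[ℝ] F)) :=
    hcont.isOpen_inter_preimage hU hopen
  set e := e₀.restrOpen _ hU' with he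
  have hsrc : e.source = e₀.source ∩ (U ∩ fderiv ℝ f ⁻¹' Set.range ((↑) : (E ≃L[ℝ] F) → E →L[ℝ] F)) :=
    e₀.restrOpen_source _ hU'
  have hef : ∀ u, e u = f u := fun u => rfl
  refine ⟨e, ?_, ?_, hef, ?_⟩
  · rw [hsrc]
    exact ⟨(hfa u₀ hu).mem_toOpenPartialHomeomorph_source hf' (by simp), hu, f', hf'.fderiv.symm⟩
  · rw [hsrc]; exact fun u hu => hu.2.1
  · intro y hy
    have hs := e.map_target hy
    rw [hsrc] at hs
    obtain ⟨-, hsU, g, hg⟩ := hs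
    have hd := ((hfa _ hsU).differentiableAt (by simp)).hasFDerivAt
    rw [← hg] at hd
    exact (e.contDiffAt_symm hy (f₀' := g) hd (hfa _ hsU)).contDiffWithinAt

/-- A local diffeomorphism onto a prescribed small neighborhood. -/
lemma exists_localDiffeo_onto {f : E → F} {U : Set E} (hU : IsOpen U) (hf : ContDiffOn ℝ ∞ f U)
    {u₀ : E} (hu : u₀ ∈ U) {f' : E ≃L[ℝ] F} (hf' : HasFDerivAt f (f' : E →L[ℝ] F) u₀) :
    ∃ δ > 0, ∀ T : Set F, IsOpen T → f u₀ ∈ T → T ⊆ Metric.ball (f u₀) δ →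
      ∃ e : OpenPartialHomeomorph E F, u₀ ∈ e.source ∧ e.source ⊆ U ∧ (∀ u, e u = f u) ∧
        e.target = T ∧ ContDiffOn ℝ ∞ e.symm e.target := by
  obtain ⟨e, h1, h2, h3, h4⟩ := exists_localDiffeo hU hf hu hf'
  have hmem : f u₀ ∈ e.target := h3 u₀ ▸ e.map_source h1
  obtain ⟨δ, hδ, hb⟩ := Metric.isOpen_iff.1 e.open_target _ hmem
  -- It is the target that is prescribed, so the inverse map is restricted and then inverted again.
  refine ⟨δ, hδ, fun T hT hfT hTb => ⟨(e.symm.restrOpen T hT).symm, ?_, ?_, fun u => h3 u, ?_, ?_⟩⟩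
  · have : u₀ = e.symm (f u₀) := by rw [← h3, e.left_inv h1]
    have h5 : f u₀ ∈ (e.symm.restrOpen T hT).source := ⟨hmem, hfT⟩
    rw [OpenPartialHomeomorph.symm_source, this]
    exact (e.symm.restrOpen T hT).map_source h5
  · rw [OpenPartialHomeomorph.symm_source]
    intro u hu
    have := (e.symm.restrOpen T hT).map_target hu
    have h6 : e.symm ((e.symm.restrOpen T hT).symm u) = u := (e.symm.restrOpen T hT).right_inv hu
    rw [← h6]
    exact h2 (e.map_target this.1)
  · rw [OpenPartialHomeomorph.symm_target, e.symm.restrOpen_source]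
    exact inter_eq_right.2 (hTb.trans hb)
  · rw [OpenPartialHomeomorph.symm_target, e.symm.restrOpen_source]
    exact h4.mono inter_subset_left

end LocalDiffeo

/-! ### The squared gradient s of R as a function of R -/

section Speed

variable {R₀ R s t r : ℝ}

/-- The first integral solved for s; by `mul_profile` the bracket is the radicand of Φ, so s is
e^{2t} times it with t = R₀ - R. -/
lemma speed_eq (h : (s + R - 3 / 2) * Real.exp (2 * (R - 1)) =
    (R₀ - 3 / 2) * Real.exp (2 * (R₀ - 1))) :
    s = Real.exp (2 * (R₀ - R)) * ((R₀ - R) * profile R₀ (R₀ - R)) := by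
  have h1 : Real.exp (2 * (R₀ - 1)) = Real.exp (2 * (R₀ - R)) * Real.exp (2 * (R - 1)) := by
    rw [← Real.exp_add]; ring_nf
  have h2 : s + R - 3 / 2 = (R₀ - 3 / 2) * Real.exp (2 * (R₀ - R)) := by
    apply mul_right_cancel₀ (Real.exp_ne_zero (2 * (R - 1)))
    rw [h, h1]; ring
  have h3 : Real.exp (2 * (R₀ - R)) * Real.exp (-2 * (R₀ - R)) = 1 := by
    rw [← Real.exp_add]; simp
  rw [mul_profile]
  linear_combination h2 - (-(R₀ - 3 / 2 - (R₀ - R))) * h3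

/-- If R ≥ R₀ > 1, then `potential R` is at least `potential R₀`, and the first integral leaves no
room for a positive gradient term. -/
lemma lt_of_speed_pos (hR₀ : 1 < R₀) (h : (s + R - 3 / 2) * Real.exp (2 * (R - 1)) =
    (R₀ - 3 / 2) * Real.exp (2 * (R₀ - 1))) (hs : 0 < s) : R < R₀ := by
  by_contra! hle
  have h1 : potential R₀ ≤ potential R :=
    strictMonoOn_potential.monotoneOn (mem_Ici.2 hR₀.le) (mem_Ici.2 (hR₀.le.trans hle)) hle
  have h2 : 0 < s * Real.exp (2 * (R - 1)) := by positivity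
  unfold potential at h1
  linarith

lemma Phi_sq_of_speed (hs : 0 ≤ s)
    (h : s = Real.exp (2 * t) * (t * profile R₀ t)) (ht : t = r ^ 2 / 4) :
    Phi R₀ r ^ 2 = s * Real.exp (-2 * t) := by
  have h3 : Real.exp (2 * t) * Real.exp (-2 * t) = 1 := by
    rw [← Real.exp_add]; simp
  have h4 : t * profile R₀ t = s * Real.exp (-2 * t) := by
    rw [h]; linear_combination (-(t * profile R₀ t)) * h3
  rw [Phi_eq, ← ht, Real.sq_sqrt, h4]
  rw [h4]; positivity

lemma Phi_pos_of_speed (hs : 0 < s)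
    (h : s = Real.exp (2 * t) * (t * profile R₀ t)) (ht : t = r ^ 2 / 4) : 0 < Phi R₀ r := by
  have h1 := Phi_sq_of_speed hs.le h ht
  have h2 : 0 ≤ Phi R₀ r := Real.sqrt_nonneg _
  have h3 : 0 < s * Real.exp (-2 * t) := by positivity
  rcases h2.eq_or_lt with h4 | h4
  · rw [← h4] at h1; norm_num at h1; linarith
  · exact h4

lemma eta_sq_of_speed (hs : 0 < s)
    (h : s = Real.exp (2 * t) * (t * profile R₀ t)) (ht : t = r ^ 2 / 4) :
    eta R₀ r ^ 2 = r ^ 2 / (4 * s) := by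
  have h1 := Phi_sq_of_speed hs.le h ht
  have h2 : Real.exp (-(r ^ 2 / 4)) ^ 2 = Real.exp (-2 * t) := by
    rw [← Real.exp_nat_mul, ht]; push_cast; ring_nf
  rw [eta, div_pow, mul_pow, mul_pow, h1, h2]
  have := Real.exp_ne_zero (-2 * t)
  field_simp
  norm_num

lemma phi_sq_of_speed (hs : 0 < s)
    (h : s = Real.exp (2 * t) * (t * profile R₀ t)) (ht : t = r ^ 2 / 4) :
    phi R₀ r ^ 2 = s * Real.exp (-2 * t) / (R₀ - 1) ^ 2 := by
  rw [phi, div_pow, Phi_sq_of_speed hs.le h ht]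

end Speed

/-! ### Closed forms on a two-dimensional solution -/

section NormalForm

variable {U : Set E2} {a b c : E2 → E2 →L[ℝ] ℝ} {R p q : E2 → ℝ} {R₀ : ℝ}

/-- The first integral of the system has the value determined by `R₀`. -/
def HasConstant (U : Set E2) (R p q : E2 → ℝ) (R₀ : ℝ) : Prop :=
  ∀ u ∈ U, (p u ^ 2 + q u ^ 2 + R u - 3 / 2) * Real.exp (2 * (R u - 1)) =
    (R₀ - 3 / 2) * Real.exp (2 * (R₀ - 1))

lemma CartanSystem.differentiableAt (h : CartanSystem U a b c R p q) (hU : IsOpen U) {u : E2}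
    (hu : u ∈ U) : DifferentiableAt ℝ a u ∧ DifferentiableAt ℝ b u ∧ DifferentiableAt ℝ c u ∧
      DifferentiableAt ℝ R u ∧ DifferentiableAt ℝ p u ∧ DifferentiableAt ℝ q u :=
  ⟨(h.smooth_a.contDiffAt (hU.mem_nhds hu)).differentiableAt (by simp),
    (h.smooth_b.contDiffAt (hU.mem_nhds hu)).differentiableAt (by simp),
    (h.smooth_c.contDiffAt (hU.mem_nhds hu)).differentiableAt (by simp),
    (h.smooth_R.contDiffAt (hU.mem_nhds hu)).differentiableAt (by simp),
    (h.smooth_p.contDiffAt (hU.mem_nhds hu)).differentiableAt (by simp),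
    (h.smooth_q.contDiffAt (hU.mem_nhds hu)).differentiableAt (by simp)⟩

/-- The form `R₁ α² - R₂ α¹`. -/
def rotForm (a b : E2 → E2 →L[ℝ] ℝ) (p q : E2 → ℝ) (u : E2) : E2 →L[ℝ] ℝ := p u • b u - q u • a u

/-- Both (p, q) and (a, b) rotate with speed `c`, and the form is invariant under simultaneous
rotation; hence no `c` term survives. -/
lemma CartanSystem.curl_rotForm (h : CartanSystem U a b c R p q) (hU : IsOpen U) {u : E2}
    (hu : u ∈ U) (v w : E2) : curl (rotForm a b p q) u v w =
      (2 - 2 * R u - (p u ^ 2 + q u ^ 2)) * (a u v * b u w - a u w * b u v) := by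
  obtain ⟨ha, hb, hc, hR, hp, hq⟩ := h.differentiableAt hU hu
  unfold rotForm
  rw [curl_sub (hp.fun_smul hb) (hq.fun_smul ha), curl_smul hp hb, curl_smul hq ha, h.dp u hu, h.dp u hu,
    h.dq u hu, h.dq u hu, h.curl_a u hu, h.curl_b u hu]
  ring

lemma CartanSystem.contDiffOn_rotForm (h : CartanSystem U a b c R p q) :
    ContDiffOn ℝ ∞ (rotForm a b p q) U :=
  (h.smooth_p.smul h.smooth_b).sub (h.smooth_q.smul h.smooth_a)

/-- The differential of the polar angle. -/
def angForm (R₀ : ℝ) (a b : E2 → E2 →L[ℝ] ℝ) (R p q : E2 → ℝ) (u : E2) : E2 →L[ℝ] ℝ :=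
  (-(R₀ - 1) * Real.exp (R₀ - R u) * (p u ^ 2 + q u ^ 2)⁻¹) • rotForm a b p q u

/-- From dR ∧ B = s a ∧ b and ds = 2(1 - R - s) dR it follows that e^{-R}/s is an integrating factor
for B. The remaining constant only fixes the scale and sign of the angle. -/
lemma CartanSystem.curl_angForm (h : CartanSystem U a b c R p q) (hU : IsOpen U) {u : E2}
    (hu : u ∈ U) (hs : p u ^ 2 + q u ^ 2 ≠ 0) (v w : E2) :
    curl (angForm R₀ a b R p q) u v w = 0 := by
  obtain ⟨ha, hb, hc, hR, hp, hq⟩ := h.differentiableAt hU hu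
  have hf : HasFDerivAt (fun u => -(R₀ - 1) * Real.exp (R₀ - R u) * (p u ^ 2 + q u ^ 2)⁻¹) _ u :=
    ((hR.hasFDerivAt.const_sub R₀).exp.const_mul (-(R₀ - 1))).fun_mul
      ((hasDerivAt_inv hs).comp_hasFDerivAt u
        (f := fun u => p u ^ 2 + q u ^ 2) ((hp.hasFDerivAt.pow 2).add (hq.hasFDerivAt.pow 2)))
  unfold angForm
  rw [curl_smul hf.differentiableAt
    ((h.contDiffOn_rotForm.contDiffAt (hU.mem_nhds hu)).differentiableAt (by simp)),
    h.curl_rotForm hU hu, hf.fderiv]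
  simp [h.dp u hu, h.dq u hu, h.dR u hu, rotForm]
  field_simp
  ring

/-- The coefficient of `R₁ α² - R₂ α¹` in the rotation of the frame against the polar angle. -/
def poleCoeff (R₀ R : ℝ) : ℝ := ((R₀ - 1) * expSlope (R₀ - R) + 1) /
  (Real.exp (2 * (R₀ - R)) * profile R₀ (R₀ - R))

lemma contDiffAt_poleCoeff {R₀ R : ℝ} (h : profile R₀ (R₀ - R) ≠ 0) :
    ContDiffAt ℝ ∞ (poleCoeff R₀) R := by
  have h1 : ContDiff ℝ ∞ expSlope := contDiff_expSlope.of_le (by simp)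
  have h2 : ContDiff ℝ ∞ (profile R₀) := (contDiff_profile R₀).of_le (by simp)
  have h0 : ContDiff ℝ ∞ (fun R => R₀ - R) := contDiff_const.sub contDiff_id
  unfold poleCoeff
  refine ContDiffAt.div ?_ ?_ (mul_ne_zero (Real.exp_ne_zero _) h)
  · exact ((contDiff_const.mul (h1.comp h0)).add contDiff_const).contDiffAt
  · exact ((Real.contDiff_exp.comp (contDiff_const.mul h0)).mul (h2.comp h0)).contDiffAt

/-- The right side vanishes at R = R₀, exactly because the exponential carries the factor R₀ - 1.
Its zero cancels the zero of s, so the quotient is regular at the pole. -/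
lemma poleCoeff_mul {R₀ R s : ℝ} (h : profile R₀ (R₀ - R) ≠ 0)
    (hs : s = Real.exp (2 * (R₀ - R)) * ((R₀ - R) * profile R₀ (R₀ - R))) :
    poleCoeff R₀ R * s = (R₀ - 1) * Real.exp (R₀ - R) + 1 - R := by
  have := mul_expSlope (R₀ - R)
  have h1 := Real.exp_ne_zero (2 * (R₀ - R))
  rw [hs, poleCoeff]
  field_simp
  linear_combination (R₀ - 1) * this

/-- The form `h(R) (R₁ α² - R₂ α¹) + α³`, minus the differential of the angle by which the frame
rotates against the polar coordinates. -/
def poleForm (R₀ : ℝ) (a b c : E2 → E2 →L[ℝ] ℝ) (R p q : E2 → ℝ) (u : E2) : E2 →L[ℝ] ℝ :=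
  poleCoeff R₀ (R u) • rotForm a b p q u + c u

/-- Where s ≠ 0 the form is a difference of closed forms: the argument of (p, q) has differential (1
- R) B / s + c, and the polar angle has differential -(R₀ - 1) e^{R₀ - R} B / s. The proof has to
cover s = 0 as well, so it never divides by s. -/
lemma CartanSystem.curl_poleForm (h : CartanSystem U a b c R p q) (hU : IsOpen U)
    (hc : HasConstant U R p q R₀) {u : E2}
    (hu : u ∈ U) (hM : profile R₀ (R₀ - R u) ≠ 0) (v w : E2) :
    curl (poleForm R₀ a b c R p q) u v w = 0 := by
  obtain ⟨ha, hb, hcd, hR, hp, hq⟩ := h.differentiableAt hU hu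
  have hh : HasDerivAt (poleCoeff R₀) (deriv (poleCoeff R₀) (R u)) (R u) :=
    ((contDiffAt_poleCoeff hM).differentiableAt (by simp)).hasDerivAt
  have hf : HasFDerivAt (fun u => poleCoeff R₀ (R u)) (deriv (poleCoeff R₀) (R u) • fderiv ℝ R u) u :=
    hh.comp_hasFDerivAt u hR.hasFDerivAt
  have hB : DifferentiableAt ℝ (rotForm a b p q) u :=
    (h.contDiffOn_rotForm.contDiffAt (hU.mem_nhds hu)).differentiableAt (by simp)
  set S : ℝ → ℝ := fun x => (R₀ - 3 / 2) * Real.exp (2 * (R₀ - x)) - (x - 3 / 2) with hSdef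
  have hSM : ∀ x, S x = Real.exp (2 * (R₀ - x)) * ((R₀ - x) * profile R₀ (R₀ - x)) := by
    intro x
    have h3 : Real.exp (2 * (R₀ - x)) * Real.exp (-2 * (R₀ - x)) = 1 := by
      rw [← Real.exp_add]; simp
    rw [mul_profile, hSdef]
    linear_combination (x - 3 / 2) * h3
  have hSd : HasDerivAt S (-2 * (S (R u) + R u - 3 / 2) - 1) (R u) := by
    have := ((((hasDerivAt_id (R u)).const_sub R₀).const_mul 2).exp.const_mul (R₀ - 3 / 2)).sub
      ((hasDerivAt_id (R u)).sub_const (3 / 2))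
    refine this.congr_deriv ?_
    simp only [hSdef, id]; ring
  have hNd : HasDerivAt (fun x => (R₀ - 1) * Real.exp (R₀ - x) + 1 - x)
      (-((R₀ - 1) * Real.exp (R₀ - R u)) - 1) (R u) := by
    have := ((((hasDerivAt_id (R u)).const_sub R₀).exp.const_mul (R₀ - 1)).add_const 1).sub
      (hasDerivAt_id (R u))
    refine this.congr_deriv ?_
    simp only [id]; ring
  have hev : (fun x => poleCoeff R₀ x * S x) =ᶠ[𝓝 (R u)]
      fun x => (R₀ - 1) * Real.exp (R₀ - x) + 1 - x := by
    have : ContinuousAt (fun x => profile R₀ (R₀ - x)) (R u) :=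
      ((contDiff_profile R₀).continuous.comp (continuous_const.sub continuous_id)).continuousAt
    filter_upwards [this.eventually_ne hM] with x hx
    exact poleCoeff_mul hx (hSM x)
  -- Differentiating the product `poleCoeff R₀ * S` expresses h' S through h and R, which remains
  -- meaningful where S = 0.
  have hder := (hh.mul hSd).unique (hNd.congr_of_eventuallyEq hev)
  have hs : p u ^ 2 + q u ^ 2 = S (R u) := by rw [hSM]; exact speed_eq (hc u hu)
  have hval := poleCoeff_mul hM (hSM (R u))
  unfold poleForm
  rw [curl_add (hf.differentiableAt.fun_smul hB) hcd, curl_smul hf.differentiableAt hB, hf.fderiv,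
    h.curl_rotForm hU hu, h.curl_c u hu]
  simp only [smul_apply, smul_eq_mul, h.dR u hu, rotForm, sub_apply]
  have e : deriv (poleCoeff R₀) (R u) * (p u ^ 2 + q u ^ 2) +
      poleCoeff R₀ (R u) * (2 - 2 * R u - (p u ^ 2 + q u ^ 2)) + R u = 0 := by
    rw [hs]; linear_combination hder + hval
  linear_combination (a u v * b u w - a u w * b u v) * e

lemma exists_equiv_of_injective {f : E2 →L[ℝ] E2} (hf : ∀ v, f v = 0 → v = 0) :
    ∃ e : E2 ≃L[ℝ] E2, (e : E2 →L[ℝ] E2) = f := by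
  have hinj : Function.Injective (f : E2 →ₗ[ℝ] E2) := (injective_iff_map_eq_zero _).2 hf
  exact ⟨(LinearEquiv.ofInjectiveEndo _ hinj).toContinuousLinearEquiv, by ext; rfl⟩

/-- The metric `α¹ ⊗ α¹ + α² ⊗ α²` in terms of `dR` and of `B = R₁ α² - R₂ α¹`. -/
lemma metric_eq_of_speed {R₀ t r s a a' b b' p q : ℝ} (hR₀ : 1 < R₀) (hr : r ≠ 0) (hs : 0 < s)
    (hspq : s = p ^ 2 + q ^ 2)
    (h : s = Real.exp (2 * t) * (t * profile R₀ t)) (ht : t = r ^ 2 / 4) :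
    a * a' + b * b' =
      eta R₀ r ^ 2 * ((-2 / r * (p * a + q * b)) * (-2 / r * (p * a' + q * b'))) +
      phi R₀ r ^ 2 * ((-(R₀ - 1) * Real.exp t / s * (p * b - q * a)) *
        (-(R₀ - 1) * Real.exp t / s * (p * b' - q * a'))) := by
  rw [eta_sq_of_speed hs h ht, phi_sq_of_speed hs h ht]
  have h1 : Real.exp (-2 * t) = (Real.exp t * Real.exp t)⁻¹ := by
    rw [← Real.exp_add, ← Real.exp_neg]; ring_nf
  rw [h1]
  have h2 : R₀ - 1 ≠ 0 := by linarith
  have h3 := Real.exp_ne_zero t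
  have h4 : s ≠ 0 := hs.ne'
  field_simp
  rw [hspq]; ring

end NormalForm

/-! ### Polar coordinates away from critical points of R -/

section NormalForm

variable {U : Set E2} {a b c : E2 → E2 →L[ℝ] ℝ} {R p q : E2 → ℝ} {R₀ : ℝ}

lemma fderiv_coord {f : E2 → E2} {u : E2} (hf : DifferentiableAt ℝ f u) (v : E2) (i : Fin 2) :
    fderiv ℝ f u v i = fderiv ℝ (fun u => f u i) u v := by
  have := ((EuclideanSpace.proj (𝕜 := ℝ) i : E2 →L[ℝ] ℝ).hasFDerivAt.comp u hf.hasFDerivAt).fderiv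
  have h2 : (fun u => f u i) = (EuclideanSpace.proj (𝕜 := ℝ) i : E2 →L[ℝ] ℝ) ∘ f := rfl
  rw [h2, this]; rfl

lemma norm_lt_of_coord {z : E2} {δ : ℝ} (h0 : |z 0| < δ / 2) (h1 : |z 1| < δ / 2) : ‖z‖ < δ := by
  have hδ : 0 < δ := by have := abs_nonneg (z 0); linarith
  rw [EuclideanSpace.norm_eq, Real.sqrt_lt' hδ, Fin.sum_univ_two, Real.norm_eq_abs,
    Real.norm_eq_abs]
  have := abs_nonneg (z 0)
  have := abs_nonneg (z 1)
  nlinarith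

/-- Polar coordinates adapted to a solution of the system where `dR ≠ 0`. -/
lemma CartanSystem.exists_polar (h : CartanSystem U a b c R p q) (hU : IsOpen U) (hR₀ : 1 < R₀)
    (hc : HasConstant U R p q R₀) (hnd : ∀ u ∈ U, ∀ v, a u v = 0 → b u v = 0 → v = 0) {u₀ : E2}
    (hu : u₀ ∈ U) (hpq : p u₀ ≠ 0 ∨ q u₀ ≠ 0) :
    ∃ e : OpenPartialHomeomorph E2 E2, u₀ ∈ e.source ∧ e.source ⊆ U ∧
      ContDiffOn ℝ ∞ e e.source ∧ ContDiffOn ℝ ∞ e.symm e.target ∧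
      (∃ a b c d : ℝ, 0 < a ∧ d - c ≤ 2 * Real.pi ∧ (∀ r ∈ Ioo a b, 0 < Phi R₀ r) ∧
        e.target = {z : E2 | z 0 ∈ Ioo a b ∧ z 1 ∈ Ioo c d}) ∧
      ∀ u ∈ e.source, R u = R₀ - (e u 0) ^ 2 / 4 ∧ ∀ v w, a u v * a u w + b u v * b u w =
        eta R₀ (e u 0) ^ 2 * (fderiv ℝ (fun u => e u 0) u v * fderiv ℝ (fun u => e u 0) u w) +
        phi R₀ (e u 0) ^ 2 * (fderiv ℝ (fun u => e u 1) u v * fderiv ℝ (fun u => e u 1) u w) := by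
  set W := U ∩ (fun u => p u ^ 2 + q u ^ 2) ⁻¹' Ioi 0 with hWdef
  have hW : IsOpen W := ((h.smooth_p.pow 2).add (h.smooth_q.pow 2)).continuousOn.isOpen_inter_preimage
    hU isOpen_Ioi
  have hWU : W ⊆ U := inter_subset_left
  have huW : u₀ ∈ W := by
    refine ⟨hu, ?_⟩
    rcases hpq with hp | hp <;> simp only [mem_preimage, mem_Ioi] <;> positivity
  have hs : ∀ u ∈ W, 0 < p u ^ 2 + q u ^ 2 := fun u hu => hu.2
  have hsp : ∀ u ∈ W, _ := fun u hu => speed_eq (hc u (hWU hu))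
  have hlt : ∀ u ∈ W, 0 < R₀ - R u := fun u hu =>
    sub_pos.2 (lt_of_speed_pos hR₀ (hc u (hWU hu)) (hs u hu))
  have hA : ContDiffOn ℝ ∞ (angForm R₀ a b R p q) W := by
    have h' := h.mono hWU
    refine ContDiffOn.smul (ContDiffOn.mul (contDiffOn_const.mul (contDiffOn_const.sub h'.smooth_R).exp)
      (((h'.smooth_p.pow 2).add (h'.smooth_q.pow 2)).inv fun u hu => (hs u hu).ne'))
      h'.contDiffOn_rotForm
  obtain ⟨ε, hε, θ, hεW, -, hθ, hdθ⟩ := exists_primitive hW hA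
    (fun u hu v w => h.curl_angForm hU (hWU hu) (hs u hu).ne' v w) huW 0
  set r : E2 → ℝ := fun u => 2 * Real.sqrt (R₀ - R u) with hrdef
  have hr2 : ∀ u ∈ W, R₀ - R u = r u ^ 2 / 4 := by
    intro u hu
    rw [hrdef]; simp only [mul_pow, Real.sq_sqrt (hlt u hu).le]; ring
  have hrpos : ∀ u ∈ W, 0 < r u := fun u hu => by
    have := Real.sqrt_pos.2 (hlt u hu)
    simp only [hrdef]; positivity
  have hrs : ContDiffOn ℝ ∞ r W := contDiffOn_const.mul
    ((contDiffOn_const.sub (h.smooth_R.mono hWU)).sqrt fun u hu => (hlt u hu).ne')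
  have hdr : ∀ u ∈ W, ∀ v, fderiv ℝ r u v = -2 / r u * (p u * a u v + q u * b u v) := by
    intro u hu v
    obtain ⟨-, -, -, hR, -, -⟩ := h.differentiableAt hU (hWU hu)
    have := ((hR.hasFDerivAt.const_sub R₀).sqrt (hlt u hu).ne').const_mul 2
    rw [this.fderiv, hrdef]
    have h1 := (Real.sqrt_pos.2 (hlt u hu)).ne'
    simp [h.dR u (hWU hu)]
    field_simp
  have hmet : ∀ u ∈ Metric.ball u₀ ε, ∀ v w, a u v * a u w + b u v * b u w =
      eta R₀ (r u) ^ 2 * (fderiv ℝ r u v * fderiv ℝ r u w) +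
      phi R₀ (r u) ^ 2 * (fderiv ℝ θ u v * fderiv ℝ θ u w) := by
    intro u hu v w
    have hu' := hεW hu
    rw [hdr u hu', hdr u hu', (hdθ u hu).fderiv,
      metric_eq_of_speed hR₀ (hrpos u hu').ne' (hs u hu') rfl (hsp u hu') (hr2 u hu')]
    simp only [angForm, rotForm, smul_apply, sub_apply, smul_eq_mul]
    ring
  set f : E2 → E2 := fun u => !₂[r u, θ u] with hf
  have hfs : ContDiffOn ℝ ∞ f (Metric.ball u₀ ε) := by
    rw [contDiffOn_euclidean]
    intro i
    fin_cases i
    · exact hrs.mono hεW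
    · exact hθ
  have hfd : ∀ u ∈ Metric.ball u₀ ε, DifferentiableAt ℝ f u := fun u hu =>
    (hfs.contDiffAt (Metric.isOpen_ball.mem_nhds hu)).differentiableAt (by simp)
  have hu₀ : u₀ ∈ Metric.ball u₀ ε := Metric.mem_ball_self hε
  -- By `hmet`, a vector killed by dr and dθ is killed by a and b, hence is zero.
  obtain ⟨f', hf'⟩ : ∃ f' : E2 ≃L[ℝ] E2, (f' : E2 →L[ℝ] E2) = fderiv ℝ f u₀ := by
    refine exists_equiv_of_injective fun v hv => ?_
    have h0 : fderiv ℝ r u₀ v = 0 := by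
      have := fderiv_coord (hfd u₀ hu₀) v 0
      rw [hv] at this; exact this.symm
    have h1 : fderiv ℝ θ u₀ v = 0 := by
      have := fderiv_coord (hfd u₀ hu₀) v 1
      rw [hv] at this; exact this.symm
    have h2 := hmet u₀ hu₀ v v
    rw [h0, h1] at h2
    have h3 : a u₀ v * a u₀ v + b u₀ v * b u₀ v = 0 := by rw [h2]; ring
    refine hnd u₀ hu v ?_ ?_ <;> nlinarith [mul_self_nonneg (a u₀ v), mul_self_nonneg (b u₀ v)]
  obtain ⟨δ, hδ, hloc⟩ := exists_localDiffeo_onto Metric.isOpen_ball hfs hu₀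
    (hf' ▸ (hfd u₀ hu₀).hasFDerivAt)
  have hr0 := hrpos u₀ huW
  -- The three bounds keep the box inside the δ-ball, its radii positive, and its angular width at
  -- most 2π.
  set κ := min (δ / 2) (min (r u₀ / 2) Real.pi) with hκ
  have hκ0 : 0 < κ := lt_min (by positivity) (lt_min (by positivity) Real.pi_pos)
  have hκ1 : κ ≤ δ / 2 := min_le_left _ _
  have hκ2 : κ ≤ r u₀ / 2 := (min_le_right _ _).trans (min_le_left _ _)
  have hκ3 : κ ≤ Real.pi := (min_le_right _ _).trans (min_le_right _ _)
  obtain ⟨e, he1, he2, he3, he4, he5⟩ := hloc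
    {z : E2 | z 0 ∈ Ioo (r u₀ - κ) (r u₀ + κ) ∧ z 1 ∈ Ioo (θ u₀ - κ) (θ u₀ + κ)}
    ((isOpen_Ioo.preimage (by fun_prop)).inter (isOpen_Ioo.preimage (by fun_prop)))
    (by simp [hf, hκ0]) (by
      rintro z ⟨⟨h1, h2⟩, h3, h4⟩
      rw [Metric.mem_ball, dist_eq_norm]
      apply norm_lt_of_coord
      · have : (z - f u₀) 0 = z 0 - r u₀ := by simp [hf]
        rw [this, abs_lt]; constructor <;> linarith
      · have : (z - f u₀) 1 = z 1 - θ u₀ := by simp [hf]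
        rw [this, abs_lt]; constructor <;> linarith)
  have hecoe : ⇑e = f := funext he3
  refine ⟨e, he1, he2.trans (hεW.trans hWU), by rw [hecoe]; exact hfs.mono he2, he5,
    ⟨r u₀ - κ, r u₀ + κ, θ u₀ - κ, θ u₀ + κ, by linarith, by linarith, ?_, he4⟩, ?_⟩
  · intro ρ hρ
    -- Every radius of the interval is attained at a point of the domain, and there s > 0 gives Φ >
    -- 0.
    have hmem : (!₂[ρ, θ u₀] : E2) ∈ e.target := by
      rw [he4]; simpa [hκ0] using hρ
    have h1 := e.map_target hmem
    have h2 := hεW (he2 h1)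
    have h3 : r (e.symm !₂[ρ, θ u₀]) = ρ := by
      have := e.right_inv hmem
      rw [he3] at this
      simpa [hf] using congrArg (fun z : E2 => z 0) this
    have := Phi_pos_of_speed (hs _ h2) (hsp _ h2) (hr2 _ h2)
    rwa [h3] at this
  · intro u hu
    rw [hecoe]
    refine ⟨?_, ?_⟩
    · have := hr2 u (hεW (he2 hu))
      simp only [hf]
      simp only [Matrix.cons_val_zero]
      linarith
    · exact hmet u (he2 hu)

end NormalForm

/-! ### Cartesian coordinates around a maximum of R -/

section NormalForm

variable {U : Set E2} {a b c : E2 → E2 →L[ℝ] ℝ} {R p q : E2 → ℝ} {R₀ : ℝ}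

/-- The ratio of `r` to the speed `(R₁² + R₂²)^{1/2}`. -/
def poleScale (R₀ R : ℝ) : ℝ := 2 / Real.sqrt (Real.exp (2 * (R₀ - R)) * profile R₀ (R₀ - R))

lemma contDiffAt_poleScale {R₀ R : ℝ} (h : 0 < profile R₀ (R₀ - R)) :
    ContDiffAt ℝ ∞ (poleScale R₀) R := by
  have h2 : ContDiff ℝ ∞ (profile R₀) := (contDiff_profile R₀).of_le (by simp)
  have h0 : ContDiff ℝ ∞ (fun R => R₀ - R) := contDiff_const.sub contDiff_id
  have h3 : 0 < Real.exp (2 * (R₀ - R)) * profile R₀ (R₀ - R) := mul_pos (Real.exp_pos _) h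
  unfold poleScale
  refine contDiffAt_const.div (ContDiffAt.sqrt ?_ h3.ne') (Real.sqrt_pos.2 h3).ne'
  exact ((Real.contDiff_exp.comp (contDiff_const.mul h0)).mul (h2.comp h0)).contDiffAt

/-- Scaling (p, q) by this factor gives a vector of length r = 2 (R₀ - R)^{1/2}. The vanishing
factor R₀ - R of s has been divided out, so the scale stays smooth and positive at the pole. -/
lemma poleScale_sq_mul {R₀ R s : ℝ} (h : 0 < profile R₀ (R₀ - R))
    (hs : s = Real.exp (2 * (R₀ - R)) * ((R₀ - R) * profile R₀ (R₀ - R))) :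
    poleScale R₀ R ^ 2 * s = 4 * (R₀ - R) := by
  have h3 : 0 < Real.exp (2 * (R₀ - R)) * profile R₀ (R₀ - R) := mul_pos (Real.exp_pos _) h
  rw [poleScale, div_pow, Real.sq_sqrt h3.le, hs]
  have := Real.exp_ne_zero (2 * (R₀ - R))
  field_simp
  ring

lemma poleScale_pos {R₀ R : ℝ} (h : 0 < profile R₀ (R₀ - R)) : 0 < poleScale R₀ R := by
  have h3 : 0 < Real.exp (2 * (R₀ - R)) * profile R₀ (R₀ - R) := mul_pos (Real.exp_pos _) h
  have := Real.sqrt_pos.2 h3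
  unfold poleScale; positivity

lemma norm_sq_eq (z : E2) : ‖z‖ ^ 2 = z 0 ^ 2 + z 1 ^ 2 := by
  rw [EuclideanSpace.norm_eq, Real.sq_sqrt (by positivity), Fin.sum_univ_two]
  simp

/-- Coordinates adapted to a solution of the system around a maximum of `R`. -/
lemma CartanSystem.exists_pole (h : CartanSystem U a b c R p q) (hU : IsOpen U) (hR₀ : 1 < R₀)
    (hc : HasConstant U R p q R₀) (hnd : ∀ u ∈ U, ∀ v, a u v = 0 → b u v = 0 → v = 0) {u₀ : E2}
    (hu : u₀ ∈ U) (hRu : R u₀ = R₀) :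
    ∃ e : OpenPartialHomeomorph E2 E2, u₀ ∈ e.source ∧ e.source ⊆ U ∧
      ContDiffOn ℝ ∞ e e.source ∧ ContDiffOn ℝ ∞ e.symm e.target ∧ e u₀ = 0 ∧
      (∃ ρ : ℝ, 0 < ρ ∧ (∀ r ∈ Ioo 0 ρ, 0 < Phi R₀ r) ∧ e.target = Metric.ball 0 ρ) ∧
      ∀ u ∈ e.source, R u = R₀ - ‖e u‖ ^ 2 / 4 ∧ (u ≠ u₀ → ∀ v w, a u v * a u w + b u v * b u w =
        polarMetric R₀ (e u) (fderiv ℝ e u v) (fderiv ℝ e u w)) := by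
  set W := U ∩ (fun u => profile R₀ (R₀ - R u)) ⁻¹' Ioi 0 with hWdef
  have hW : IsOpen W := ((contDiff_profile R₀).continuous.comp_continuousOn
    (continuousOn_const.sub h.smooth_R.continuousOn)).isOpen_inter_preimage hU isOpen_Ioi
  have hWU : W ⊆ U := inter_subset_left
  have hM : ∀ u ∈ W, 0 < profile R₀ (R₀ - R u) := fun u hu => hu.2
  have huW : u₀ ∈ W := by
    refine ⟨hu, ?_⟩
    simp only [mem_preimage, hRu, sub_self, profile_zero, mem_Ioi]; linarith
  have hsp : ∀ u ∈ W, _ := fun u hu => speed_eq (hc u (hWU hu))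
  have h' := h.mono hWU
  have hA : ContDiffOn ℝ ∞ (fun u => -poleForm R₀ a b c R p q u) W := by
    have hP : ContDiffOn ℝ ∞ (fun u => poleCoeff R₀ (R u)) W := fun u hu =>
      (contDiffAt_poleCoeff (hM u hu).ne').comp_contDiffWithinAt u (h'.smooth_R u hu)
    exact ((hP.smul h'.contDiffOn_rotForm).add h'.smooth_c).neg
  -- χ is the rotation of the frame after which the gradient of R has the polar angle as its
  -- argument, up to a constant; it is normalized by χ(u₀) = 0.
  obtain ⟨ε, hε, χ, hεW, hχ0, hχ, hdχ⟩ := exists_primitive hW hA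
    (fun u hu v w => by
      have := h.curl_poleForm hU hc (hWU hu) (hM u hu).ne' v w
      simp only [curl, fderiv_fun_neg, neg_apply] at this ⊢
      linarith) huW 0
  set k : E2 → ℝ := fun u => poleScale R₀ (R u) with hkdef
  have hks : ContDiffOn ℝ ∞ k W := fun u hu =>
    (contDiffAt_poleScale (hM u hu)).comp_contDiffWithinAt u (h'.smooth_R u hu)
  -- The gradient points toward the maximum; the minus sign reverses it, so the differential of `f`
  -- at `u₀` is a positive multiple of (a, b).
  set f : E2 → E2 := fun u => !₂[-k u * (p u * Real.cos (χ u) - q u * Real.sin (χ u)),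
    -k u * (p u * Real.sin (χ u) + q u * Real.cos (χ u))] with hf
  have hfs : ContDiffOn ℝ ∞ f (Metric.ball u₀ ε) := by
    have hk' := hks.mono hεW
    have hp' := h'.smooth_p.mono hεW
    have hq' := h'.smooth_q.mono hεW
    rw [contDiffOn_euclidean]
    intro i
    fin_cases i
    · exact hk'.neg.mul ((hp'.mul hχ.cos).sub (hq'.mul hχ.sin))
    · exact hk'.neg.mul ((hp'.mul hχ.sin).add (hq'.mul hχ.cos))
  have hfd : ∀ u ∈ Metric.ball u₀ ε, DifferentiableAt ℝ f u := fun u hu =>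
    (hfs.contDiffAt (Metric.isOpen_ball.mem_nhds hu)).differentiableAt (by simp)
  have hfn : ∀ u ∈ W, R₀ - R u = ‖f u‖ ^ 2 / 4 := by
    intro u hu
    have h1 := poleScale_sq_mul (hM u hu) (hsp u hu)
    have h2 := Real.sin_sq_add_cos_sq (χ u)
    rw [norm_sq_eq]
    simp only [hf, hkdef, Matrix.cons_val_zero, Matrix.cons_val_one]
    linear_combination (-1 / 4) * h1 -
      (1 / 4) * poleScale R₀ (R u) ^ 2 * (p u ^ 2 + q u ^ 2) * h2
  have hu₀ : u₀ ∈ Metric.ball u₀ ε := Metric.mem_ball_self hε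
  -- The derivative of the scale is left unspecified: it multiplies a vector parallel to `f`, so it
  -- drops out of dθ, and at `u₀` it multiplies zero.
  have hdf : ∀ u ∈ Metric.ball u₀ ε, ∃ dk : E2 →L[ℝ] ℝ, ∀ v,
      fderiv ℝ f u v 0 = -(dk v * (p u * Real.cos (χ u) - q u * Real.sin (χ u)) +
        k u * (fderiv ℝ p u v * Real.cos (χ u) - fderiv ℝ q u v * Real.sin (χ u) +
          (p u * Real.sin (χ u) + q u * Real.cos (χ u)) * poleForm R₀ a b c R p q u v)) ∧
      fderiv ℝ f u v 1 = -(dk v * (p u * Real.sin (χ u) + q u * Real.cos (χ u)) +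
        k u * (fderiv ℝ p u v * Real.sin (χ u) + fderiv ℝ q u v * Real.cos (χ u) -
          (p u * Real.cos (χ u) - q u * Real.sin (χ u)) * poleForm R₀ a b c R p q u v)) := by
    intro u hu
    have hu' := hεW hu
    obtain ⟨-, -, -, -, hp, hq⟩ := h.differentiableAt hU (hWU hu')
    have hk := ((hks.contDiffAt (hW.mem_nhds hu')).differentiableAt (by simp)).hasFDerivAt
    have hχ' := hdχ u hu
    refine ⟨fderiv ℝ k u, fun v => ⟨?_, ?_⟩⟩
    · rw [fderiv_coord (hfd u hu)]
      have h0 : HasFDerivAt (fun u => f u 0) _ u :=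
        hk.neg.mul ((hp.hasFDerivAt.mul hχ'.cos).sub (hq.hasFDerivAt.mul hχ'.sin))
      rw [h0.fderiv]
      simp
      ring
    · rw [fderiv_coord (hfd u hu)]
      have h0 : HasFDerivAt (fun u => f u 1) _ u :=
        hk.neg.mul ((hp.hasFDerivAt.mul hχ'.sin).add (hq.hasFDerivAt.mul hχ'.cos))
      rw [h0.fderiv]
      simp
      ring
  have hpq0 : p u₀ = 0 ∧ q u₀ = 0 := by
    have := hsp u₀ huW
    rw [hRu] at this
    simp only [sub_self, zero_mul, mul_zero] at this
    constructor <;> nlinarith [sq_nonneg (p u₀), sq_nonneg (q u₀)]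
  have hf0 : f u₀ = 0 := by
    ext i; fin_cases i <;> simp [hf, hpq0]
  obtain ⟨f', hf'⟩ : ∃ f' : E2 ≃L[ℝ] E2, (f' : E2 →L[ℝ] E2) = fderiv ℝ f u₀ := by
    refine exists_equiv_of_injective fun v hv => ?_
    obtain ⟨dk, hdk⟩ := hdf u₀ hu₀
    obtain ⟨h0, h1⟩ := hdk v
    rw [hv] at h0 h1
    have hk0 : k u₀ ≠ 0 := (poleScale_pos (hM u₀ huW)).ne'
    simp [hpq0, hχ0, h.dp u₀ hu, h.dq u₀ hu, hRu, hk0] at h0 h1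
    have : 1 - R₀ ≠ 0 := by linarith
    exact hnd u₀ hu v (by tauto) (by tauto)
  obtain ⟨δ, hδ, hloc⟩ := exists_localDiffeo_onto Metric.isOpen_ball hfs hu₀
    (hf' ▸ (hfd u₀ hu₀).hasFDerivAt)
  obtain ⟨e, he1, he2, he3, he4, he5⟩ := hloc (Metric.ball (f u₀) δ) Metric.isOpen_ball
    (Metric.mem_ball_self hδ) le_rfl
  have hecoe : ⇑e = f := funext he3
  rw [hf0] at he4
  refine ⟨e, he1, he2.trans (hεW.trans hWU), by rw [hecoe]; exact hfs.mono he2, he5,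
    by rw [he3, hf0], ⟨δ, hδ, ?_, he4⟩, ?_⟩
  · intro r hr
    have hmem : (!₂[r, 0] : E2) ∈ e.target := by
      rw [he4, mem_ball_zero_iff]
      apply lt_of_pow_lt_pow_left₀ 2 hδ.le
      rw [norm_sq_eq]
      simpa using pow_lt_pow_left₀ hr.2 hr.1.le (two_ne_zero)
    have h2 := hεW (he2 (e.map_target hmem))
    have h3 := hfn _ h2
    rw [← he3, e.right_inv hmem, norm_sq_eq] at h3
    rw [Phi_pos_iff R₀ hr.1.ne']
    have h4 := hM _ h2
    rw [h3] at h4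
    simpa using h4
  · intro u hue
    have hub := he2 hue
    have huW' := hεW hub
    rw [hecoe]
    have hn := hfn u huW'
    refine ⟨by linarith, fun hne v w => ?_⟩
    have hfne : f u ≠ 0 := by
      rw [← hf0, ← he3, ← he3]
      exact fun h => hne (e.injOn hue he1 h)
    have hr : ‖f u‖ ≠ 0 := norm_ne_zero_iff.2 hfne
    have ht : 0 < R₀ - R u := by rw [hn]; positivity
    have hs : 0 < p u ^ 2 + q u ^ 2 := by
      have := hM u huW'
      rw [hsp u huW']; positivity
    rw [metric_eq_of_speed hR₀ hr hs rfl (hsp u huW') hn, polarMetric]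
    -- Differentiates ‖f‖² = 4 (R₀ - R), which avoids the derivatives of χ and of the scale.
    have hrad : ∀ v, dRad (f u) (fderiv ℝ f u v) =
        -2 / ‖f u‖ * (p u * a u v + q u * b u v) := by
      intro v
      have h1 : HasFDerivAt (fun u => f u 0 ^ 2 + f u 1 ^ 2) _ u :=
        ((((EuclideanSpace.proj (𝕜 := ℝ) (0 : Fin 2) : E2 →L[ℝ] ℝ).hasFDerivAt.comp u
          (hfd u hub).hasFDerivAt).pow 2).add (((EuclideanSpace.proj (𝕜 := ℝ) (1 : Fin 2) :
          E2 →L[ℝ] ℝ).hasFDerivAt.comp u (hfd u hub).hasFDerivAt).pow 2))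
      obtain ⟨-, -, -, hR, -, -⟩ := h.differentiableAt hU (hWU huW')
      have h2 : HasFDerivAt (fun u => 4 * (R₀ - R u)) _ u :=
        (hR.hasFDerivAt.const_sub R₀).const_mul 4
      have h3 : (fun u => f u 0 ^ 2 + f u 1 ^ 2) =ᶠ[𝓝 u] fun u => 4 * (R₀ - R u) := by
        filter_upwards [hW.mem_nhds huW'] with y hy
        rw [hfn y hy, norm_sq_eq]; ring
      have h4 := congrArg (fun l : E2 →L[ℝ] ℝ => l v) (h1.unique (h2.congr_of_eventuallyEq h3))
      simp [h.dR u (hWU huW')] at h4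
      rw [dRad]
      field_simp
      linarith
    have hang : ∀ v, dAng (f u) (fderiv ℝ f u v) =
        -(R₀ - 1) * Real.exp (R₀ - R u) / (p u ^ 2 + q u ^ 2) * (p u * b u v - q u * a u v) := by
      intro v
      obtain ⟨dk, hdk⟩ := hdf u hub
      obtain ⟨h0, h1⟩ := hdk v
      have h2 := poleScale_sq_mul (hM u huW') (hsp u huW')
      have h3 := poleCoeff_mul (hM u huW').ne' (hsp u huW')
      have h4 := Real.sin_sq_add_cos_sq (χ u)
      have h5 : ‖f u‖ ^ 2 = k u ^ 2 * (p u ^ 2 + q u ^ 2) := by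
        rw [h2, hn]; ring
      have hk0 : k u ≠ 0 := (poleScale_pos (hM u huW')).ne'
      rw [dAng, h0, h1, h5]
      have h6 : f u 0 = -k u * (p u * Real.cos (χ u) - q u * Real.sin (χ u)) := rfl
      have h7 : f u 1 = -k u * (p u * Real.sin (χ u) + q u * Real.cos (χ u)) := rfl
      rw [h6, h7, h.dp u (hWU huW'), h.dq u (hWU huW')]
      simp only [poleForm, rotForm, add_apply, smul_apply, sub_apply, smul_eq_mul]
      rw [div_eq_iff (by positivity)]
      have h8 : -(R₀ - 1) * Real.exp (R₀ - R u) / (p u ^ 2 + q u ^ 2) *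
          (p u * b u v - q u * a u v) * (k u ^ 2 * (p u ^ 2 + q u ^ 2)) =
          -(R₀ - 1) * Real.exp (R₀ - R u) * (p u * b u v - q u * a u v) * k u ^ 2 := by
        field_simp
      rw [h8]
      linear_combination k u ^ 2 * ((1 - R u) * (p u * b u v - q u * a u v) -
        (p u ^ 2 + q u ^ 2) * poleCoeff R₀ (R u) * (p u * b u v - q u * a u v)) * h4 -
        k u ^ 2 * (p u * b u v - q u * a u v) * h3
    rw [hrad, hrad, hang, hang]

end NormalForm

/-! ### Straightening a submersion -/

section FlowBox

variable {S : Type*} [TopologicalSpace S] [ChartedSpace E3 S]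
  {L : Type*} [TopologicalSpace L] [ChartedSpace E2 L]

/-- `Ψ`, with local inverse `G`, straightens the submersion `pr` of `V` near `x`: read in the
preferred chart at `pr x` it is the projection `E2 × ℝ → E2`. -/
structure IsFlowBox (V : Set S) (pr : S → L) (x : S) (Ψ : E2 × ℝ → S) (G : S → E2 × ℝ) (ε : ℝ) :
    Prop where
  pos : 0 < ε
  base : Ψ (extChartAt (𝓡 2) (pr x) (pr x), 0) = x
  smooth : ContMDiffOn 𝓘(ℝ, E2 × ℝ) (𝓡 3) ∞ Ψ
    (Metric.ball (extChartAt (𝓡 2) (pr x) (pr x), (0 : ℝ)) ε)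
  left_inv : ∀ z ∈ Metric.ball (extChartAt (𝓡 2) (pr x) (pr x), (0 : ℝ)) ε, G (Ψ z) = z
  mem : ∀ z ∈ Metric.ball (extChartAt (𝓡 2) (pr x) (pr x), (0 : ℝ)) ε,
    Ψ z ∈ V ∧ z.1 ∈ (extChartAt (𝓡 2) (pr x)).target ∧
      pr (Ψ z) = (extChartAt (𝓡 2) (pr x)).symm z.1
  inv : ∀ᶠ y in 𝓝 x, ContMDiffAt (𝓡 3) 𝓘(ℝ, E2 × ℝ) ∞ G y ∧
    G y ∈ Metric.ball (extChartAt (𝓡 2) (pr x) (pr x), (0 : ℝ)) ε ∧ Ψ (G y) = y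

/-- The kernel is a line; the inner product with a spanning vector is injective on it and completes
`A` to an isomorphism. -/
lemma exists_complement {A : E3 →L[ℝ] E2} (hA : Function.Surjective A) :
    ∃ l : E3 →L[ℝ] ℝ, ∃ e : E3 ≃L[ℝ] E2 × ℝ, (e : E3 →L[ℝ] E2 × ℝ) = A.prod l := by
  have hrank := LinearMap.finrank_range_add_finrank_ker (A : E3 →ₗ[ℝ] E2)
  have hr : Module.finrank ℝ (LinearMap.range (A : E3 →ₗ[ℝ] E2)) = 2 := by
    rw [LinearMap.range_eq_top.2 hA, finrank_top]; simp
  rw [hr] at hrank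
  have hk : Module.finrank ℝ (LinearMap.ker (A : E3 →ₗ[ℝ] E2)) = 1 := by
    have : Module.finrank ℝ E3 = 3 := by simp
    omega
  obtain ⟨v, hv0, hv⟩ := finrank_eq_one_iff'.1 hk
  have hv1 : (v : E3) ≠ 0 := fun h => hv0 (Subtype.ext h)
  refine ⟨innerSL ℝ (v : E3), ?_⟩
  have hinj : Function.Injective (A.prod (innerSL ℝ (v : E3)) : E3 →ₗ[ℝ] E2 × ℝ) := by
    rw [injective_iff_map_eq_zero]
    intro w hw
    have h1 : A w = 0 := congrArg Prod.fst hw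
    have h2 : inner ℝ (v : E3) w = 0 := congrArg Prod.snd hw
    obtain ⟨c, hc⟩ := hv ⟨w, h1⟩
    have hc' : c • (v : E3) = w := congrArg Subtype.val hc
    rw [← hc', inner_smul_right, mul_eq_zero] at h2
    rcases h2 with h2 | h2
    · rw [← hc', h2, zero_smul]
    · exact absurd (inner_self_eq_zero.1 h2) hv1
  exact ⟨(LinearEquiv.ofInjectiveOfFinrankEq _ hinj (by simp)).toContinuousLinearEquiv, by
    ext w <;> rfl⟩

variable [IsManifold (𝓡 3) ∞ S] [IsManifold (𝓡 2) ∞ L]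

/-- The inverse function theorem, in a chart, for the projection completed by a linear functional
that is nonzero on the kernel of its differential. -/
lemma exists_flowBox {V : Set S} (hV : IsOpen V) {pr : S → L}
    (hs : ContMDiffOn (𝓡 3) (𝓡 2) ∞ pr V) {x : S} (hx : x ∈ V)
    (hsub : Function.Surjective (mfderiv (𝓡 3) (𝓡 2) pr x)) :
    ∃ Ψ G ε, IsFlowBox V pr x Ψ G ε := by
  set φ := extChartAt (𝓡 3) x with hφ
  set κ := extChartAt (𝓡 2) (pr x) with hκ
  have hφx : φ x ∈ φ.target := mem_extChartAt_target x
  have hφxx : φ.symm (φ x) = x := extChartAt_to_inv x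
  have hκo : IsOpen κ.source := isOpen_extChartAt_source _
  have hφo : IsOpen φ.source := isOpen_extChartAt_source _
  have hφc : ContinuousOn φ.symm φ.target := continuousOn_extChartAt_symm x
  have hO1 : IsOpen (V ∩ pr ⁻¹' κ.source) := hs.continuousOn.isOpen_inter_preimage hV hκo
  set O := φ.target ∩ φ.symm ⁻¹' (V ∩ pr ⁻¹' κ.source) with hOdef
  have hO : IsOpen O := hφc.isOpen_inter_preimage (isOpen_extChartAt_target x) hO1
  have hxO : φ x ∈ O := ⟨hφx, by rw [mem_preimage, hφxx]; exact ⟨hx, mem_extChartAt_source _⟩⟩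
  set F₀ : E3 → E2 := fun z => κ (pr (φ.symm z)) with hF₀
  have hF₀s : ContDiffOn ℝ ∞ F₀ O := by
    intro z hz
    have h1 : ContMDiffAt (𝓡 3) (𝓡 2) ∞ pr (φ.symm z) := hs.contMDiffAt (hV.mem_nhds hz.2.1)
    have h2 : ContMDiffAt (𝓡 2) 𝓘(ℝ, E2) ∞ κ (pr (φ.symm z)) :=
      contMDiffAt_extChartAt' (by simpa [hκ] using hz.2.2)
    have h3 : ContMDiffAt 𝓘(ℝ, E3) 𝓘(ℝ, E2) ∞ F₀ z :=
      ContMDiffAt.comp z h2 (ContMDiffAt.comp z h1 (contMDiffAt_symm_extChartAt hz.1))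
    exact h3.contDiffAt.contDiffWithinAt
  have hdF₀ : DifferentiableAt ℝ F₀ (φ x) :=
    (hF₀s.contDiffAt (hO.mem_nhds hxO)).differentiableAt (by simp)
  have hsurj : Function.Surjective (fderiv ℝ F₀ (φ x)) := by
    obtain ⟨e1, he1⟩ := exists_equiv_mfderiv_symm hφx
    have h2 := isInvertible_mfderiv_extChartAt (I := 𝓡 2) (mem_extChartAt_source (pr x))
    obtain ⟨e2, he2⟩ := h2
    have h1 : MDifferentiableAt (𝓡 3) (𝓡 2) pr (φ.symm (φ x)) := by
      rw [hφxx]; exact (hs.contMDiffAt (hV.mem_nhds hx)).mdifferentiableAt (by simp)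
    have h3 : MDifferentiableAt (𝓡 2) 𝓘(ℝ, E2) κ (pr (φ.symm (φ x))) := by
      rw [hφxx]; exact mdifferentiableAt_extChartAt (mem_chart_source _ _)
    have h4 : MDifferentiableAt 𝓘(ℝ, E3) (𝓡 3) φ.symm (φ x) :=
      (contMDiffAt_symm_extChartAt hφx).mdifferentiableAt (by simp)
    have h5 : fderiv ℝ F₀ (φ x) = (mfderiv (𝓡 2) 𝓘(ℝ, E2) κ (pr (φ.symm (φ x)))).comp
        ((mfderiv (𝓡 3) (𝓡 2) pr (φ.symm (φ x))).comp (mfderiv 𝓘(ℝ, E3) (𝓡 3) φ.symm (φ x))) := by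
      rw [← mfderiv_eq_fderiv, ← mfderiv_comp (φ x) h1 h4]
      exact mfderiv_comp (φ x) h3 (h1.comp (φ x) h4)
    have h6 : Function.Surjective (mfderiv 𝓘(ℝ, E3) (𝓡 3) φ.symm (φ x)) := by
      rw [← he1]; exact e1.surjective
    have h7 : Function.Surjective (mfderiv (𝓡 2) 𝓘(ℝ, E2) κ (pr (φ.symm (φ x)))) := by
      rw [hφxx, ← he2]; exact e2.surjective
    have h8 : Function.Surjective (mfderiv (𝓡 3) (𝓡 2) pr (φ.symm (φ x))) := by
      rw [hφxx]; exact hsub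
    rw [h5]
    exact h7.comp (h8.comp h6)
  obtain ⟨l, e', he'⟩ := exists_complement hsurj
  set F : E3 → E2 × ℝ := fun z => (F₀ z, l z - l (φ x)) with hF
  have hFs : ContDiffOn ℝ ∞ F O := hF₀s.prodMk (l.contDiff.contDiffOn.sub contDiffOn_const)
  have hFd : HasFDerivAt F (e' : E3 →L[ℝ] E2 × ℝ) (φ x) := by
    rw [he']; exact hdF₀.hasFDerivAt.prodMk (l.hasFDerivAt.sub_const _)
  obtain ⟨δ, hδ, hloc⟩ := exists_localDiffeo_onto hO hFs hxO hFd
  have hFx : F (φ x) = (κ (pr x), 0) := by simp [hF, hF₀, hφxx]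
  obtain ⟨e, he1, he2, he3, he4, he5⟩ := hloc (Metric.ball (F (φ x)) δ) Metric.isOpen_ball
    (Metric.mem_ball_self hδ) le_rfl
  rw [hFx] at he4
  refine ⟨φ.symm ∘ e.symm, F ∘ φ, δ, hδ, ?_, ?_, ?_, ?_, ?_⟩
  · rw [← hFx, ← he3, Function.comp, e.left_inv he1, hφxx]
  · rw [← he4]
    intro z hz
    have h1 := he2 (e.map_target hz)
    have h2 : ContMDiffAt 𝓘(ℝ, E2 × ℝ) 𝓘(ℝ, E3) ∞ e.symm z :=
      (he5.contDiffAt (e.open_target.mem_nhds hz)).contMDiffAt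
    exact (ContMDiffAt.comp z (contMDiffAt_symm_extChartAt h1.1) h2).contMDiffWithinAt
  · rw [← he4]
    intro z hz
    have h1 := he2 (e.map_target hz)
    simp only [Function.comp]
    rw [φ.right_inv h1.1, ← he3, e.right_inv hz]
  · rw [← he4]
    intro z hz
    have h1 := he2 (e.map_target hz)
    have h2 : κ (pr (φ.symm (e.symm z))) = z.1 := by
      have := e.right_inv hz
      rw [he3] at this
      exact congrArg Prod.fst this
    refine ⟨h1.2.1, ?_, ?_⟩
    · rw [← h2]; exact κ.map_source h1.2.2
    · rw [← h2, κ.left_inv h1.2.2]; rfl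
  · have hc : ∀ᶠ y in 𝓝 x, φ y ∈ e.source :=
      (continuousAt_extChartAt x).eventually (e.open_source.mem_nhds he1)
    filter_upwards [hc, extChartAt_source_mem_nhds (I := 𝓡 3) x] with y hy hys
    refine ⟨?_, ?_, ?_⟩
    · have h1 : ContMDiffAt 𝓘(ℝ, E3) 𝓘(ℝ, E2 × ℝ) ∞ F (φ y) :=
        (hFs.contDiffAt (hO.mem_nhds (he2 hy))).contMDiffAt
      exact ContMDiffAt.comp y h1 (contMDiffAt_extChartAt' (by simpa [hφ] using hys))
    · rw [← he4, Function.comp, ← he3]; exact e.map_source hy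
    · simp only [Function.comp]
      rw [← he3, e.left_inv hy, φ.left_inv hys]

end FlowBox

/-! ### Leaves as fibers, and their tangent directions -/

section Leaves

variable {S : Type*} [TopologicalSpace S] [ChartedSpace E3 S]
  {L : Type*} [TopologicalSpace L] [ChartedSpace E2 L] {α : Fin 3 → OneForm S} {R : S → ℝ}
  {V : Set S} {pr : S → L}

section Composition

variable {E F : Type*} [NormedAddCommGroup E] [NormedSpace ℝ E] [NormedAddCommGroup F]
  [NormedSpace ℝ F]

lemma pullForm_comp {f : F → S} {g : E → F} {u : E} (hf : MDifferentiableAt 𝓘(ℝ, F) (𝓡 3) f (g u))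
    (hg : DifferentiableAt ℝ g u) (a : OneForm S) (v : E) :
    pullForm (f ∘ g) a u v = pullForm f a (g u) (fderiv ℝ g u v) := by
  have h : mfderiv 𝓘(ℝ, E) (𝓡 3) (f ∘ g) u =
      (mfderiv 𝓘(ℝ, F) (𝓡 3) f (g u)).comp (mfderiv 𝓘(ℝ, E) 𝓘(ℝ, F) g u) :=
    mfderiv_comp u hf hg.mdifferentiableAt
  rw [mfderiv_eq_fderiv] at h
  rw [pullForm_apply, h]
  rfl

lemma pullForm_congr {f g : E → S} {u : E} (h : f =ᶠ[𝓝 u] g) (a : OneForm S) :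
    pullForm f a u = pullForm g a u := by
  ext v
  rw [pullForm_apply, pullForm_apply, h.mfderiv_eq, h.eq_of_nhds]

end Composition

/-- A curve in a leaf of the foliation `{α¹ = 0, α² = 0}` of `V`. -/
structure IsLeafCurve (α : Fin 3 → OneForm S) (V : Set S) (γ : ℝ → S) : Prop where
  smooth : ContMDiff 𝓘(ℝ, ℝ) (𝓡 3) ∞ γ
  mem : ∀ t, γ t ∈ V
  zero : ∀ t, pullForm γ (α 0) t 1 = 0
  one : ∀ t, pullForm γ (α 1) t 1 = 0

lemma sameLeaf_iff {x y : S} : SameLeaf α V x y ↔ ∃ γ, IsLeafCurve α V γ ∧ γ 0 = x ∧ γ 1 = y :=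
  ⟨fun ⟨γ, h1, h2, h3, h4⟩ => ⟨γ, ⟨h1, fun t => (h4 t).1, fun t => (h4 t).2.1,
    fun t => (h4 t).2.2⟩, h2, h3⟩,
  fun ⟨γ, h, h2, h3⟩ => ⟨γ, h.smooth, h2, h3, fun t => ⟨h.mem t, h.zero t, h.one t⟩⟩⟩

lemma IsLeafCurve.sameLeaf {γ : ℝ → S} (h : IsLeafCurve α V γ) (s t : ℝ) :
    SameLeaf α V (γ s) (γ t) := by
  rw [sameLeaf_iff]
  set g : ℝ → ℝ := fun τ => s + τ * (t - s) with hg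
  have hgs : ContDiff ℝ ∞ g := by fun_prop
  have hgd : ∀ τ, HasDerivAt g (t - s) τ := fun τ => by
    simpa [hg] using ((hasDerivAt_id τ).mul_const (t - s)).const_add s
  have key : ∀ i, (∀ t, pullForm γ (α i) t 1 = 0) → ∀ τ, pullForm (γ ∘ g) (α i) τ 1 = 0 := by
    intro i hi τ
    rw [pullForm_comp (h.smooth.mdifferentiable (by simp) _) (hgd τ).differentiableAt]
    have : fderiv ℝ g τ 1 = (t - s) • (1 : ℝ) := by
      rw [(hgd τ).hasFDerivAt.fderiv]; simp
    rw [this, map_smul, hi, smul_zero]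
  refine ⟨γ ∘ g, ⟨h.smooth.comp hgs.contMDiff, fun τ => h.mem _, key 0 h.zero, key 1 h.one⟩, ?_, ?_⟩
  · simp [hg]
  · simp [hg]

lemma IsLeafSpace.pr_leafCurve (h : IsLeafSpace α V pr) {γ : ℝ → S} (hγ : IsLeafCurve α V γ)
    (s t : ℝ) : pr (γ s) = pr (γ t) :=
  (h.fibers _ (hγ.mem s) _ (hγ.mem t)).2 (hγ.sameLeaf s t)

/-- A property of points of a fiber that is locally constant along the fibers is constant. -/
lemma IsLeafSpace.eq_of_locally_eq (h : IsLeafSpace α V pr) {X : Type*} {f : S → X}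
    (hf : ∀ x ∈ V, ∀ᶠ y in 𝓝 x, pr y = pr x → f y = f x) {x y : S} (hx : x ∈ V) (hy : y ∈ V)
    (hxy : pr x = pr y) : f x = f y := by
  obtain ⟨γ, hγ, h0, h1⟩ := sameLeaf_iff.1 ((h.fibers x hx y hy).1 hxy)
  have hloc : IsLocallyConstant (f ∘ γ) := by
    rw [IsLocallyConstant.iff_eventually_eq]
    intro t
    filter_upwards [hγ.smooth.continuous.continuousAt.eventually (hf _ (hγ.mem t))] with s hs
    exact hs (h.pr_leafCurve hγ s t)
  have := hloc.apply_eq_of_preconnectedSpace 0 1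
  simpa [h0, h1] using this

variable [IsManifold (𝓡 3) ∞ S] {x : S} {Ψ : E2 × ℝ → S} {G : S → E2 × ℝ} {ε : ℝ}

omit [IsManifold (𝓡 3) ∞ S] in
lemma IsFlowBox.fst_eq (hB : IsFlowBox V pr x Ψ G ε) {z : E2 × ℝ}
    (hz : z ∈ Metric.ball (extChartAt (𝓡 2) (pr x) (pr x), (0 : ℝ)) ε)
    (h : pr (Ψ z) = pr x) : z.1 = extChartAt (𝓡 2) (pr x) (pr x) := by
  obtain ⟨-, h1, h2⟩ := hB.mem z hz
  have h3 := (extChartAt (𝓡 2) (pr x)).right_inv h1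
  rw [← h2, h] at h3
  exact h3.symm

/-- The vertical direction of a flow box is tangent to the leaves: near a point where it were not,
leaf curves would be constant, whereas the fiber contains an arc. -/
lemma IsFlowBox.forms_vertical_base [T2Space S] (hα : ∀ i, SmoothForm (α i))
    (h : IsLeafSpace α V pr)
    (hx : x ∈ V) (hB : IsFlowBox V pr x Ψ G ε) {i : Fin 3} (hi : i = 0 ∨ i = 1) :
    pullForm Ψ (α i) (extChartAt (𝓡 2) (pr x) (pr x), 0) (0, 1) = 0 := by
  by_contra hne
  set u₀ := extChartAt (𝓡 2) (pr x) (pr x) with hu₀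
  have hcont : ContinuousAt (fun z => pullForm Ψ (α i) z (0, 1)) (u₀, 0) :=
    ((contDiffAt_pullForm (hB.smooth.contMDiffAt
      (Metric.isOpen_ball.mem_nhds (Metric.mem_ball_self hB.pos))) (hα i)).clm_apply
      contDiffAt_const).continuousAt
  obtain ⟨δ, hδ, hball⟩ := Metric.eventually_nhds_iff_ball.1 (hcont.eventually_ne hne)
  -- A second point of the fiber of x; being in the same leaf, it is joined to x by a leaf curve.
  set y := Ψ (u₀, ε / 2) with hy
  have hmem : (u₀, ε / 2) ∈ Metric.ball (u₀, (0 : ℝ)) ε := by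
    rw [← ball_prod_same]
    have := hB.pos
    refine ⟨Metric.mem_ball_self hB.pos, ?_⟩
    simp [abs_of_pos this, this]
  have hyV := hB.mem _ hmem
  have hyx : x ≠ y := by
    intro hxy
    have h1 := hB.left_inv _ hmem
    have h2 := hB.left_inv _ (Metric.mem_ball_self hB.pos)
    rw [hB.base, hxy, h1] at h2
    have := congrArg Prod.snd h2
    have := hB.pos
    simp at *
    linarith
  have hpr : pr x = pr y := by
    rw [hyV.2.2, hu₀, extChartAt_to_inv]
  obtain ⟨γ, hγ, h0, h1⟩ := sameLeaf_iff.1 ((h.fibers x hx y hyV.1).1 hpr)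
  -- The leaf curve cannot leave x: the times spent at x form a closed set since S is Hausdorff, and
  -- an open one by the argument in the flow box.
  have hclopen : IsClopen (γ ⁻¹' {x}) := by
    refine ⟨isClosed_singleton.preimage hγ.smooth.continuous, ?_⟩
    rw [isOpen_iff_mem_nhds]
    intro s hs
    have hs' : γ s = x := hs
    have hGx : G x = (u₀, 0) := by
      have := hB.left_inv _ (Metric.mem_ball_self hB.pos)
      rwa [hB.base] at this
    have hGc : ContinuousAt G x := hB.inv.self_of_nhds.1.continuousAt
    have hev : ∀ᶠ y in 𝓝 x, G y ∈ Metric.ball (u₀, (0 : ℝ)) δ := by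
      refine hGc.eventually ?_
      rw [hGx]; exact Metric.ball_mem_nhds _ hδ
    have hγc : Filter.Tendsto γ (𝓝 s) (𝓝 x) := hs' ▸ hγ.smooth.continuous.continuousAt
    obtain ⟨ρ, hρ, hball'⟩ := Metric.eventually_nhds_iff_ball.1
      (hγc.eventually (hB.inv.and hev))
    have hfst : ∀ t ∈ Metric.ball s ρ, (G (γ t)).1 = u₀ := by
      intro t ht
      obtain ⟨⟨-, h2, h3⟩, -⟩ := hball' t ht
      exact hB.fst_eq h2 (by rw [h3, h.pr_leafCurve hγ t s, hs'])
    have hsm : ∀ t ∈ Metric.ball s ρ, DifferentiableAt ℝ (G ∘ γ) t := fun t ht =>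
      (((hball' t ht).1.1.comp t (hγ.smooth t)).mdifferentiableAt (by simp)).differentiableAt
    -- Inside the box the curve moves only vertically. Its velocity is killed by `α i`, which is
    -- nonzero on the vertical direction near x, so the velocity is zero.
    have hder : ∀ t ∈ Metric.ball s ρ, HasDerivAt (fun t => (G (γ t)).2) 0 t := by
      intro t ht
      have hnb : Metric.ball s ρ ∈ 𝓝 t := Metric.isOpen_ball.mem_nhds ht
      have hd := (hsm t ht).hasDerivAt
      have h2 : HasDerivAt (fun t => (G (γ t)).2) (deriv (G ∘ γ) t).2 t :=
        hd.snd
      have h1 : HasDerivAt (fun t => (G (γ t)).1) (deriv (G ∘ γ) t).1 t :=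
        hd.fst
      have h1' : (deriv (G ∘ γ) t).1 = 0 := by
        refine h1.unique ((hasDerivAt_const t u₀).congr_of_eventuallyEq ?_)
        filter_upwards [hnb] with t' ht' using hfst t' ht'
      have heq : γ =ᶠ[𝓝 t] Ψ ∘ (G ∘ γ) := by
        filter_upwards [hnb] with t' ht' using (hball' t' ht').1.2.2.symm
      have h3 : pullForm γ (α i) t 1 = pullForm Ψ (α i) (G (γ t)) (deriv (G ∘ γ) t) := by
        rw [pullForm_congr heq, pullForm_comp _ (hsm t ht)]
        · rfl
        · exact (hB.smooth.contMDiffAt (Metric.isOpen_ball.mem_nhds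
            (hball' t ht).1.2.1)).mdifferentiableAt (by simp)
      have h4 : deriv (G ∘ γ) t = (deriv (G ∘ γ) t).2 • ((0, 1) : E2 × ℝ) := by
        ext1
        · simp [h1']
        · simp
      have h5 : pullForm γ (α i) t 1 = 0 := by
        rcases hi with rfl | rfl
        · exact hγ.zero t
        · exact hγ.one t
      rw [h3, h4, map_smul, smul_eq_mul, mul_eq_zero] at h5
      have h6 := h5.resolve_right (hball _ (hball' t ht).2)
      rwa [h6] at h2
    have hcst : ∀ t ∈ Metric.ball s ρ, (G (γ t)).2 = (G (γ s)).2 := fun t ht =>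
      (convex_ball s ρ).is_const_of_fderivWithin_eq_zero (𝕜 := ℝ) (f := fun t => (G (γ t)).2)
        (fun t ht => (hder t ht).differentiableAt.differentiableWithinAt)
        (fun t ht => by
          rw [fderivWithin_of_isOpen Metric.isOpen_ball ht, (hder t ht).hasFDerivAt.fderiv]
          simp) ht (Metric.mem_ball_self hρ)
    filter_upwards [Metric.ball_mem_nhds s hρ] with t ht
    have h7 : G (γ t) = G (γ s) := Prod.ext ((hfst t ht).trans (hfst s (Metric.mem_ball_self hρ)).symm)
      (hcst t ht)
    have h8 := (hball' t ht).1.2.2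
    rw [h7, (hball' s (Metric.mem_ball_self hρ)).1.2.2, hs'] at h8
    exact h8.symm
  have huniv := hclopen.eq_univ ⟨0, h0⟩
  have : γ 1 = x := by
    have : (1 : ℝ) ∈ γ ⁻¹' {x} := huniv ▸ mem_univ _
    exact this
  exact hyx (this.symm.trans h1)

end Leaves

/-! ### The quadratic form (α¹)² + (α²)² on the quotient tangent space -/

section FiberForm

variable {S : Type*} [TopologicalSpace S] [ChartedSpace E3 S]
  {L : Type*} [TopologicalSpace L] [ChartedSpace E2 L] {α : Fin 3 → OneForm S} {R : S → ℝ}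
  {V : Set S} {pr : S → L}

lemma exists_rightInverse {A : E3 →L[ℝ] E2} (hA : Function.Surjective A) :
    ∃ B : E2 →L[ℝ] E3, ∀ w, A (B w) = w := by
  obtain ⟨g, hg⟩ := (A : E3 →ₗ[ℝ] E2).exists_rightInverse_of_surjective (LinearMap.range_eq_top.2 hA)
  exact ⟨LinearMap.toContinuousLinearMap g, fun w => LinearMap.congr_fun hg w⟩

/-- A right inverse of the differential of `pr`. -/
def horizontalLift (pr : S → L) (x : S) : E2 →L[ℝ] E3 :=
  Classical.epsilon fun B : E2 →L[ℝ] E3 => ∀ w, (mfderiv (𝓡 3) (𝓡 2) pr x : E3 →L[ℝ] E2) (B w) = w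

/-- The bilinear form on the tangent space of the leaf space at `pr x` that pulls back to
`(α¹)² + (α²)²` at `x`. -/
def fiberForm (α : Fin 3 → OneForm S) (pr : S → L) (x : S) : E2 →L[ℝ] E2 →L[ℝ] ℝ :=
  ((α 0 x : E3 →L[ℝ] ℝ).comp (horizontalLift pr x)).smulRight
      ((α 0 x : E3 →L[ℝ] ℝ).comp (horizontalLift pr x)) +
    ((α 1 x : E3 →L[ℝ] ℝ).comp (horizontalLift pr x)).smulRight
      ((α 1 x : E3 →L[ℝ] ℝ).comp (horizontalLift pr x))

variable [IsManifold (𝓡 2) ∞ L] {x : S} {Ψ : E2 × ℝ → S} {G : S → E2 × ℝ}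
  {ε : ℝ}

lemma contMDiffAt_symm_extChartAt₂ {q₀ : L} {z : E2} (hz : z ∈ (extChartAt (𝓡 2) q₀).target) :
    ContMDiffAt 𝓘(ℝ, E2) (𝓡 2) ∞ (extChartAt (𝓡 2) q₀).symm z :=
  (contMDiffOn_extChartAt_symm q₀).contMDiffAt ((isOpen_extChartAt_target q₀).mem_nhds hz)

lemma exists_equiv_mfderiv_symm₂ {q₀ : L} {z : E2} (hz : z ∈ (extChartAt (𝓡 2) q₀).target) :
    ∃ e : E2 ≃L[ℝ] E2, (e : E2 →L[ℝ] E2) =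
      mfderiv 𝓘(ℝ, E2) (𝓡 2) (extChartAt (𝓡 2) q₀).symm z := by
  have := isInvertible_mfderivWithin_extChartAt_symm (I := 𝓡 2) hz
  rw [ModelWithCorners.range_eq_univ, mfderivWithin_univ] at this
  exact this

lemma IsFlowBox.mfderiv_pr (hV : IsOpen V) (hs : ContMDiffOn (𝓡 3) (𝓡 2) ∞ pr V)
    (hB : IsFlowBox V pr x Ψ G ε) {z : E2 × ℝ}
    (hz : z ∈ Metric.ball (extChartAt (𝓡 2) (pr x) (pr x), (0 : ℝ)) ε) (v : E2 × ℝ) :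
    (mfderiv (𝓡 3) (𝓡 2) pr (Ψ z) : E3 →L[ℝ] E2)
      ((mfderiv 𝓘(ℝ, E2 × ℝ) (𝓡 3) Ψ z : E2 × ℝ →L[ℝ] E3) v) =
      (mfderiv 𝓘(ℝ, E2) (𝓡 2) (extChartAt (𝓡 2) (pr x)).symm z.1 : E2 →L[ℝ] E2) v.1 := by
  obtain ⟨h1, h2, h3⟩ := hB.mem z hz
  have hΨd : MDifferentiableAt 𝓘(ℝ, E2 × ℝ) (𝓡 3) Ψ z :=
    (hB.smooth.contMDiffAt (Metric.isOpen_ball.mem_nhds hz)).mdifferentiableAt (by simp)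
  have hprd : MDifferentiableAt (𝓡 3) (𝓡 2) pr (Ψ z) :=
    (hs.contMDiffAt (hV.mem_nhds h1)).mdifferentiableAt (by simp)
  have hκd : MDifferentiableAt 𝓘(ℝ, E2) (𝓡 2) (extChartAt (𝓡 2) (pr x)).symm (Prod.fst z) :=
    (contMDiffAt_symm_extChartAt₂ h2).mdifferentiableAt (by simp)
  have heq : pr ∘ Ψ =ᶠ[𝓝 z] (extChartAt (𝓡 2) (pr x)).symm ∘ Prod.fst := by
    filter_upwards [Metric.isOpen_ball.mem_nhds hz] with y hy using (hB.mem y hy).2.2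
  have h4 := mfderiv_comp z hprd hΨd
  have hfstd : MDifferentiableAt 𝓘(ℝ, E2 × ℝ) 𝓘(ℝ, E2) (Prod.fst : E2 × ℝ → E2) z :=
    differentiableAt_fst.mdifferentiableAt
  have h5 := mfderiv_comp z hκd hfstd
  rw [mfderiv_eq_fderiv, fderiv_fst] at h5
  have h6 : (mfderiv (𝓡 3) (𝓡 2) pr (Ψ z)).comp (mfderiv 𝓘(ℝ, E2 × ℝ) (𝓡 3) Ψ z) =
      (mfderiv 𝓘(ℝ, E2) (𝓡 2) (extChartAt (𝓡 2) (pr x)).symm (Prod.fst z)).comp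
        (ContinuousLinearMap.fst ℝ E2 ℝ) := by
    exact h4.symm.trans (heq.mfderiv_eq.trans h5)
  exact congrArg (fun l : E2 × ℝ →L[ℝ] E2 => l v) h6

variable [IsManifold (𝓡 3) ∞ S]

/-- In a flow box centered at x, the kernel of the differential of `pr` is the vertical line, to
which `IsFlowBox.forms_vertical_base` applies. -/
lemma IsLeafSpace.forms_eq_zero [T2Space S] (hα : ∀ i, SmoothForm (α i)) (hV : IsOpen V)
    (h : IsLeafSpace α V pr) (hx : x ∈ V) {v : E3}
    (hv : (mfderiv (𝓡 3) (𝓡 2) pr x : E3 →L[ℝ] E2) v = 0) {i : Fin 3} (hi : i = 0 ∨ i = 1) :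
    (α i x : E3 →L[ℝ] ℝ) v = 0 := by
  obtain ⟨Ψ, G, ε, hB⟩ := exists_flowBox hV h.smooth hx (h.submersion x hx)
  set κ := extChartAt (𝓡 2) (pr x) with hκ
  have hb := Metric.mem_ball_self (x := (κ (pr x), (0 : ℝ))) hB.pos
  have hGx : G x = (κ (pr x), 0) := by
    have := hB.left_inv _ hb
    rwa [hB.base] at this
  have hGd : MDifferentiableAt (𝓡 3) 𝓘(ℝ, E2 × ℝ) G x :=
    hB.inv.self_of_nhds.1.mdifferentiableAt (by simp)
  have hΨd : MDifferentiableAt 𝓘(ℝ, E2 × ℝ) (𝓡 3) Ψ (G x) := by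
    rw [hGx]
    exact (hB.smooth.contMDiffAt (Metric.isOpen_ball.mem_nhds hb)).mdifferentiableAt (by simp)
  have hid : Ψ ∘ G =ᶠ[𝓝 x] id := hB.inv.mono fun y hy => hy.2.2
  have h1 : (mfderiv 𝓘(ℝ, E2 × ℝ) (𝓡 3) Ψ (G x)).comp (mfderiv (𝓡 3) 𝓘(ℝ, E2 × ℝ) G x) =
      ContinuousLinearMap.id ℝ E3 := by
    rw [← mfderiv_comp x hΨd hGd, hid.mfderiv_eq, mfderiv_id]; rfl
  have hfst : Prod.fst ∘ G =ᶠ[𝓝 x] κ ∘ pr := by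
    filter_upwards [hB.inv] with y hy
    obtain ⟨-, h2, h3⟩ := hB.mem _ hy.2.1
    rw [hy.2.2] at h3
    simp only [Function.comp]
    rw [h3, ← hκ, PartialEquiv.right_inv _ h2]
  have hprd : MDifferentiableAt (𝓡 3) (𝓡 2) pr x :=
    (h.smooth.contMDiffAt (hV.mem_nhds hx)).mdifferentiableAt (by simp)
  have hκd : MDifferentiableAt (𝓡 2) 𝓘(ℝ, E2) κ (pr x) :=
    mdifferentiableAt_extChartAt (mem_chart_source _ _)
  set w : E2 × ℝ := (mfderiv (𝓡 3) 𝓘(ℝ, E2 × ℝ) G x : E3 →L[ℝ] E2 × ℝ) v with hw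
  have hw1 : w.1 = 0 := by
    have h2 : mfderiv (𝓡 3) 𝓘(ℝ, E2) (Prod.fst ∘ G) x =
        (ContinuousLinearMap.fst ℝ E2 ℝ).comp (mfderiv (𝓡 3) 𝓘(ℝ, E2 × ℝ) G x) := by
      have h3 : MDifferentiableAt 𝓘(ℝ, E2 × ℝ) 𝓘(ℝ, E2) (Prod.fst : E2 × ℝ → E2) (G x) :=
        differentiableAt_fst.mdifferentiableAt
      rw [mfderiv_comp x h3 hGd, mfderiv_eq_fderiv, fderiv_fst]
      rfl
    have h4 : mfderiv (𝓡 3) 𝓘(ℝ, E2) (κ ∘ pr) x =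
        (mfderiv (𝓡 2) 𝓘(ℝ, E2) κ (pr x)).comp (mfderiv (𝓡 3) (𝓡 2) pr x) :=
      mfderiv_comp x hκd hprd
    have h5 : (ContinuousLinearMap.fst ℝ E2 ℝ).comp (mfderiv (𝓡 3) 𝓘(ℝ, E2 × ℝ) G x) =
        (mfderiv (𝓡 2) 𝓘(ℝ, E2) κ (pr x)).comp (mfderiv (𝓡 3) (𝓡 2) pr x) := by
      rw [← h2, ← h4, hfst.mfderiv_eq]
    have h6 := congrArg (fun l : E3 →L[ℝ] E2 => l v) h5
    have h7 : w.1 = (mfderiv (𝓡 2) 𝓘(ℝ, E2) κ (pr x) : E2 →L[ℝ] E2)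
      ((mfderiv (𝓡 3) (𝓡 2) pr x : E3 →L[ℝ] E2) v) := h6
    rw [h7, hv]
    exact map_zero (mfderiv (𝓡 2) 𝓘(ℝ, E2) κ (pr x) : E2 →L[ℝ] E2)
  have hw2 : w = w.2 • ((0, 1) : E2 × ℝ) := by
    ext1
    · simp [hw1]
    · simp
  have h8 : (α i x : E3 →L[ℝ] ℝ) v = pullForm Ψ (α i) (G x) w := by
    have h9 : v = (mfderiv 𝓘(ℝ, E2 × ℝ) (𝓡 3) Ψ (G x) : E2 × ℝ →L[ℝ] E3) w :=
      (congrArg (fun l : E3 →L[ℝ] E3 => l v) h1).symm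
    have h10 : Ψ (G x) = x := hB.inv.self_of_nhds.2.2
    conv_lhs => rw [h9]
    rw [pullForm, h10]
    rfl
  rw [h8, hw2, map_smul, hGx, hB.forms_vertical_base hα h hx hi, smul_zero]

/-- A map from dimension 3 to dimension 2 has a nonzero kernel vector, and by hypothesis it lies in
the line cut out by `l 0` and `l 1`; so it spans that line. -/
lemma map_eq_zero_of_linearIndependent {l : Fin 3 → E3 →L[ℝ] ℝ} (hl : LinearIndependent ℝ l)
    (A : E3 →L[ℝ] E2) (hA : ∀ v, A v = 0 → l 0 v = 0 ∧ l 1 v = 0) {v : E3} (h0 : l 0 v = 0)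
    (h1 : l 1 v = 0) : A v = 0 := by
  have hker : LinearMap.ker (A : E3 →ₗ[ℝ] E2) ≠ ⊥ :=
    LinearMap.ker_ne_bot_of_finrank_lt (by simp)
  obtain ⟨w, hw, hw0⟩ := Submodule.exists_mem_ne_zero_of_ne_bot hker
  have hw' : A w = 0 := hw
  obtain ⟨hw1, hw2⟩ := hA w hw'
  have hw3 : l 2 w ≠ 0 := by
    intro hw3
    apply hw0
    refine ext_of_linearIndependent hl fun j => ?_
    fin_cases j <;> simpa
  have hvw : v = (l 2 v / l 2 w) • w := by
    refine ext_of_linearIndependent hl fun j => ?_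
    rw [map_smul, smul_eq_mul]
    fin_cases j
    · simp [h0, hw1]
    · simp [h1, hw2]
    · simp [hw3]
  rw [hvw, map_smul, hw', smul_zero]

lemma IsLeafSpace.mfderiv_eq_zero [T2Space S] (hα : ∀ i, SmoothForm (α i)) (hV : IsOpen V)
    (hli : LinearIndependent ℝ (fun i => α i x))
    (h : IsLeafSpace α V pr) (hx : x ∈ V) {v : E3} (h0 : (α 0 x : E3 →L[ℝ] ℝ) v = 0)
    (h1 : (α 1 x : E3 →L[ℝ] ℝ) v = 0) : (mfderiv (𝓡 3) (𝓡 2) pr x : E3 →L[ℝ] E2) v = 0 :=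
  map_eq_zero_of_linearIndependent (l := fun i => α i x) hli (mfderiv (𝓡 3) (𝓡 2) pr x)
    (fun _ hw => ⟨h.forms_eq_zero hα hV hx hw (Or.inl rfl),
      h.forms_eq_zero hα hV hx hw (Or.inr rfl)⟩) h0 h1

/-- The choice of `horizontalLift` is immaterial: two lifts differ by a kernel vector of the
differential of `pr`, on which α¹ and α² vanish. -/
lemma fiberForm_apply [T2Space S] (hα : ∀ i, SmoothForm (α i)) (hV : IsOpen V)
    (h : IsLeafSpace α V pr) (hx : x ∈ V) (v w : E3) :
    fiberForm α pr x ((mfderiv (𝓡 3) (𝓡 2) pr x : E3 →L[ℝ] E2) v)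
      ((mfderiv (𝓡 3) (𝓡 2) pr x : E3 →L[ℝ] E2) w) =
      (α 0 x : E3 →L[ℝ] ℝ) v * (α 0 x : E3 →L[ℝ] ℝ) w +
        (α 1 x : E3 →L[ℝ] ℝ) v * (α 1 x : E3 →L[ℝ] ℝ) w := by
  set A : E3 →L[ℝ] E2 := mfderiv (𝓡 3) (𝓡 2) pr x with hA
  have hlift : ∀ w, A (horizontalLift pr x w) = w :=
    Classical.epsilon_spec (exists_rightInverse (A := A) (h.submersion x hx))
  have key : ∀ i, (i = 0 ∨ i = 1) → ∀ v, (α i x : E3 →L[ℝ] ℝ) (horizontalLift pr x (A v)) =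
      (α i x : E3 →L[ℝ] ℝ) v := by
    intro i hi v
    have h1 : A (horizontalLift pr x (A v) - v) = 0 := by rw [map_sub, hlift, sub_self]
    have h2 := h.forms_eq_zero hα hV hx h1 hi
    exact sub_eq_zero.1 ((map_sub (α i x : E3 →L[ℝ] ℝ) _ _).symm.trans h2)
  rw [← key 0 (Or.inl rfl) v, ← key 0 (Or.inl rfl) w, ← key 1 (Or.inr rfl) v,
    ← key 1 (Or.inr rfl) w]
  rfl

lemma IsFlowBox.forms_vertical [T2Space S] (hα : ∀ i, SmoothForm (α i)) (hV : IsOpen V)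
    (h : IsLeafSpace α V pr) (hB : IsFlowBox V pr x Ψ G ε) {z : E2 × ℝ}
    (hz : z ∈ Metric.ball (extChartAt (𝓡 2) (pr x) (pr x), (0 : ℝ)) ε) {i : Fin 3}
    (hi : i = 0 ∨ i = 1) : pullForm Ψ (α i) z (0, 1) = 0 := by
  refine h.forms_eq_zero hα hV (hB.mem z hz).1 ?_ hi
  exact (hB.mfderiv_pr hV h.smooth hz (0, 1)).trans (map_zero
    (mfderiv 𝓘(ℝ, E2) (𝓡 2) (extChartAt (𝓡 2) (pr x)).symm z.1 : E2 →L[ℝ] E2))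

lemma IsFlowBox.fiberForm_apply [T2Space S] (hα : ∀ i, SmoothForm (α i)) (hV : IsOpen V)
    (h : IsLeafSpace α V pr) (hB : IsFlowBox V pr x Ψ G ε) {z : E2 × ℝ}
    (hz : z ∈ Metric.ball (extChartAt (𝓡 2) (pr x) (pr x), (0 : ℝ)) ε) (v w : E2) :
    fiberForm α pr (Ψ z)
      ((mfderiv 𝓘(ℝ, E2) (𝓡 2) (extChartAt (𝓡 2) (pr x)).symm z.1 : E2 →L[ℝ] E2) v)
      ((mfderiv 𝓘(ℝ, E2) (𝓡 2) (extChartAt (𝓡 2) (pr x)).symm z.1 : E2 →L[ℝ] E2) w) =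
      pullForm Ψ (α 0) z (v, 0) * pullForm Ψ (α 0) z (w, 0) +
        pullForm Ψ (α 1) z (v, 0) * pullForm Ψ (α 1) z (w, 0) := by
  rw [← hB.mfderiv_pr hV h.smooth hz (v, 0), ← hB.mfderiv_pr hV h.smooth hz (w, 0)]
  exact CartanLeaf.fiberForm_apply hα hV h (hB.mem z hz).1 _ _

end FiberForm

/-! ### Constancy of R and of the metric along the leaves -/

section Invariance

lemma eq_of_fderiv_vertical {F : Type*} [NormedAddCommGroup F] [NormedSpace ℝ F] {u₀ : F} {ε : ℝ}
    {f : F × ℝ → ℝ} (hf : DifferentiableOn ℝ f (Metric.ball (u₀, (0 : ℝ)) ε))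
    (h0 : ∀ z ∈ Metric.ball (u₀, (0 : ℝ)) ε, fderiv ℝ f z (0, 1) = 0) {u : F} {s t : ℝ}
    (hs : (u, s) ∈ Metric.ball (u₀, (0 : ℝ)) ε) (ht : (u, t) ∈ Metric.ball (u₀, (0 : ℝ)) ε) :
    f (u, s) = f (u, t) := by
  have hbo : IsOpen (Metric.ball (u₀, (0 : ℝ)) ε) := Metric.isOpen_ball
  have hu : u ∈ Metric.ball u₀ ε := by
    rw [← ball_prod_same] at hs
    exact hs.1
  have hconv : Convex ℝ {τ : ℝ | (u, τ) ∈ Metric.ball (u₀, (0 : ℝ)) ε} := by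
    have : {τ : ℝ | (u, τ) ∈ Metric.ball (u₀, (0 : ℝ)) ε} = Metric.ball 0 ε := by
      ext τ
      rw [← ball_prod_same]
      exact and_iff_right hu
    rw [this]
    exact convex_ball _ _
  have ho : IsOpen {τ : ℝ | (u, τ) ∈ Metric.ball (u₀, (0 : ℝ)) ε} :=
    hbo.preimage (by fun_prop)
  have hd : ∀ τ ∈ {τ : ℝ | (u, τ) ∈ Metric.ball (u₀, (0 : ℝ)) ε},
      HasDerivAt (fun τ => f (u, τ)) 0 τ := by
    intro τ hτ
    have h1 : HasFDerivAt f (fderiv ℝ f (u, τ)) (u, τ) :=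
      ((hf _ hτ).differentiableAt (hbo.mem_nhds hτ)).hasFDerivAt
    have h2 : HasDerivAt (fun τ : ℝ => (u, τ)) ((0 : F), (1 : ℝ)) τ :=
      (hasDerivAt_const τ u).prodMk (hasDerivAt_id τ)
    have := h1.comp_hasDerivAt τ h2
    rwa [h0 _ hτ] at this
  exact hconv.is_const_of_fderivWithin_eq_zero (𝕜 := ℝ) (f := fun τ => f (u, τ))
    (fun τ hτ => (hd τ hτ).differentiableAt.differentiableWithinAt)
    (fun τ hτ => by
      rw [fderivWithin_of_isOpen ho hτ, (hd τ hτ).hasFDerivAt.fderiv]; simp) hs ht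

/-- For the vertical field T, Cartan's formula gives L_T a = -c(T) b and L_T b = c(T) a: the coframe
rotates infinitesimally, which preserves a² + b². -/
lemma CartanSystem.vertical_metric {u₀ : E2} {ε : ℝ} {a b c : E2 × ℝ → E2 × ℝ →L[ℝ] ℝ}
    {R p q : E2 × ℝ → ℝ} (h : CartanSystem (Metric.ball (u₀, (0 : ℝ)) ε) a b c R p q)
    (ha : ∀ z ∈ Metric.ball (u₀, (0 : ℝ)) ε, a z (0, 1) = 0)
    (hb : ∀ z ∈ Metric.ball (u₀, (0 : ℝ)) ε, b z (0, 1) = 0) {u : E2} {s t : ℝ}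
    (hs : (u, s) ∈ Metric.ball (u₀, (0 : ℝ)) ε) (ht : (u, t) ∈ Metric.ball (u₀, (0 : ℝ)) ε)
    (v w : E2 × ℝ) :
    a (u, s) v * a (u, s) w + b (u, s) v * b (u, s) w =
      a (u, t) v * a (u, t) w + b (u, t) v * b (u, t) w := by
  have hbo : IsOpen (Metric.ball (u₀, (0 : ℝ)) ε) := Metric.isOpen_ball
  have had : ∀ z ∈ Metric.ball (u₀, (0 : ℝ)) ε, DifferentiableAt ℝ a z := fun z hz =>
    (h.smooth_a.contDiffAt (hbo.mem_nhds hz)).differentiableAt (by simp)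
  have hbd : ∀ z ∈ Metric.ball (u₀, (0 : ℝ)) ε, DifferentiableAt ℝ b z := fun z hz =>
    (h.smooth_b.contDiffAt (hbo.mem_nhds hz)).differentiableAt (by simp)
  -- Since l(T) vanishes identically, dl(T, v) is just the derivative of l(v) along T for constant
  -- v.
  have key : ∀ {l : E2 × ℝ → E2 × ℝ →L[ℝ] ℝ}, (∀ z ∈ Metric.ball (u₀, (0 : ℝ)) ε,
      DifferentiableAt ℝ l z) → (∀ z ∈ Metric.ball (u₀, (0 : ℝ)) ε, l z (0, 1) = 0) →
      ∀ z ∈ Metric.ball (u₀, (0 : ℝ)) ε, ∀ v, fderiv ℝ l z v (0, 1) = 0 := by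
    intro l hl hl0 z hz v
    have h1 : HasFDerivAt (fun z => l z (0, 1))
        ((fderiv ℝ l z).flip (0, 1)) z := by
      have := (hl z hz).hasFDerivAt.clm_apply (hasFDerivAt_const ((0 : E2), (1 : ℝ)) z)
      simpa using this
    have h2 : HasFDerivAt (fun z => l z (0, 1)) (0 : E2 × ℝ →L[ℝ] ℝ) z := by
      refine (hasFDerivAt_const (0 : ℝ) z).congr_of_eventuallyEq ?_
      filter_upwards [hbo.mem_nhds hz] with y hy using hl0 y hy
    exact congrArg (fun m : E2 × ℝ →L[ℝ] ℝ => m v) (h1.unique h2)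
  have hda : ∀ z ∈ Metric.ball (u₀, (0 : ℝ)) ε, ∀ v, fderiv ℝ a z (0, 1) v =
      -(b z v * c z (0, 1)) := by
    intro z hz v
    have h1 := h.curl_a z hz (0, 1) v
    rw [curl, key had ha z hz v, hb z hz] at h1
    linarith
  have hdb : ∀ z ∈ Metric.ball (u₀, (0 : ℝ)) ε, ∀ v, fderiv ℝ b z (0, 1) v =
      a z v * c z (0, 1) := by
    intro z hz v
    have h1 := h.curl_b z hz (0, 1) v
    rw [curl, key hbd hb z hz v, ha z hz] at h1
    linarith
  have happ : ∀ {l : E2 × ℝ → E2 × ℝ →L[ℝ] ℝ} {z : E2 × ℝ}, DifferentiableAt ℝ l z → ∀ v,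
      HasFDerivAt (fun z => l z v) ((fderiv ℝ l z).flip v) z := by
    intro l z hl v
    have := hl.hasFDerivAt.clm_apply (hasFDerivAt_const v z)
    simpa using this
  have hmain : ∀ z ∈ Metric.ball (u₀, (0 : ℝ)) ε, HasFDerivAt
      (fun z => a z v * a z w + b z v * b z w) _ z := fun z hz =>
    ((happ (had z hz) v).mul (happ (had z hz) w)).add
      ((happ (hbd z hz) v).mul (happ (hbd z hz) w))
  refine eq_of_fderiv_vertical (f := fun z => a z v * a z w + b z v * b z w)
    (fun z hz => (hmain z hz).differentiableAt.differentiableWithinAt) (fun z hz => ?_) hs ht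
  rw [(hmain z hz).fderiv]
  simp [hda z hz, hdb z hz]
  ring

variable {S : Type*} [TopologicalSpace S] [ChartedSpace E3 S]
  {L : Type*} [TopologicalSpace L] [ChartedSpace E2 L] {α : Fin 3 → OneForm S} {R : S → ℝ}
  {V : Set S} {pr : S → L} {x : S} {Ψ : E2 × ℝ → S} {G : S → E2 × ℝ} {ε : ℝ}

lemma IsFlowBox.eventually_fiber (hB : IsFlowBox V pr x Ψ G ε) :
    ∀ᶠ y in 𝓝 x, pr y = pr x → ∃ t, y = Ψ (extChartAt (𝓡 2) (pr x) (pr x), t) ∧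
      (extChartAt (𝓡 2) (pr x) (pr x), t) ∈
        Metric.ball (extChartAt (𝓡 2) (pr x) (pr x), (0 : ℝ)) ε := by
  filter_upwards [hB.inv] with y ⟨_, h2, h3⟩ hy
  have h4 := hB.fst_eq h2 (by rw [h3, hy])
  have h5 : G y = (extChartAt (𝓡 2) (pr x) (pr x), (G y).2) := Prod.ext h4 rfl
  exact ⟨(G y).2, by rw [← h5, h3], by rwa [← h5]⟩

variable [IsManifold (𝓡 3) ∞ S]

lemma IsFlowBox.cartanSystem (hα : IsCartanStructure α R) (hR : SatisfiesEDS α R)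
    (hB : IsFlowBox V pr x Ψ G ε) :
    CartanSystem (Metric.ball (extChartAt (𝓡 2) (pr x) (pr x), (0 : ℝ)) ε) (pullForm Ψ (α 0))
      (pullForm Ψ (α 1)) (pullForm Ψ (α 2)) (R ∘ Ψ) (cder α 0 R ∘ Ψ) (cder α 1 R ∘ Ψ) :=
  cartanSystem_pullForm hα hR Metric.isOpen_ball hB.smooth

variable [IsManifold (𝓡 2) ∞ L] [T2Space S]

/-- dR has no α³ term because R₃ = 0, so R has zero vertical derivative in a flow box. -/
lemma IsLeafSpace.eventually_R_eq (hα : IsCartanStructure α R) (hR : SatisfiesEDS α R)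
    (hV : IsOpen V) (h : IsLeafSpace α V pr) (hx : x ∈ V) :
    ∀ᶠ y in 𝓝 x, pr y = pr x → R y = R x := by
  obtain ⟨Ψ, G, ε, hB⟩ := exists_flowBox hV h.smooth hx (h.submersion x hx)
  have hC := hB.cartanSystem hα hR
  filter_upwards [hB.eventually_fiber] with y hy hyx
  obtain ⟨t, rfl, ht⟩ := hy hyx
  have := eq_of_fderiv_vertical (f := R ∘ Ψ) (hC.smooth_R.differentiableOn (by simp))
    (fun z hz => by
      rw [hC.dR z hz, hB.forms_vertical hα.smooth_form hV h hz (Or.inl rfl),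
        hB.forms_vertical hα.smooth_form hV h hz (Or.inr rfl)]; ring) ht
    (Metric.mem_ball_self hB.pos)
  rwa [Function.comp, Function.comp, hB.base] at this

lemma IsLeafSpace.R_eq (hα : IsCartanStructure α R) (hR : SatisfiesEDS α R)
    (hV : IsOpen V) (h : IsLeafSpace α V pr) {y : S} (hx : x ∈ V) (hy : y ∈ V)
    (hxy : pr x = pr y) : R x = R y :=
  h.eq_of_locally_eq (fun _ hz => h.eventually_R_eq hα hR hV hz) hx hy hxy

/-- Over one fiber the chart of the leaf space identifies all quotient tangent spaces with the same
plane, so `CartanSystem.vertical_metric` compares the forms directly. -/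
lemma IsLeafSpace.eventually_fiberForm_eq (hα : IsCartanStructure α R) (hR : SatisfiesEDS α R)
    (hV : IsOpen V) (h : IsLeafSpace α V pr) (hx : x ∈ V) :
    ∀ᶠ y in 𝓝 x, pr y = pr x → fiberForm α pr y = fiberForm α pr x := by
  obtain ⟨Ψ, G, ε, hB⟩ := exists_flowBox hV h.smooth hx (h.submersion x hx)
  have hC := hB.cartanSystem hα hR
  obtain ⟨e, he⟩ := exists_equiv_mfderiv_symm₂ (mem_extChartAt_target (I := 𝓡 2) (pr x))
  have hes : ∀ v, (mfderiv 𝓘(ℝ, E2) (𝓡 2) (extChartAt (𝓡 2) (pr x)).symm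
      (extChartAt (𝓡 2) (pr x) (pr x)) : E2 →L[ℝ] E2) (e.symm v) = v := fun v =>
    (congrArg (fun l : E2 →L[ℝ] E2 => l (e.symm v)) he.symm).trans (e.apply_symm_apply v)
  have h0 := Metric.mem_ball_self (x := (extChartAt (𝓡 2) (pr x) (pr x), (0 : ℝ))) hB.pos
  have key : ∀ z ∈ Metric.ball (extChartAt (𝓡 2) (pr x) (pr x), (0 : ℝ)) ε,
      z.1 = extChartAt (𝓡 2) (pr x) (pr x) → ∀ v w, fiberForm α pr (Ψ z) v w =
        pullForm Ψ (α 0) z (e.symm v, 0) * pullForm Ψ (α 0) z (e.symm w, 0) +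
        pullForm Ψ (α 1) z (e.symm v, 0) * pullForm Ψ (α 1) z (e.symm w, 0) := by
    intro z hz hz1 v w
    have := hB.fiberForm_apply hα.smooth_form hV h hz (e.symm v) (e.symm w)
    rwa [hz1, hes, hes] at this
  filter_upwards [hB.eventually_fiber] with y hy hyx
  obtain ⟨t, rfl, ht⟩ := hy hyx
  ext1 v; ext1 w
  have h1 := key _ ht rfl v w
  have h2 := key _ h0 rfl v w
  rw [hB.base] at h2
  rw [h1, h2]
  exact hC.vertical_metric (fun z hz => hB.forms_vertical hα.smooth_form hV h hz (Or.inl rfl))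
    (fun z hz => hB.forms_vertical hα.smooth_form hV h hz (Or.inr rfl)) ht h0 _ _

lemma IsLeafSpace.fiberForm_eq (hα : IsCartanStructure α R) (hR : SatisfiesEDS α R)
    (hV : IsOpen V) (h : IsLeafSpace α V pr) {y : S} (hx : x ∈ V) (hy : y ∈ V)
    (hxy : pr x = pr y) : fiberForm α pr x = fiberForm α pr y :=
  h.eq_of_locally_eq (fun _ hz => h.eventually_fiberForm_eq hα hR hV hz) hx hy hxy

end Invariance

/-! ### The induced Riemannian metric -/

section LeafMetric

/-- A positive definite bilinear form on a finite-dimensional space has a bounded unit ball. -/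
lemma isVonNBounded_of_posDef (h : E2 →L[ℝ] E2 →L[ℝ] ℝ) (hp : ∀ v, v ≠ 0 → 0 < h v v) :
    Bornology.IsVonNBounded ℝ {v : E2 | h v v < 1} := by
  have hc : Continuous fun v => h v v := by fun_prop
  obtain ⟨v₀, hv₀, hmin⟩ := (isCompact_sphere (0 : E2) 1).exists_isMinOn
    (NormedSpace.sphere_nonempty.2 zero_le_one) hc.continuousOn
  have hm : 0 < h v₀ v₀ := hp v₀ (by
    rintro rfl
    simp at hv₀)
  have hle : ∀ v, h v₀ v₀ * ‖v‖ ^ 2 ≤ h v v := by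
    intro v
    rcases eq_or_ne v 0 with rfl | hv
    · simp
    have hn : ‖v‖ ≠ 0 := norm_ne_zero_iff.2 hv
    have h1 : h v₀ v₀ ≤ h (‖v‖⁻¹ • v) (‖v‖⁻¹ • v) :=
      hmin (by simp [norm_smul, inv_mul_cancel₀ hn])
    have h2 : h (‖v‖⁻¹ • v) (‖v‖⁻¹ • v) * ‖v‖ ^ 2 = h v v := by
      simp only [map_smul, smul_apply, smul_eq_mul]
      field_simp
    rw [← h2]
    gcongr
  refine (NormedSpace.isVonNBounded_iff ℝ).2 ((Metric.isBounded_ball (x := (0 : E2))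
    (r := Real.sqrt (1 / h v₀ v₀) )).subset fun v hv => ?_)
  have hv' : h v v < 1 := hv
  rw [mem_ball_zero_iff]
  apply Real.lt_sqrt_of_sq_lt
  rw [lt_div_iff₀ hm]
  linarith [hle v]

variable {S : Type*} [TopologicalSpace S] [ChartedSpace E3 S]
  {L : Type*} [TopologicalSpace L] [ChartedSpace E2 L] {α : Fin 3 → OneForm S} {R : S → ℝ}
  {V : Set S} {pr : S → L} {x : S} {q₀ : L} {σ : E2 → S} {W : Set E2} {u : E2}

/-- `σ` is a local section of `pr` over the part of the leaf space that the preferred chart at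
`q₀` maps to `W`. -/
structure IsSlice (V : Set S) (pr : S → L) (q₀ : L) (σ : E2 → S) (W : Set E2) : Prop where
  isOpen : IsOpen W
  subset : W ⊆ (extChartAt (𝓡 2) q₀).target
  smooth : ContMDiffOn 𝓘(ℝ, E2) (𝓡 3) ∞ σ W
  mem : ∀ u ∈ W, σ u ∈ V
  pr_eq : ∀ u ∈ W, pr (σ u) = (extChartAt (𝓡 2) q₀).symm u

lemma IsSlice.mfderiv_pr (hV : IsOpen V) (hs : ContMDiffOn (𝓡 3) (𝓡 2) ∞ pr V)
    (hσ : IsSlice V pr q₀ σ W) (hu : u ∈ W) (v : E2) :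
    (mfderiv (𝓡 3) (𝓡 2) pr (σ u) : E3 →L[ℝ] E2)
      ((mfderiv 𝓘(ℝ, E2) (𝓡 3) σ u : E2 →L[ℝ] E3) v) =
      (mfderiv 𝓘(ℝ, E2) (𝓡 2) (extChartAt (𝓡 2) q₀).symm u : E2 →L[ℝ] E2) v := by
  have hσd : MDifferentiableAt 𝓘(ℝ, E2) (𝓡 3) σ u :=
    (hσ.smooth.contMDiffAt (hσ.isOpen.mem_nhds hu)).mdifferentiableAt (by simp)
  have hprd : MDifferentiableAt (𝓡 3) (𝓡 2) pr (σ u) :=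
    (hs.contMDiffAt (hV.mem_nhds (hσ.mem u hu))).mdifferentiableAt (by simp)
  have heq : pr ∘ σ =ᶠ[𝓝 u] (extChartAt (𝓡 2) q₀).symm := by
    filter_upwards [hσ.isOpen.mem_nhds hu] with y hy using hσ.pr_eq y hy
  have h4 := mfderiv_comp u hprd hσd
  exact congrArg (fun l : E2 →L[ℝ] E2 => l v) (h4.symm.trans heq.mfderiv_eq)

lemma fiberForm_symm (x : S) (v w : E2) : fiberForm α pr x v w = fiberForm α pr x w v := by
  simp [fiberForm, mul_comm]

variable [IsManifold (𝓡 2) ∞ L]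

/-- Smoothness of a field of bilinear forms, read in the preferred chart. -/
lemma contMDiffAt_bilinForm
    {s : ∀ q : L, TangentSpace (𝓡 2) q →L[ℝ] TangentSpace (𝓡 2) q →L[ℝ] ℝ}
    {H : E2 → E2 →L[ℝ] E2 →L[ℝ] ℝ} (hH : ContDiffAt ℝ ∞ H (extChartAt (𝓡 2) q₀ q₀))
    (hs : ∀ᶠ q in 𝓝 q₀, ∀ v w : E2,
      s q (mfderiv 𝓘(ℝ, E2) (𝓡 2) (extChartAt (𝓡 2) q₀).symm (extChartAt (𝓡 2) q₀ q) v :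
          E2)
        (mfderiv 𝓘(ℝ, E2) (𝓡 2) (extChartAt (𝓡 2) q₀).symm (extChartAt (𝓡 2) q₀ q) w :
          E2) = H (extChartAt (𝓡 2) q₀ q) v w) :
    ContMDiffAt (𝓡 2) ((𝓡 2).prod 𝓘(ℝ, E2 →L[ℝ] E2 →L[ℝ] ℝ)) ∞
      (fun q => TotalSpace.mk' (E2 →L[ℝ] E2 →L[ℝ] ℝ)
        (E := fun q : L => TangentSpace (𝓡 2) q →L[ℝ] TangentSpace (𝓡 2) q →L[ℝ] ℝ) q
        (s q)) q₀ := by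
  rw [contMDiffAt_hom_bundle]
  refine ⟨contMDiffAt_id, ?_⟩
  have hκ : ContMDiffAt (𝓡 2) 𝓘(ℝ, E2) ∞ (extChartAt (𝓡 2) q₀) q₀ := contMDiffAt_extChartAt
  refine (ContMDiffAt.comp q₀ hH.contMDiffAt hκ).congr_of_eventuallyEq ?_
  filter_upwards [hs, extChartAt_source_mem_nhds (I := 𝓡 2) q₀] with q hq hqs
  have hqs' : q ∈ (chartAt E2 q₀).source := by simpa using hqs
  ext v w
  have hb : q ∈ (trivializationAt E2 (TangentSpace (𝓡 2)) q₀).baseSet := by simpa using hqs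
  have hsy : ∀ v : E2, (trivializationAt E2 (TangentSpace (𝓡 2)) q₀).symm q v =
      mfderiv 𝓘(ℝ, E2) (𝓡 2) (extChartAt (𝓡 2) q₀).symm (extChartAt (𝓡 2) q₀ q) v := by
    intro v
    have h1 := TangentBundle.symmL_trivializationAt (I := 𝓡 2) hqs'
    rw [ModelWithCorners.range_eq_univ, mfderivWithin_univ] at h1
    rw [← h1]
    exact (Trivialization.symmL_apply _ hb v).symm
  rw [inCoordinates_apply_eq₂ hb hb (mem_univ _), hsy, hsy]
  simp only [Trivial.fiberBundle_trivializationAt', Trivial.linearMapAt_trivialization,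
        LinearMap.id_coe, id_eq]
  exact hq v w

/-- Surjectivity of `pr` on points and of its differential on vectors lets the pullback determine
the metric. -/
lemma IsInduced.unique (h : IsLeafSpace α V pr) {g g' : RMetric L}
    (hg : IsInduced α V pr g) (hg' : IsInduced α V pr g') : g' = g := by
  have : g'.inner = g.inner := by
    funext q
    obtain ⟨x, hx, rfl⟩ : q ∈ pr '' V := h.surj ▸ mem_univ _
    ext v w
    obtain ⟨v, rfl⟩ := h.submersion x hx v
    obtain ⟨w, rfl⟩ := h.submersion x hx w
    rw [hg x hx, hg' x hx]
  cases g; cases g'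
  congr

variable [IsManifold (𝓡 3) ∞ S]

lemma exists_slice (hV : IsOpen V) (h : IsLeafSpace α V pr) (hx : x ∈ V) :
    ∃ σ W, IsSlice V pr (pr x) σ W ∧ extChartAt (𝓡 2) (pr x) (pr x) ∈ W ∧
      σ (extChartAt (𝓡 2) (pr x) (pr x)) = x := by
  obtain ⟨Ψ, G, ε, hB⟩ := exists_flowBox hV h.smooth hx (h.submersion x hx)
  have hmem : ∀ u ∈ Metric.ball (extChartAt (𝓡 2) (pr x) (pr x)) ε,
      (u, (0 : ℝ)) ∈ Metric.ball (extChartAt (𝓡 2) (pr x) (pr x), (0 : ℝ)) ε := by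
    intro u hu
    rw [← ball_prod_same]
    exact ⟨hu, Metric.mem_ball_self hB.pos⟩
  refine ⟨fun u => Ψ (u, 0), Metric.ball _ ε, ⟨Metric.isOpen_ball,
    fun u hu => (hB.mem _ (hmem u hu)).2.1, fun u hu => ?_, fun u hu => (hB.mem _ (hmem u hu)).1,
    fun u hu => (hB.mem _ (hmem u hu)).2.2⟩, Metric.mem_ball_self hB.pos, hB.base⟩
  have h1 : ContMDiffAt 𝓘(ℝ, E2 × ℝ) (𝓡 3) ∞ Ψ (u, 0) :=
    hB.smooth.contMDiffAt (Metric.isOpen_ball.mem_nhds (hmem u hu))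
  have h2 : ContMDiffAt 𝓘(ℝ, E2) 𝓘(ℝ, E2 × ℝ) ∞ (fun u : E2 => (u, (0 : ℝ))) u :=
    (contDiffAt_id.prodMk contDiffAt_const).contMDiffAt
  exact (ContMDiffAt.comp u h1 h2).contMDiffWithinAt

variable [T2Space S]

lemma IsSlice.fiberForm_apply (hα : ∀ i, SmoothForm (α i)) (hV : IsOpen V)
    (h : IsLeafSpace α V pr) (hσ : IsSlice V pr q₀ σ W) (hu : u ∈ W) (v w : E2) :
    fiberForm α pr (σ u)
      ((mfderiv 𝓘(ℝ, E2) (𝓡 2) (extChartAt (𝓡 2) q₀).symm u : E2 →L[ℝ] E2) v)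
      ((mfderiv 𝓘(ℝ, E2) (𝓡 2) (extChartAt (𝓡 2) q₀).symm u : E2 →L[ℝ] E2) w) =
      pullForm σ (α 0) u v * pullForm σ (α 0) u w +
        pullForm σ (α 1) u v * pullForm σ (α 1) u w := by
  rw [← hσ.mfderiv_pr hV h.smooth hu v, ← hσ.mfderiv_pr hV h.smooth hu w]
  exact CartanLeaf.fiberForm_apply hα hV h (hσ.mem u hu) _ _

/-- A slice is transverse to the leaves, so α¹ and α² restrict to a coframe on it. -/
lemma IsSlice.eq_zero (hα : ∀ i, SmoothForm (α i))
    (hli : ∀ x, LinearIndependent ℝ (fun i => α i x)) (hV : IsOpen V)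
    (h : IsLeafSpace α V pr) (hσ : IsSlice V pr q₀ σ W) (hu : u ∈ W) {v : E2}
    (h0 : pullForm σ (α 0) u v = 0) (h1 : pullForm σ (α 1) u v = 0) : v = 0 := by
  have h2 := h.mfderiv_eq_zero hα hV (hli _) (hσ.mem u hu) h0 h1
  obtain ⟨e, he⟩ := exists_equiv_mfderiv_symm₂ (hσ.subset hu)
  have h3 := (hσ.mfderiv_pr hV h.smooth hu v).symm.trans h2
  have h4 : e v = 0 := (congrArg (fun l : E2 →L[ℝ] E2 => l v) he).trans h3
  exact e.map_eq_zero_iff.1 h4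

/-- The metric of the leaf space, as a family of bilinear forms. -/
def leafForm [Nonempty S] (α : Fin 3 → OneForm S) (V : Set S) (pr : S → L) (q : L) : E2 →L[ℝ] E2 →L[ℝ] ℝ :=
  fiberForm α pr (Function.invFunOn pr V q)

/-- The arbitrary preimage chosen in `leafForm` does not matter, by constancy along the fibers. -/
lemma IsLeafSpace.leafForm_eq [Nonempty S] (hα : IsCartanStructure α R) (hR : SatisfiesEDS α R)
    (hV : IsOpen V) (h : IsLeafSpace α V pr) (hx : x ∈ V) :
    leafForm α V pr (pr x) = fiberForm α pr x :=
  h.fiberForm_eq hα hR hV (Function.invFunOn_mem ⟨x, hx, rfl⟩) hx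
    (Function.invFunOn_eq ⟨x, hx, rfl⟩)

lemma fiberForm_pos (hα : IsCartanStructure α R) (hV : IsOpen V) (h : IsLeafSpace α V pr)
    (hx : x ∈ V) {v : E2} (hv : v ≠ 0) : 0 < fiberForm α pr x v v := by
  obtain ⟨w, rfl⟩ : ∃ w : E3, (mfderiv (𝓡 3) (𝓡 2) pr x : E3 →L[ℝ] E2) w = v :=
    h.submersion x hx v
  rw [CartanLeaf.fiberForm_apply hα.smooth_form hV h hx]
  by_contra hle
  have h0 : (α 0 x : E3 →L[ℝ] ℝ) w = 0 := by
    nlinarith [mul_self_nonneg ((α 0 x : E3 →L[ℝ] ℝ) w), mul_self_nonneg ((α 1 x : E3 →L[ℝ] ℝ) w)]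
  have h1 : (α 1 x : E3 →L[ℝ] ℝ) w = 0 := by
    nlinarith [mul_self_nonneg ((α 0 x : E3 →L[ℝ] ℝ) w), mul_self_nonneg ((α 1 x : E3 →L[ℝ] ℝ) w)]
  exact hv (h.mfderiv_eq_zero hα.smooth_form hV (hα.coframe x) hx h0 h1)

lemma IsSlice.leafForm_apply [Nonempty S] (hα : IsCartanStructure α R)
    (hR : SatisfiesEDS α R) (hV : IsOpen V) (h : IsLeafSpace α V pr) (hσ : IsSlice V pr q₀ σ W)
    {q : L} (hq : extChartAt (𝓡 2) q₀ q ∈ W) (hqs : q ∈ (extChartAt (𝓡 2) q₀).source) (v w : E2) :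
    leafForm α V pr q
      ((mfderiv 𝓘(ℝ, E2) (𝓡 2) (extChartAt (𝓡 2) q₀).symm (extChartAt (𝓡 2) q₀ q) :
        E2 →L[ℝ] E2) v)
      ((mfderiv 𝓘(ℝ, E2) (𝓡 2) (extChartAt (𝓡 2) q₀).symm (extChartAt (𝓡 2) q₀ q) :
        E2 →L[ℝ] E2) w) =
      pullForm σ (α 0) (extChartAt (𝓡 2) q₀ q) v * pullForm σ (α 0) (extChartAt (𝓡 2) q₀ q) w +
        pullForm σ (α 1) (extChartAt (𝓡 2) q₀ q) v *
          pullForm σ (α 1) (extChartAt (𝓡 2) q₀ q) w := by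
  have hfin := hσ.fiberForm_apply hα.smooth_form hV h hq v w
  rwa [← h.leafForm_eq hα hR hV (hσ.mem _ hq), hσ.pr_eq _ hq,
    (extChartAt (𝓡 2) q₀).left_inv hqs] at hfin

/-- The chosen preimages need not vary continuously; by fiberwise constancy they may be replaced by
a smooth slice, where the form is visibly smooth. -/
lemma IsLeafSpace.contMDiff_leafForm [Nonempty S] (hα : IsCartanStructure α R)
    (hR : SatisfiesEDS α R) (hV : IsOpen V) (h : IsLeafSpace α V pr) :
    ContMDiff (𝓡 2) ((𝓡 2).prod 𝓘(ℝ, E2 →L[ℝ] E2 →L[ℝ] ℝ)) ∞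
      (fun q => TotalSpace.mk' (E2 →L[ℝ] E2 →L[ℝ] ℝ)
        (E := fun q : L => TangentSpace (𝓡 2) q →L[ℝ] TangentSpace (𝓡 2) q →L[ℝ] ℝ) q
        (leafForm α V pr q)) := by
  intro q₀
  obtain ⟨x, hx, rfl⟩ : q₀ ∈ pr '' V := h.surj ▸ mem_univ _
  obtain ⟨σ, W, hσ, huW, hux⟩ := exists_slice hV h hx
  set a := pullForm σ (α 0)
  set b := pullForm σ (α 1)
  have hσs := hσ.smooth.contMDiffAt (hσ.isOpen.mem_nhds huW)
  refine contMDiffAt_bilinForm (s := leafForm α V pr)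
    (H := fun u => (a u).smulRight (a u) + (b u).smulRight (b u))
    (((contDiffAt_pullForm hσs (hα.smooth_form 0)).smulRight
      (contDiffAt_pullForm hσs (hα.smooth_form 0))).add
      ((contDiffAt_pullForm hσs (hα.smooth_form 1)).smulRight
      (contDiffAt_pullForm hσs (hα.smooth_form 1)))) ?_
  filter_upwards [(continuousAt_extChartAt (I := 𝓡 2) (pr x)) (hσ.isOpen.mem_nhds huW),
    extChartAt_source_mem_nhds (I := 𝓡 2) (pr x)] with q hq hqs v w
  exact hσ.leafForm_apply hα hR hV h hq hqs v w

/-- The metric that `α` induces on the leaf space. -/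
lemma IsLeafSpace.exists_metric [Nonempty S] (hα : IsCartanStructure α R) (hR : SatisfiesEDS α R)
    (hV : IsOpen V) (h : IsLeafSpace α V pr) :
    ∃ g : RMetric L, ∀ q, g.inner q = leafForm α V pr q := by
  have hpos : ∀ (q : L) (v : E2), v ≠ 0 → 0 < leafForm α V pr q v v := by
    intro q v hv
    obtain ⟨x, hx, rfl⟩ : q ∈ pr '' V := h.surj ▸ mem_univ _
    rw [h.leafForm_eq hα hR hV hx]
    exact fiberForm_pos hα hV h hx hv
  exact ⟨⟨leafForm α V pr, fun q => fiberForm_symm _, hpos,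
    fun q => isVonNBounded_of_posDef _ (hpos q), h.contMDiff_leafForm hα hR hV⟩,
    fun q => rfl⟩

lemma IsLeafSpace.isInduced [Nonempty S] (hα : IsCartanStructure α R) (hR : SatisfiesEDS α R)
    (hV : IsOpen V) (h : IsLeafSpace α V pr) {g : RMetric L}
    (hg : ∀ q, g.inner q = leafForm α V pr q) : IsInduced α V pr g := by
  intro x hx v w
  rw [hg, h.leafForm_eq hα hR hV hx]
  exact CartanLeaf.fiberForm_apply hα.smooth_form hV h hx v w

end LeafMetric

/-! ### The system restricted to a slice -/

section Slices

variable {L : Type*} [TopologicalSpace L] [ChartedSpace E2 L] {q₀ : L}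
  {S : Type*} [TopologicalSpace S] [ChartedSpace E3 S]
  [IsManifold (𝓡 3) ∞ S] {α : Fin 3 → OneForm S} {R : S → ℝ} {V : Set S} {pr : S → L}
  {σ : E2 → S} {W : Set E2}

lemma IsSlice.cartanSystem (hα : IsCartanStructure α R) (hR : SatisfiesEDS α R)
    (hσ : IsSlice V pr q₀ σ W) :
    CartanSystem W (pullForm σ (α 0)) (pullForm σ (α 1)) (pullForm σ (α 2)) (R ∘ σ)
      (cder α 0 R ∘ σ) (cder α 1 R ∘ σ) :=
  cartanSystem_pullForm hα hR hσ.isOpen hσ.smooth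

end Slices

/-! ### Adapted charts on the leaf space -/

section Charts

variable {L : Type*} [TopologicalSpace L] [ChartedSpace E2 L] [IsManifold (𝓡 2) ∞ L] {q₀ q : L}

/-- The preferred chart at `q₀` followed by a local diffeomorphism of the plane. -/
lemma exists_chart_trans (q₀ : L) {e : OpenPartialHomeomorph E2 E2}
    (hs : e.source ⊆ (extChartAt (𝓡 2) q₀).target) (he : ContDiffOn ℝ ∞ e e.source)
    (he' : ContDiffOn ℝ ∞ e.symm e.target) :
    ∃ f : OpenPartialHomeomorph L E2, f ∈ IsManifold.maximalAtlas (𝓡 2) ∞ L ∧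
      f.target = e.target ∧ (∀ q, f q = e (extChartAt (𝓡 2) q₀ q)) ∧
      ∀ q, q ∈ f.source ↔
        q ∈ (extChartAt (𝓡 2) q₀).source ∧ extChartAt (𝓡 2) q₀ q ∈ e.source := by
  have hκ : ∀ q, extChartAt (𝓡 2) q₀ q = chartAt E2 q₀ q := fun q => by simp
  have hsrc : ∀ q, q ∈ ((chartAt E2 q₀).trans e).source ↔
      q ∈ (extChartAt (𝓡 2) q₀).source ∧ extChartAt (𝓡 2) q₀ q ∈ e.source := by
    intro q
    rw [OpenPartialHomeomorph.trans_source, hκ, extChartAt_source]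
    rfl
  have htar : ((chartAt E2 q₀).trans e).target = e.target := by
    rw [OpenPartialHomeomorph.trans_target]
    refine inter_eq_left.2 fun z hz => ?_
    have := hs (e.map_target hz)
    simpa using this
  refine ⟨(chartAt E2 q₀).trans e, ?_, htar, fun q => by rw [hκ]; rfl, hsrc⟩
  refine OpenPartialHomeomorph.mem_maximalAtlas_of_contMDiffOn _ ?_ ?_
  · intro q hq
    obtain ⟨h1, h2⟩ := (hsrc q).1 hq
    have h3 : ContMDiffAt (𝓡 2) 𝓘(ℝ, E2) ∞ (extChartAt (𝓡 2) q₀) q :=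
      contMDiffAt_extChartAt' (by simpa using h1)
    have h4 : ContMDiffAt 𝓘(ℝ, E2) 𝓘(ℝ, E2) ∞ e (extChartAt (𝓡 2) q₀ q) :=
      (he.contDiffAt (e.open_source.mem_nhds h2)).contMDiffAt
    exact (ContMDiffAt.comp q h4 h3).contMDiffWithinAt.congr (fun y _ => by
      rw [Function.comp, hκ]; rfl) (by rw [Function.comp, hκ]; rfl)
  · rw [htar]
    intro z hz
    have h3 : ContMDiffAt 𝓘(ℝ, E2) 𝓘(ℝ, E2) ∞ e.symm z :=
      (he'.contDiffAt (e.open_target.mem_nhds hz)).contMDiffAt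
    have h4 := contMDiffAt_symm_extChartAt₂ (hs (e.map_target hz))
    exact (ContMDiffAt.comp z h4 h3).contMDiffWithinAt.congr (fun y _ => by
      simp) (by simp)

lemma mfderiv_comp_extChartAt {F : Type*} [NormedAddCommGroup F] [NormedSpace ℝ F] {f : E2 → F}
    (hq : q ∈ (extChartAt (𝓡 2) q₀).source)
    (hf : DifferentiableAt ℝ f (extChartAt (𝓡 2) q₀ q)) (w : E2) :
    (mfderiv (𝓡 2) 𝓘(ℝ, F) (fun q => f (extChartAt (𝓡 2) q₀ q)) q : E2 →L[ℝ] F)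
      ((mfderiv 𝓘(ℝ, E2) (𝓡 2) (extChartAt (𝓡 2) q₀).symm (extChartAt (𝓡 2) q₀ q) :
        E2 →L[ℝ] E2) w) = fderiv ℝ f (extChartAt (𝓡 2) q₀ q) w := by
  have ht := (extChartAt (𝓡 2) q₀).map_source hq
  have hl := (extChartAt (𝓡 2) q₀).left_inv hq
  have hκ : MDifferentiableAt (𝓡 2) 𝓘(ℝ, E2) (extChartAt (𝓡 2) q₀) q :=
    mdifferentiableAt_extChartAt (by simpa using hq)
  have h1 : MDifferentiableAt (𝓡 2) 𝓘(ℝ, F) (fun q => f (extChartAt (𝓡 2) q₀ q))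
      ((extChartAt (𝓡 2) q₀).symm (extChartAt (𝓡 2) q₀ q)) := by
    rw [hl]; exact MDifferentiableAt.comp q hf.mdifferentiableAt hκ
  have h2 : MDifferentiableAt 𝓘(ℝ, E2) (𝓡 2) (extChartAt (𝓡 2) q₀).symm
      (extChartAt (𝓡 2) q₀ q) := (contMDiffAt_symm_extChartAt₂ ht).mdifferentiableAt (by simp)
  have h3 := mfderiv_comp _ h1 h2
  have h4 : (fun q => f (extChartAt (𝓡 2) q₀ q)) ∘ (extChartAt (𝓡 2) q₀).symm
      =ᶠ[𝓝 (extChartAt (𝓡 2) q₀ q)] f := by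
    filter_upwards [(isOpen_extChartAt_target q₀).mem_nhds ht] with u hu
    exact congrArg f ((extChartAt (𝓡 2) q₀).right_inv hu)
  rw [h4.mfderiv_eq, mfderiv_eq_fderiv, hl] at h3
  exact (congrArg (fun l : E2 →L[ℝ] F => l w) h3).symm

lemma exists_eq_mfderiv_symm (hq : q ∈ (extChartAt (𝓡 2) q₀).source) (v : E2) : ∃ w : E2,
    v = (mfderiv 𝓘(ℝ, E2) (𝓡 2) (extChartAt (𝓡 2) q₀).symm (extChartAt (𝓡 2) q₀ q) :
        E2 →L[ℝ] E2) w := by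
  obtain ⟨e, he⟩ := exists_equiv_mfderiv_symm₂ ((extChartAt (𝓡 2) q₀).map_source hq)
  exact ⟨e.symm v, ((congrArg (fun l : E2 →L[ℝ] E2 => l (e.symm v)) he.symm).trans
    (e.apply_symm_apply v)).symm⟩

variable {S : Type*} [TopologicalSpace S] [ChartedSpace E3 S]
  [IsManifold (𝓡 3) ∞ S] {α : Fin 3 → OneForm S} {R : S → ℝ} {V : Set S} {pr : S → L} {x : S}
  {σ : E2 → S} {W : Set E2}

variable [T2Space S]

lemma IsSlice.R_eq (hα : IsCartanStructure α R) (hR : SatisfiesEDS α R)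
    (hV : IsOpen V) (h : IsLeafSpace α V pr) (hσ : IsSlice V pr q₀ σ W) {y : S} (hy : y ∈ V)
    (hq : extChartAt (𝓡 2) q₀ (pr y) ∈ W) (hqs : pr y ∈ (extChartAt (𝓡 2) q₀).source) :
    R y = R (σ (extChartAt (𝓡 2) q₀ (pr y))) :=
  h.R_eq hα hR hV hy (hσ.mem _ hq) (by
    rw [hσ.pr_eq _ hq, (extChartAt (𝓡 2) q₀).left_inv hqs])

variable [Nonempty S] {R₀ : ℝ} {g : RMetric L}

/-- The normal form is found on a slice through x and carried to the leaf space by the preferred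
chart; the formula for R then holds at all points over the chart since R is constant on fibers. -/
lemma IsLeafSpace.exists_polarChart (hα : IsCartanStructure α R) (hR : SatisfiesEDS α R)
    (hR₀ : 1 < R₀)
    (hc : ∀ x, firstIntegral α R x = (R₀ - 3 / 2) * Real.exp (2 * (R₀ - 1))) (hV : IsOpen V)
    (h : IsLeafSpace α V pr) (hg : ∀ q, g.inner q = leafForm α V pr q) (hx : x ∈ V)
    (hpq : cder α 0 R x ≠ 0 ∨ cder α 1 R x ≠ 0) :
    ∃ e : OpenPartialHomeomorph L E2, pr x ∈ e.source ∧ IsPolarChart R₀ g e ∧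
      ∀ y ∈ V, pr y ∈ e.source → R y = R₀ - (e (pr y) 0) ^ 2 / 4 := by
  obtain ⟨σ, W, hσ, huW, hux⟩ := exists_slice hV h hx
  obtain ⟨e, he0, heW, hes, hes', hbox, hmet⟩ := (hσ.cartanSystem hα hR).exists_polar hσ.isOpen
    hR₀ (fun u _ => hc (σ u)) (fun u hu v => hσ.eq_zero hα.smooth_form hα.coframe hV h hu) huW
    (by rw [Function.comp, Function.comp, hux]; exact hpq)
  obtain ⟨f, hfat, hft, hfe, hfs⟩ := exists_chart_trans (pr x) (heW.trans hσ.subset) hes hes'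
  refine ⟨f, (hfs _).2 ⟨mem_extChartAt_source _, he0⟩, ⟨hfat, hft ▸ hbox, ?_⟩, ?_⟩
  · intro q hq v w
    obtain ⟨hq1, hq2⟩ := (hfs q).1 hq
    obtain ⟨v, rfl⟩ := exists_eq_mfderiv_symm hq1 v
    obtain ⟨w, rfl⟩ := exists_eq_mfderiv_symm hq1 w
    have hd : ∀ (i : Fin 2) (v : E2), dCoord f i q
        ((mfderiv 𝓘(ℝ, E2) (𝓡 2) (extChartAt (𝓡 2) (pr x)).symm (extChartAt (𝓡 2) (pr x) q) :
        E2 →L[ℝ] E2) v) = fderiv ℝ (fun u => e u i) (extChartAt (𝓡 2) (pr x) q) v := by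
      intro i v
      have h1 : DifferentiableAt ℝ (fun u => e u i) (extChartAt (𝓡 2) (pr x) q) :=
        (EuclideanSpace.proj (𝕜 := ℝ) i).differentiableAt.comp _
          ((hes.contDiffAt (e.open_source.mem_nhds hq2)).differentiableAt (by simp))
      have h2 := mfderiv_comp_extChartAt hq1 h1 v
      have h3 : (fun q' => f q' i) = fun q' => e (extChartAt (𝓡 2) (pr x) q') i :=
        funext fun q' => by rw [hfe]
      rw [← h3] at h2
      exact h2
    rw [hd, hd, hd, hd, hg, hfe, ← (hmet _ hq2).2]
    exact hσ.leafForm_apply hα hR hV h (heW hq2) hq1 v w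
  · intro y hy hys
    obtain ⟨hq1, hq2⟩ := (hfs _).1 hys
    rw [hσ.R_eq hα hR hV h hy (heW hq2) hq1, hfe]
    exact (hmet _ hq2).1

lemma IsLeafSpace.exists_poleChart (hα : IsCartanStructure α R) (hR : SatisfiesEDS α R)
    (hR₀ : 1 < R₀)
    (hc : ∀ x, firstIntegral α R x = (R₀ - 3 / 2) * Real.exp (2 * (R₀ - 1))) (hV : IsOpen V)
    (h : IsLeafSpace α V pr) (hg : ∀ q, g.inner q = leafForm α V pr q) (hx : x ∈ V)
    (hRx : R x = R₀) :
    ∃ e : OpenPartialHomeomorph L E2, pr x ∈ e.source ∧ IsPoleChart R₀ g (pr x) e ∧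
      ∀ y ∈ V, pr y ∈ e.source → R y = R₀ - ‖e (pr y)‖ ^ 2 / 4 := by
  obtain ⟨σ, W, hσ, huW, hux⟩ := exists_slice hV h hx
  obtain ⟨e, he0, heW, hes, hes', hz, hball, hmet⟩ := (hσ.cartanSystem hα hR).exists_pole hσ.isOpen
    hR₀ (fun u _ => hc (σ u)) (fun u hu v => hσ.eq_zero hα.smooth_form hα.coframe hV h hu) huW
    (by rw [Function.comp, hux]; exact hRx)
  obtain ⟨f, hfat, hft, hfe, hfs⟩ := exists_chart_trans (pr x) (heW.trans hσ.subset) hes hes'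
  refine ⟨f, (hfs _).2 ⟨mem_extChartAt_source _, he0⟩,
    ⟨hfat, by rw [hfe, hz], hft ▸ hball, ?_⟩, ?_⟩
  · intro q hq hqx v w
    obtain ⟨hq1, hq2⟩ := (hfs q).1 hq
    obtain ⟨v, rfl⟩ := exists_eq_mfderiv_symm hq1 v
    obtain ⟨w, rfl⟩ := exists_eq_mfderiv_symm hq1 w
    have hne : extChartAt (𝓡 2) (pr x) q ≠ extChartAt (𝓡 2) (pr x) (pr x) := fun heq =>
      hqx ((extChartAt (𝓡 2) (pr x)).injOn hq1 (mem_extChartAt_source _) heq)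
    have hd : ∀ v : E2, mfderiv (𝓡 2) 𝓘(ℝ, E2) f q
        ((mfderiv 𝓘(ℝ, E2) (𝓡 2) (extChartAt (𝓡 2) (pr x)).symm (extChartAt (𝓡 2) (pr x) q) :
        E2 →L[ℝ] E2) v) = fderiv ℝ e (extChartAt (𝓡 2) (pr x) q) v := by
      intro v
      have h1 : DifferentiableAt ℝ e (extChartAt (𝓡 2) (pr x) q) :=
        (hes.contDiffAt (e.open_source.mem_nhds hq2)).differentiableAt (by simp)
      have h2 := mfderiv_comp_extChartAt hq1 h1 v
      rw [← h2, show (f : L → E2) = fun q => e (extChartAt (𝓡 2) (pr x) q) from funext hfe]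
    rw [hd, hd, hg, hfe, ← (hmet _ hq2).2 hne]
    exact hσ.leafForm_apply hα hR hV h (heW hq2) hq1 v w
  · intro y hy hys
    obtain ⟨hq1, hq2⟩ := (hfs _).1 hys
    rw [hσ.R_eq hα hR hV h hy (heW hq2) hq1, hfe]
    exact (hmet _ hq2).1

end Charts

/-! ### Smooth extension of the metric across the origin -/

section Rotational

variable {R₀ : ℝ} {z : E2}

lemma mem_region (hR₀ : 1 < R₀) : z ∈ region R₀ ↔ 0 < profile R₀ (‖z‖ ^ 2 / 4) := by
  rcases eq_or_ne z 0 with rfl | hz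
  · simp [region, profile_zero, hR₀]
  · rw [← Phi_pos_iff R₀ (norm_ne_zero_iff.2 hz)]
    simp [region, hz]

/-- The function `K` with `t K(t) = 4 (R₀ - 1)² e^{-2t} - M(t)²`. -/
def radialSlope (R₀ : ℝ) : ℝ → ℝ :=
  dslope (fun t => 4 * (R₀ - 1) ^ 2 * Real.exp (-2 * t) - profile R₀ t ^ 2) 0

lemma contDiff_radialSlope (R₀ : ℝ) : ContDiff ℝ ω (radialSlope R₀) := by
  refine contDiff_dslope ?_ _
  exact (contDiff_const.mul (Real.contDiff_exp.comp (contDiff_const.mul contDiff_id))).sub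
    ((contDiff_profile R₀).pow 2)

/-- The right side vanishes at t = 0 because M(0) = 2 (R₀ - 1). This is the absence of a cone angle,
and the reason for the normalization of φ. -/
lemma mul_radialSlope (R₀ t : ℝ) :
    t * radialSlope R₀ t = 4 * (R₀ - 1) ^ 2 * Real.exp (-2 * t) - profile R₀ t ^ 2 := by
  rw [radialSlope, mul_dslope_zero]
  simp [profile_zero]
  ring

/-- The inner product of the plane, as a bilinear form. -/
def innerForm : E2 →L[ℝ] E2 →L[ℝ] ℝ :=
  (isBoundedBilinearMap_inner (𝕜 := ℝ) (E := E2)).toContinuousLinearMap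

/-- The smooth extension of the metric `η(r)² dr² + φ(r)² dθ²` across the origin. -/
def rotMetric (R₀ : ℝ) (z : E2) : E2 →L[ℝ] E2 →L[ℝ] ℝ :=
  (profile R₀ (‖z‖ ^ 2 / 4) / (4 * (R₀ - 1) ^ 2)) • innerForm +
    (radialSlope R₀ (‖z‖ ^ 2 / 4) / (16 * (R₀ - 1) ^ 2 * profile R₀ (‖z‖ ^ 2 / 4))) •
      (innerForm z).smulRight (innerForm z)

lemma rotMetric_apply (v w : E2) : rotMetric R₀ z v w =
    profile R₀ (‖z‖ ^ 2 / 4) / (4 * (R₀ - 1) ^ 2) * inner ℝ v w +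
    radialSlope R₀ (‖z‖ ^ 2 / 4) / (16 * (R₀ - 1) ^ 2 * profile R₀ (‖z‖ ^ 2 / 4)) *
      (inner ℝ z v * inner ℝ z w) := rfl

/-- Substituting r² dθ² = |·|² - dr² turns the metric into (φ²/r²) |·|² + (η² - φ²/r²) dr², with
φ²/r² = M / (4 (R₀ - 1)²) and η² = e^{-2t} / M. -/
lemma rotMetric_eq_polarMetric (hR₀ : 1 < R₀) (hz : z ∈ region R₀) (hz0 : z ≠ 0) (v w : E2) :
    rotMetric R₀ z v w = polarMetric R₀ z v w := by
  have hM := (mem_region hR₀).1 hz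
  have hr : 0 < ‖z‖ := norm_pos_iff.2 hz0
  set t := ‖z‖ ^ 2 / 4 with ht
  have ht0 : 0 < t := by positivity
  have hPhi : Phi R₀ ‖z‖ ^ 2 = t * profile R₀ t := by
    rw [Phi_eq, Real.sq_sqrt (by positivity)]
  have hexp : Real.exp (-(‖z‖ ^ 2 / 4)) ^ 2 = Real.exp (-2 * t) := by
    rw [← Real.exp_nat_mul, ← ht]; push_cast; ring_nf
  have hr2 : ‖z‖ ^ 2 = 4 * t := by rw [ht]; ring
  have hn : ‖z‖ ^ 2 = z 0 ^ 2 + z 1 ^ 2 := by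
    rw [EuclideanSpace.real_norm_sq_eq]; simp
  have heta : eta R₀ ‖z‖ ^ 2 = Real.exp (-2 * t) / profile R₀ t := by
    rw [eta, div_pow, mul_pow, mul_pow, hPhi, hexp, hr2]
    field_simp
    norm_num
  have hphi : phi R₀ ‖z‖ ^ 2 = t * profile R₀ t / (R₀ - 1) ^ 2 := by
    rw [phi, div_pow, hPhi]
  have hK : radialSlope R₀ t =
      (4 * (R₀ - 1) ^ 2 * Real.exp (-2 * t) - profile R₀ t ^ 2) / t := by
    rw [← mul_radialSlope]; field_simp
  have hc : R₀ - 1 ≠ 0 := by linarith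
  have hin : ∀ v w : E2, inner ℝ v w = v 0 * w 0 + v 1 * w 1 := by
    intro v w; simp [PiLp.inner_apply, mul_comm]
  have hrad : dRad z v * dRad z w =
      (z 0 * v 0 + z 1 * v 1) * (z 0 * w 0 + z 1 * w 1) / (4 * t) := by
    rw [dRad, dRad, ← hr2]; field_simp
  have hang : dAng z v * dAng z w =
      (4 * t * (v 0 * w 0 + v 1 * w 1) -
        (z 0 * v 0 + z 1 * v 1) * (z 0 * w 0 + z 1 * w 1)) / (4 * t) ^ 2 := by
    rw [dAng, dAng, hr2, ← hr2, hn]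
    have : z 0 ^ 2 + z 1 ^ 2 ≠ 0 := by rw [← hn]; positivity
    field_simp
    ring
  rw [rotMetric_apply, polarMetric, heta, hphi, hrad, hang, ← ht, hK, hin, hin, hin]
  field_simp
  ring

/-- The tangential eigenvalue is A and the radial one is A + ‖z‖² B = e^{-2t} / M; both are positive
where M is. -/
lemma rotMetric_pos (hR₀ : 1 < R₀) (hz : z ∈ region R₀) {v : E2} (hv : v ≠ 0) :
    0 < rotMetric R₀ z v v := by
  have hM := (mem_region hR₀).1 hz
  rw [rotMetric_apply, real_inner_self_eq_norm_sq]
  set t := ‖z‖ ^ 2 / 4 with ht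
  set A := profile R₀ t / (4 * (R₀ - 1) ^ 2) with hA
  set B := radialSlope R₀ t / (16 * (R₀ - 1) ^ 2 * profile R₀ t) with hB
  have hc : 0 < R₀ - 1 := by linarith
  have hA0 : 0 < A := by positivity
  have hAB : A + ‖z‖ ^ 2 * B = Real.exp (-2 * t) / profile R₀ t := by
    have h1 := mul_radialSlope R₀ t
    have h2 : ‖z‖ ^ 2 = 4 * t := by rw [ht]; ring
    rw [hA, hB, h2]
    have h3 : radialSlope R₀ t * t = 4 * (R₀ - 1) ^ 2 * Real.exp (-2 * t) - profile R₀ t ^ 2 := by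
      rw [← h1, mul_comm]
    have h4 : profile R₀ t / (4 * (R₀ - 1) ^ 2) +
        4 * t * (radialSlope R₀ t / (16 * (R₀ - 1) ^ 2 * profile R₀ t)) =
        (profile R₀ t ^ 2 + radialSlope R₀ t * t) / (4 * (R₀ - 1) ^ 2 * profile R₀ t) := by
      field_simp
      ring
    rw [h4, h3]
    field_simp
    ring
  have hAB0 : 0 < A + ‖z‖ ^ 2 * B := by rw [hAB]; positivity
  have hcs : inner ℝ z v * inner ℝ z v ≤ ‖z‖ ^ 2 * ‖v‖ ^ 2 := by
    have := real_inner_mul_inner_self_le z v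
    rwa [real_inner_self_eq_norm_sq, real_inner_self_eq_norm_sq] at this
  have hv0 : 0 < ‖v‖ ^ 2 := by positivity
  have hsq := mul_self_nonneg (inner ℝ z v : ℝ)
  -- For B ≥ 0 the second term may be dropped; for B < 0 Cauchy–Schwarz bounds the form below by the
  -- radial eigenvalue.
  rcases le_or_gt 0 B with hB0 | hB0
  · have h1 := mul_nonneg hB0 hsq
    have h2 := mul_pos hA0 hv0
    linarith
  · have h1 := mul_le_mul_of_nonpos_left hcs hB0.le
    have h2 := mul_pos hAB0 hv0
    linarith

lemma isSmoothRotational (hR₀ : 1 < R₀) : IsSmoothRotational R₀ := by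
  have hsq : ContDiff ℝ ∞ fun z : E2 => ‖z‖ ^ 2 / 4 := (contDiff_norm_sq ℝ).div_const 4
  have hM : ContDiff ℝ ∞ fun z : E2 => profile R₀ (‖z‖ ^ 2 / 4) :=
    ((contDiff_profile R₀).of_le le_top).comp hsq
  have hK : ContDiff ℝ ∞ fun z : E2 => radialSlope R₀ (‖z‖ ^ 2 / 4) :=
    ((contDiff_radialSlope R₀).of_le le_top).comp hsq
  have hreg : region R₀ = {z | 0 < profile R₀ (‖z‖ ^ 2 / 4)} := ext fun _ => mem_region hR₀
  have hc : R₀ - 1 ≠ 0 := by linarith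
  have hopen : IsOpen (region R₀) := hreg ▸ isOpen_lt continuous_const hM.continuous
  refine ⟨hopen, rotMetric R₀, ?_, fun z _ v w => ?_,
    fun z hz v hv => rotMetric_pos hR₀ hz hv, fun z _ A v w => ?_,
    fun z hz hz0 v w => rotMetric_eq_polarMetric hR₀ hz hz0 v w⟩
  · have hB : ContDiffOn ℝ ∞ (fun z : E2 => radialSlope R₀ (‖z‖ ^ 2 / 4) /
        (16 * (R₀ - 1) ^ 2 * profile R₀ (‖z‖ ^ 2 / 4))) (region R₀) := by
      refine hK.contDiffOn.div (contDiff_const.mul hM).contDiffOn fun z hz => ?_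
      have := (mem_region hR₀).1 hz
      positivity
    intro z hz
    have hMz := (hM.div_const (4 * (R₀ - 1) ^ 2)).contDiffAt (x := z)
    have hBz := hB.contDiffAt (hopen.mem_nhds hz)
    refine (contDiffAt_clm_of_apply fun v => contDiffAt_clm_of_apply fun w => ?_).contDiffWithinAt
    simp only [rotMetric_apply]
    exact (hMz.mul contDiffAt_const).add (hBz.mul
      ((contDiffAt_id.inner ℝ contDiffAt_const).mul (contDiffAt_id.inner ℝ contDiffAt_const)))
  · rw [rotMetric_apply, rotMetric_apply, real_inner_comm, mul_comm (inner ℝ z v)]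
  · simp only [rotMetric_apply, LinearIsometryEquiv.norm_map, LinearIsometryEquiv.inner_map_map]

end Rotational

/-! ### Cartan structures on Euclidean space in flat terms -/

section EuclideanForms

lemma smoothForm_of_contDiff {a : E3 → E3 →L[ℝ] ℝ} (ha : ContDiff ℝ ∞ a) :
    SmoothForm (S := E3) a := by
  intro x
  rw [contMDiffAt_hom_bundle]
  refine ⟨contMDiffAt_id, ?_⟩
  refine ha.contDiffAt.contMDiffAt.congr_of_eventuallyEq (Filter.Eventually.of_forall fun y => ?_)
  ext v
  simp [ContinuousLinearMap.inCoordinates]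
  rfl

lemma pullForm_id (a : OneForm E3) : pullForm id a = a := by
  funext z
  ext v
  rw [pullForm_apply, mfderiv_id]
  rfl

/-- Pulling back along the identity converts `dForm` into `curl`. -/
lemma isCartanStructure_of_curl {α : Fin 3 → E3 → E3 →L[ℝ] ℝ} {R : E3 → ℝ}
    (hα : ∀ i, ContDiff ℝ ∞ (α i)) (hR : ContDiff ℝ ∞ R)
    (hli : ∀ z, LinearIndependent ℝ fun i => α i z)
    (h0 : ∀ z v w, curl (α 0) z v w = α 1 z v * α 2 z w - α 1 z w * α 2 z v)
    (h1 : ∀ z v w, curl (α 1) z v w = -(α 0 z v * α 2 z w - α 0 z w * α 2 z v))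
    (h2 : ∀ z v w, curl (α 2) z v w = R z * (α 0 z v * α 1 z w - α 0 z w * α 1 z v)) :
    IsCartanStructure (S := E3) α R := by
  have hs : ∀ i, SmoothForm (S := E3) (α i) := fun i => smoothForm_of_contDiff (hα i)
  have hd : ∀ i, ∀ z v w : E3, dForm (S := E3) (α i) z v w = curl (α i) z v w := by
    intro i z v w
    have h := curl_pullForm (contMDiffAt_id (x := z) (I := 𝓡 3)) (hs i) v w
    rw [mfderiv_id] at h
    exact h.symm.trans (congrArg (fun a : E3 → E3 →L[ℝ] ℝ => curl a z v w) (pullForm_id (α i)))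
  exact ⟨hs, hR.contMDiff, hli, fun z v w => (hd 0 z v w).trans (h0 z v w),
    fun z v w => (hd 1 z v w).trans (h1 z v w), fun z v w => (hd 2 z v w).trans (h2 z v w)⟩

lemma cder_eq_of_hasFDerivAt {α : Fin 3 → E3 → E3 →L[ℝ] ℝ} {z : E3}
    (hli : LinearIndependent ℝ fun i => α i z) {f : E3 → ℝ} {f' : E3 →L[ℝ] ℝ}
    (hf : HasFDerivAt f f' z) {c : Fin 3 → ℝ} (hc : ∀ v, f' v = ∑ i, c i * α i z v) (i : Fin 3) :
    cder (S := E3) α i f z = c i :=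
  cder_eq_of_mfderiv_eq hli (fun v => by rw [mfderiv_eq_fderiv, hf.fderiv]; exact hc v) i

end EuclideanForms

/-! ### A model structure for each R₀ -/

section Model

/-- The `i`-th coordinate of space. -/
abbrev coord (i : Fin 3) : E3 →L[ℝ] ℝ := EuclideanSpace.proj i

variable {ρ s k : ℝ → ℝ}

/-- The coframe built from functions `ρ`, `s`, `k` of one variable, where `k = ρ'` and `s` is the
length of the gradient of `ρ`. -/
def modelForm (ρ s k : ℝ → ℝ) : Fin 3 → E3 → E3 →L[ℝ] ℝ :=
  ![fun z => (Real.cos (z 2) * (k (z 0) / s (z 0))) • coord 0 -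
      (Real.sin (z 2) * (s (z 0) * Real.exp (ρ (z 0)))) • coord 1,
    fun z => (Real.sin (z 2) * (k (z 0) / s (z 0))) • coord 0 +
      (Real.cos (z 2) * (s (z 0) * Real.exp (ρ (z 0)))) • coord 1,
    fun z => coord 2 - ((1 - ρ (z 0)) * Real.exp (ρ (z 0))) • coord 1]

lemma modelForm_zero (z v : E3) : modelForm ρ s k 0 z v =
    Real.cos (z 2) * (k (z 0) / s (z 0)) * v 0 -
      Real.sin (z 2) * (s (z 0) * Real.exp (ρ (z 0))) * v 1 := rfl

lemma modelForm_one (z v : E3) : modelForm ρ s k 1 z v =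
    Real.sin (z 2) * (k (z 0) / s (z 0)) * v 0 +
      Real.cos (z 2) * (s (z 0) * Real.exp (ρ (z 0))) * v 1 := rfl

lemma modelForm_two (z v : E3) : modelForm ρ s k 2 z v =
    v 2 - (1 - ρ (z 0)) * Real.exp (ρ (z 0)) * v 1 := rfl

lemma hasFDerivAt_coord (i : Fin 3) (z : E3) : HasFDerivAt (fun z : E3 => z i) (coord i) z :=
  (coord i).hasFDerivAt

/-- The exterior derivative of a combination of the coordinate differentials. -/
lemma curl_smul_coord {f : E3 → ℝ} {f' : E3 →L[ℝ] ℝ} {z : E3} (hf : HasFDerivAt f f' z)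
    (i : Fin 3) (v w : E3) :
    curl (fun z => f z • coord i) z v w = f' v * w i - f' w * v i := by
  rw [curl_smul hf.differentiableAt (differentiableAt_const _), hf.fderiv]
  simp [curl]

variable (hρ : ContDiff ℝ ∞ ρ) (hs : ContDiff ℝ ∞ s) (hk : ContDiff ℝ ∞ k)
  (hs0 : ∀ x, 0 < s x) (hk0 : ∀ x, k x ≠ 0) (hρk : ∀ x, HasDerivAt ρ (k x) x)
  (hsk : ∀ x, HasDerivAt s ((1 - ρ x - s x ^ 2) * k x / s x) x)

include hρ hs hk hs0 in
lemma contDiff_modelForm (i : Fin 3) : ContDiff ℝ ∞ (modelForm ρ s k i) := by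
  have h0 : ContDiff ℝ ∞ fun z : E3 => z 0 := (coord 0).contDiff
  have h2 : ContDiff ℝ ∞ fun z : E3 => z 2 := (coord 2).contDiff
  have hρ' := hρ.comp h0
  have he : ContDiff ℝ ∞ fun z : E3 => Real.exp (ρ (z 0)) := hρ'.exp
  have hss := (hs.comp h0).mul he
  have hks := (hk.comp h0).div (hs.comp h0) fun z => (hs0 (z 0)).ne'
  have hcos : ContDiff ℝ ∞ fun z : E3 => Real.cos (z 2) := h2.cos
  have hsin : ContDiff ℝ ∞ fun z : E3 => Real.sin (z 2) := h2.sin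
  fin_cases i
  · exact (((hcos.mul hks).smul contDiff_const).sub
      ((hsin.mul hss).smul contDiff_const))
  · exact (((hsin.mul hks).smul contDiff_const).add
      ((hcos.mul hss).smul contDiff_const))
  · exact (contDiff_const.sub
      (((contDiff_const.sub hρ').mul he).smul contDiff_const))

include hs0 hk0 in
lemma linearIndependent_modelForm (z : E3) :
    LinearIndependent ℝ (fun i => modelForm ρ s k i z) := by
  rw [Fintype.linearIndependent_iff]
  intro g hg
  have key : ∀ v : E3, g 0 * modelForm ρ s k 0 z v + g 1 * modelForm ρ s k 1 z v +
      g 2 * modelForm ρ s k 2 z v = 0 := by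
    intro v
    have := congrArg (fun l : E3 →L[ℝ] ℝ => l v) hg
    rw [Fin.sum_univ_three] at this
    exact this
  have h1 := key (EuclideanSpace.single 0 1)
  have h2 := key (EuclideanSpace.single 1 1)
  have h3 := key (EuclideanSpace.single 2 1)
  simp only [modelForm_zero, modelForm_one, modelForm_two] at h1 h2 h3
  simp at h1 h2 h3
  have hs1 := (hs0 (z 0)).ne'
  have hk1 := hk0 (z 0)
  have he := Real.exp_ne_zero (ρ (z 0))
  have hsc := Real.sin_sq_add_cos_sq (z 2)
  rw [h3] at h2
  have e1 : g 0 * Real.cos (z 2) + g 1 * Real.sin (z 2) = 0 := by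
    have : (g 0 * Real.cos (z 2) + g 1 * Real.sin (z 2)) * (k (z 0) / s (z 0)) = 0 := by
      linear_combination h1
    exact (mul_eq_zero.1 this).resolve_right (div_ne_zero hk1 hs1)
  have e2 : -(g 0 * Real.sin (z 2)) + g 1 * Real.cos (z 2) = 0 := by
    have : (-(g 0 * Real.sin (z 2)) + g 1 * Real.cos (z 2)) *
        (s (z 0) * Real.exp (ρ (z 0))) = 0 := by
      linear_combination h2
    exact (mul_eq_zero.1 this).resolve_right (mul_ne_zero hs1 he)
  intro i
  fin_cases i
  · change g 0 = 0
    linear_combination Real.cos (z 2) * e1 - Real.sin (z 2) * e2 - g 0 * hsc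
  · change g 1 = 0
    linear_combination Real.sin (z 2) * e1 + Real.cos (z 2) * e2 - g 1 * hsc
  · exact h3

include hρ hs hk hs0 hk0 hρk hsk in
-- At angle zero the first two forms are dR/|∇R| and |∇R| e^R dy, the normal form with dy = e^{-R} B
-- / |∇R|². The third coordinate rotates this orthonormal coframe, and the third form is its
-- connection form, with curvature ρ.
lemma isCartanStructure_modelForm :
    IsCartanStructure (S := E3) (modelForm ρ s k) fun z => ρ (z 0) := by
  have h0 : ∀ z : E3, HasFDerivAt (fun z : E3 => z 0) (coord 0) z := hasFDerivAt_coord 0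
  have h2 : ∀ z : E3, HasFDerivAt (fun z : E3 => z 2) (coord 2) z := hasFDerivAt_coord 2
  have hcos : ∀ z : E3, HasFDerivAt (fun z : E3 => Real.cos (z 2)) _ z := fun z => (h2 z).cos
  have hsin : ∀ z : E3, HasFDerivAt (fun z : E3 => Real.sin (z 2)) _ z := fun z => (h2 z).sin
  have hks : ∀ z : E3, HasFDerivAt (fun z : E3 => k (z 0) / s (z 0))
      (deriv (fun x => k x / s x) (z 0) • coord 0) z := fun z =>
    HasDerivAt.comp_hasFDerivAt (h₂ := fun x => k x / s x) z
      (((hk.div hs fun x => (hs0 x).ne').differentiable (by simp) (z 0)).hasDerivAt) (h0 z)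
  have hse : ∀ z : E3, HasFDerivAt (fun z : E3 => s (z 0) * Real.exp (ρ (z 0)))
      (((1 - ρ (z 0)) * k (z 0) / s (z 0) * Real.exp (ρ (z 0))) • coord 0) z := by
    intro z
    have h := (hsk (z 0)).mul (hρk (z 0)).exp
    -- The factor e^ρ removes the s² term, leaving k/s times the coefficient (1 - ρ) e^ρ of the
    -- connection form.
    have h' : (1 - ρ (z 0) - s (z 0) ^ 2) * k (z 0) / s (z 0) * Real.exp (ρ (z 0)) +
        s (z 0) * (Real.exp (ρ (z 0)) * k (z 0)) =
        (1 - ρ (z 0)) * k (z 0) / s (z 0) * Real.exp (ρ (z 0)) := by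
      have := (hs0 (z 0)).ne'
      field_simp
      ring
    rw [h'] at h
    exact h.comp_hasFDerivAt z (h0 z)
  have hre : ∀ z : E3, HasFDerivAt (fun z : E3 => (1 - ρ (z 0)) * Real.exp (ρ (z 0)))
      ((-(ρ (z 0) * k (z 0) * Real.exp (ρ (z 0)))) • coord 0) z := by
    intro z
    have h := ((hρk (z 0)).const_sub 1).mul (hρk (z 0)).exp
    have h' : -k (z 0) * Real.exp (ρ (z 0)) + (1 - ρ (z 0)) * (Real.exp (ρ (z 0)) * k (z 0)) =
        -(ρ (z 0) * k (z 0) * Real.exp (ρ (z 0))) := by ring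
    rw [h'] at h
    exact h.comp_hasFDerivAt z (h0 z)
  have hd : ∀ {f : E3 → ℝ} {f' : E3 →L[ℝ] ℝ} {z : E3} (i : Fin 3), HasFDerivAt f f' z →
      DifferentiableAt ℝ (fun z => f z • coord i) z := fun i hf =>
    hf.differentiableAt.smul (differentiableAt_const _)
  refine isCartanStructure_of_curl (contDiff_modelForm hρ hs hk hs0) (hρ.comp (coord 0).contDiff)
    (linearIndependent_modelForm hs0 hk0) (fun z v w => ?_) (fun z v w => ?_) fun z v w => ?_
  all_goals
    have hs1 := (hs0 (z 0)).ne'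
    have hsc := Real.sin_sq_add_cos_sq (z 2)
  · rw [modelForm_one, modelForm_one, modelForm_two, modelForm_two]
    refine (curl_sub (hd 0 ((hcos z).mul (hks z))) (hd 1 ((hsin z).mul (hse z))) v w).trans ?_
    rw [curl_smul_coord ((hcos z).mul (hks z)), curl_smul_coord ((hsin z).mul (hse z))]
    simp
    field_simp
    ring
  · rw [modelForm_zero, modelForm_zero, modelForm_two, modelForm_two]
    refine (curl_add (hd 0 ((hsin z).mul (hks z))) (hd 1 ((hcos z).mul (hse z))) v w).trans ?_
    rw [curl_smul_coord ((hsin z).mul (hks z)), curl_smul_coord ((hcos z).mul (hse z))]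
    simp
    field_simp
    ring
  · rw [modelForm_zero, modelForm_zero, modelForm_one, modelForm_one]
    refine (curl_sub (differentiableAt_const _) (hd 1 (hre z)) v w).trans ?_
    rw [curl_smul_coord (hre z)]
    simp [curl]
    field_simp
    linear_combination (-(ρ (z 0) * k (z 0) * Real.exp (ρ (z 0)) * s (z 0) ^ 2)) * ((v 0 * w 1 - w 0 * v 1)) * hsc

include hs0 hk0 hρk hsk in
-- The gradient of ρ has length s and makes the angle `z 2` with the frame; the derivative rule for
-- s then reproduces the system.
lemma cder_modelForm (z : E3) (i : Fin 3) :
    cder (S := E3) (modelForm ρ s k) i (fun z => ρ (z 0)) z =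
      ![s (z 0) * Real.cos (z 2), s (z 0) * Real.sin (z 2), 0] i ∧
    cder (S := E3) (modelForm ρ s k) i (fun z => s (z 0) * Real.cos (z 2)) z =
      ![1 - ρ (z 0) - (s (z 0) * Real.cos (z 2)) ^ 2,
        -(s (z 0) * Real.cos (z 2) * (s (z 0) * Real.sin (z 2))), -(s (z 0) * Real.sin (z 2))] i ∧
    cder (S := E3) (modelForm ρ s k) i (fun z => s (z 0) * Real.sin (z 2)) z =
      ![-(s (z 0) * Real.cos (z 2) * (s (z 0) * Real.sin (z 2))),
        1 - ρ (z 0) - (s (z 0) * Real.sin (z 2)) ^ 2, s (z 0) * Real.cos (z 2)] i := by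
  have h0 := hasFDerivAt_coord 0 z
  have h2 := hasFDerivAt_coord 2 z
  have hs1 := (hs0 (z 0)).ne'
  have hsc := Real.sin_sq_add_cos_sq (z 2)
  have hli := linearIndependent_modelForm hs0 hk0 (ρ := ρ) z
  have hρ' : HasFDerivAt (fun z : E3 => ρ (z 0)) _ z := (hρk (z 0)).comp_hasFDerivAt z h0
  have hs' : HasFDerivAt (fun z : E3 => s (z 0)) _ z := (hsk (z 0)).comp_hasFDerivAt z h0
  refine ⟨cder_eq_of_hasFDerivAt hli hρ' (fun v => ?_) i,
    cder_eq_of_hasFDerivAt hli (hs'.mul h2.cos) (fun v => ?_) i,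
    cder_eq_of_hasFDerivAt hli (hs'.mul h2.sin) (fun v => ?_) i⟩
  all_goals
    rw [Fin.sum_univ_three, modelForm_zero, modelForm_one, modelForm_two]
    simp
    field_simp
  · linear_combination (-(k (z 0) * v 0)) * hsc
  · linear_combination (s (z 0) ^ 2 * Real.cos (z 2) * k (z 0) * v 0) * hsc
  · linear_combination (s (z 0) ^ 2 * Real.sin (z 2) * k (z 0) * v 0) * hsc

end Model

/-- Every value `R₀ > 1` of the constant occurs for a Cartan structure on space. -/
lemma exists_cartanStructure {R₀ : ℝ} (hR₀ : 1 < R₀) :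
    ∃ (α : Fin 3 → OneForm E3) (R : E3 → ℝ), IsCartanStructure α R ∧ SatisfiesEDS α R ∧
      ∀ x, firstIntegral α R x = (R₀ - 3 / 2) * Real.exp (2 * (R₀ - 1)) := by
  -- A sigmoid keeps ρ strictly between 1 and R₀, where `potential ρ < potential R₀`, with nowhere
  -- vanishing derivative k.
  set ρ : ℝ → ℝ := fun x => 1 + (R₀ - 1) * Real.sigmoid x with hρdef
  set k : ℝ → ℝ := fun x => (R₀ - 1) * (Real.sigmoid x * (1 - Real.sigmoid x)) with hkdef
  -- The squared gradient dictated by the first integral with constant R₀; it is positive by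
  -- monotonicity of `potential`.
  set A : ℝ → ℝ := fun x => (R₀ - 3 / 2) * Real.exp (2 * (R₀ - 1)) * Real.exp (-(2 * (ρ x - 1))) -
    ρ x + 3 / 2 with hA
  set s : ℝ → ℝ := fun x => Real.sqrt (A x) with hs
  have hR₁ : 0 < R₀ - 1 := sub_pos.2 hR₀
  have hsig : ContDiff ℝ ∞ Real.sigmoid := contDiff_sigmoid.of_le le_top
  have hρ : ContDiff ℝ ∞ ρ := contDiff_const.add (contDiff_const.mul hsig)
  have hk : ContDiff ℝ ∞ k := contDiff_const.mul (hsig.mul (contDiff_const.sub hsig))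
  have hAc : ContDiff ℝ ∞ A := ((contDiff_const.mul
    (contDiff_const.mul (hρ.sub contDiff_const)).neg.exp).sub hρ).add contDiff_const
  have hexp : ∀ x, Real.exp (-(2 * (ρ x - 1))) * Real.exp (2 * (ρ x - 1)) = 1 := fun x => by
    rw [← Real.exp_add]; simp
  have hA0 : ∀ x, 0 < A x := by
    intro x
    have h1 : 1 < ρ x := by
      have := mul_pos hR₁ (Real.sigmoid_pos x)
      simp only [hρdef]; linarith
    have h2 : ρ x < R₀ := by
      have := mul_lt_mul_of_pos_left (Real.sigmoid_lt_one x) hR₁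
      simp only [hρdef]; linarith
    have h3 : potential (ρ x) < potential R₀ :=
      strictMonoOn_potential (mem_Ici.2 h1.le) (mem_Ici.2 hR₀.le) h2
    unfold potential at h3
    have h4 := mul_lt_mul_of_pos_right h3 (Real.exp_pos (-(2 * (ρ x - 1))))
    have h5 : (ρ x - 3 / 2) * Real.exp (2 * (ρ x - 1)) * Real.exp (-(2 * (ρ x - 1))) =
        ρ x - 3 / 2 := by linear_combination (ρ x - 3 / 2) * hexp x
    rw [h5] at h4
    simp only [hA]
    linarith
  have hsc : ContDiff ℝ ∞ s := hAc.sqrt fun x => (hA0 x).ne'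
  have hs0 : ∀ x, 0 < s x := fun x => Real.sqrt_pos.2 (hA0 x)
  have hsq : ∀ x, s x ^ 2 = A x := fun x => Real.sq_sqrt (hA0 x).le
  have hk0 : ∀ x, k x ≠ 0 := fun x => (mul_pos hR₁ (mul_pos (Real.sigmoid_pos x)
    (sub_pos.2 (Real.sigmoid_lt_one x)))).ne'
  have hρk : ∀ x, HasDerivAt ρ (k x) x := fun x =>
    ((Real.hasDerivAt_sigmoid x).const_mul (R₀ - 1)).const_add 1
  have hsk : ∀ x, HasDerivAt s ((1 - ρ x - s x ^ 2) * k x / s x) x := by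
    intro x
    have h1 : HasDerivAt A _ x := ((((((hρk x).sub_const 1).const_mul 2).neg).exp.const_mul
      ((R₀ - 3 / 2) * Real.exp (2 * (R₀ - 1)))).sub (hρk x)).add_const (3 / 2)
    convert h1.sqrt (hA0 x).ne' using 1
    have h2 := hsq x
    simp only [hA] at h2
    have h3 := (hs0 x).ne'
    change _ = _ / (2 * s x)
    rw [div_eq_div_iff h3 (by positivity)]
    linear_combination (-2 * k x * s x) * h2
  have hder := cder_modelForm hs0 hk0 hρk hsk
  have hd0 : cder (S := E3) (modelForm ρ s k) 0 (fun z => ρ (z 0)) =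
      fun z => s (z 0) * Real.cos (z 2) := funext fun z => (hder z 0).1
  have hd1 : cder (S := E3) (modelForm ρ s k) 1 (fun z => ρ (z 0)) =
      fun z => s (z 0) * Real.sin (z 2) := funext fun z => (hder z 1).1
  refine ⟨modelForm ρ s k, fun z => ρ (z 0), isCartanStructure_modelForm hρ hsc hk hs0 hk0 hρk hsk,
    ⟨fun z => (hder z 2).1, fun z => ?_, fun z => ?_, fun z => ?_⟩, fun z => ?_⟩
  · rw [hd0]; exact (hder z 0).2.1
  · rw [hd0, hd1]; exact (hder z 1).2.1
  · rw [hd1]; exact (hder z 1).2.2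
  · unfold firstIntegral
    rw [hd0, hd1]
    have h1 := hsq (z 0)
    simp only [hA] at h1
    have h2 : (s (z 0) * Real.cos (z 2)) ^ 2 + (s (z 0) * Real.sin (z 2)) ^ 2 = s (z 0) ^ 2 := by
      linear_combination s (z 0) ^ 2 * Real.sin_sq_add_cos_sq (z 2)
    simp only [h2]
    linear_combination Real.exp (2 * (ρ (z 0) - 1)) * h1 +
      (R₀ - 3 / 2) * Real.exp (2 * (R₀ - 1)) * hexp (z 0)

end CartanLeaf

end

open CartanLeaf in
theorem theorem6p1 :
    -- every nontrivial structure determines R₀ and induces the metric of that parameter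
    (∀ (S : Type*) [TopologicalSpace S] [T2Space S] [ConnectedSpace S] [ChartedSpace E3 S]
        [IsManifold (𝓡 3) ∞ S] (α : Fin 3 → OneForm S) (R : S → ℝ),
      IsCartanStructure α R → SatisfiesEDS α R → (∃ x, R x ≠ 1) →
      ∃ R₀ : ℝ, 1 < R₀ ∧
        (∀ x, firstIntegral α R x = (R₀ - 3 / 2) * Real.exp (2 * (R₀ - 1))) ∧
        ∀ (V : Set S), IsOpen V →
        ∀ (L : Type*) [TopologicalSpace L] [T2Space L] [ChartedSpace E2 L]
          [IsManifold (𝓡 2) ∞ L] (pr : S → L), IsLeafSpace α V pr →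
          ∃ g : RMetric L, IsInduced α V pr g ∧
            (∀ g' : RMetric L, IsInduced α V pr g' → g' = g) ∧
            (∀ x ∈ V, (cder α 0 R x ≠ 0 ∨ cder α 1 R x ≠ 0) →
              ∃ e : OpenPartialHomeomorph L E2, pr x ∈ e.source ∧ IsPolarChart R₀ g e ∧
                ∀ y ∈ V, pr y ∈ e.source → R y = R₀ - (e (pr y) 0) ^ 2 / 4) ∧
            (∀ x ∈ V, R x = R₀ →
              ∃ e : OpenPartialHomeomorph L E2, pr x ∈ e.source ∧ IsPoleChart R₀ g (pr x) e ∧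
                ∀ y ∈ V, pr y ∈ e.source → R y = R₀ - ‖e (pr y)‖ ^ 2 / 4)) ∧
    -- every R₀ > 1 gives a smooth rotationally symmetric metric, and every R₀ > 1 occurs
    (∀ R₀ : ℝ, 1 < R₀ → IsSmoothRotational R₀ ∧
      ∃ (α : Fin 3 → OneForm E3) (R : E3 → ℝ), IsCartanStructure α R ∧ SatisfiesEDS α R ∧
        ∀ x, firstIntegral α R x = (R₀ - 3 / 2) * Real.exp (2 * (R₀ - 1))) := by
  refine ⟨?_, fun R₀ hR₀ => ⟨isSmoothRotational hR₀, exists_cartanStructure hR₀⟩⟩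
  intro S _ _ _ _ _ α R hα hR hne
  obtain ⟨R₀, hR₀, hc⟩ := exists_constant hα hR hne
  refine ⟨R₀, hR₀, hc, fun V hV L _ _ _ _ pr h => ?_⟩
  obtain ⟨g, hg⟩ := h.exists_metric hα hR hV
  have hi := h.isInduced hα hR hV hg
  exact ⟨g, hi, fun g' hg' => hi.unique h hg',
    fun x hx hpq => h.exists_polarChart hα hR hR₀ hc hV hg hx hpq,
    fun x hx hRx => h.exists_poleChart hα hR hR₀ hc hV hg hx hRx⟩
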